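/- Fix $m\ge 2$ and an alphabet $\{a_1,\dots,a_m\}$ with probabilities $p_1,\dots,p_m>0$, $\sum_j p_j=1$. An $m$-ary trie is built from $n$ independent infinite random strings whose letters are independent, with $a_j$ having probability $p_j$. Let $h=-\sum_j p_j\ln p_j$, and call the source periodic if $\log p_j/\log p_k$ is rational for all $j,k$, aperiodic otherwise. A motif is a trie shape; its size is its number of leaves (external nodes that hold a string). For a motif $T$ of size $\tau\ge2$ let $X_{n,T}$ be the number of nodes of the trie on $n$ strings at which the entire rooted subtree is equal to $T$, and let $\mathcal Q(T)$ be the probability that the trie grown on $\tau$ random strings is equal to $T$. Two motifs are nonoverlapping if neither appears as a subtree of the other. There are functions $\delta_T,\widehat\delta_T$ (for every motif $T$ of size $\ge 2$) and $\delta_{T,\widetilde T},\widehat\delta_{T,\widetilde T}$ (for every pair of nonoverlapping motifs), all fluctuating with average value zero in the following sense: each is a continuous function $g(\ln x)$ of $\ln x$; $g=0$ if the source is aperiodic; and if the source is periodic, $g$ is periodic with period $d$ and has mean zero over a period, where $d>0$ generates the additive group generated by the numbers $\ln p_j$. With these functions the following holds. (1) For every motif $T$ of size $\tau\ge2$, as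 $n\to\infty$, $$\mathrm{Var}[X_{n,T}]=\Bigl[A_T+\delta_T(n)-\bigl(B_T+\widehat\delta_T(n)\bigr)^2\Bigr]\,n+o(n),\qquad B_T=\frac{\mathcal Q(T)}{\tau(\tau-1)h},$$ $$A_T=\frac{\mathcal Q(T)}{\tau(\tau-1)h}-\frac{2\mathcal Q(T)^2}{h}\Bigl(\frac{2^{-2\tau}}{2\tau(2\tau-1)}\binom{2\tau}{\tau}+\frac1{(\tau!)^2}\sum_{j=0}^\infty(-1)^j\frac{\sum_{k=1}^m p_k^{j+\tau}}{1-\sum_{k=1}^m p_k^{j+\tau}}\cdot\frac{(j+2\tau-2)!}{j!}\Bigr).$$ (2) For every two nonoverlapping motifs $T,\widetilde T$, of sizes $\tau,\widetilde\tau$ (not necessarily equal), as $n\to\infty$, $$\begin{aligned}\mathrm{Cov}[X_{n,T},X_{n,\widetilde T}]=\Bigl[&C_{T,\widetilde T}+\tfrac12\bigl(\delta_{T,\widetilde T}(n)-\delta_T(n)-\delta_{\widetilde T}(n)\bigr)-\frac{\mathcal Q(T)\mathcal Q(\widetilde T)}{\tau(\tau-1)\widetilde\tau(\widetilde\tau-1)h^2}\\&+\frac1h\Bigl(\frac{\mathcal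 Q(T)}{\tau(\tau-1)}\bigl(\widehat\delta_T(n)-\widehat\delta_{T,\widetilde T}(n)\bigr)+\frac{\mathcal Q(\widetilde T)}{\widetilde\tau(\widetilde\tau-1)}\bigl(\widehat\delta_{\widetilde T}(n)-\widehat\delta_{T,\widetilde T}(n)\bigr)\Bigr)\\&-\tfrac12\bigl(\widehat\delta_{T,\widetilde T}(n)^2-\widehat\delta_T(n)^2-\widehat\delta_{\widetilde T}(n)^2\bigr)\Bigr]\,n+o(n),\end{aligned}$$ $$C_{T,\widetilde T}=-\frac{2\mathcal Q(T)\mathcal Q(\widetilde T)}{\tau!\,\widetilde\tau!\,h}\Bigl(2^{-\tau-\widetilde\tau}(\tau+\widetilde\tau-2)!+2^{-1}\sum_{j=0}^\infty(-1)^j\Bigl(\frac{\sum_k p_k^{\tau+j}}{1-\sum_k p_k^{\tau+j}}+\frac{\sum_k p_k^{\widetilde\tau+j}}{1-\sum_k p_k^{\widetilde\tau+j}}\Bigr)\frac{(\tau+\widetilde\tau+j-2)!}{j!}\Bigr).$$ (3) If the source is periodic, the error $o(n)$ in (1) and in (2) is $O(n^{1-\varepsilon})$ for some $0<\varepsilon<1$.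 (4) The fluctuating functions are those of the poissonized model: if $N_z$ is a Poisson variable with mean $z$ that is independent of the strings, then, as $z\to\infty$ through the reals, $\mathrm{Var}[X_{N_z,T}]=(A_T+\delta_T(z))z+o(z)$ and $\frac{d}{dz}\mathrm E[X_{N_z,T}]=B_T+\widehat\delta_T(z)+o(1)$; and, for $X_{N_z,T}+X_{N_z,\widetilde T}$ in place of $X_{N_z,T}$, the same holds with $A_T+A_{\widetilde T}+2C_{T,\widetilde T}$, $B_T+B_{\widetilde T}$, $\delta_{T,\widetilde T}$ and $\widehat\delta_{T,\widetilde T}$ in place of $A_T$, $B_T$, $\delta_T$ and $\widehat\delta_T$. -/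

import Mathlib

open MeasureTheory ProbabilityTheory Filter Asymptotics Topology
open scoped Nat

noncomputable section

namespace DigitalTree

/-- A memoryless source over the `m`-letter alphabet `Fin m`: letter `j` is emitted with
probability `prob j > 0`, and the probabilities sum to one. -/
structure Source (m : ℕ) where
  prob : Fin m → ℝ
  pos : ∀ j, 0 < prob j
  sum_eq_one : ∑ j, prob j = 1

/-- Finite words over the alphabet. -/
abbrev Word (m : ℕ) : Type := List (Fin m)

/-- The sample space: sequences `S 0, S 1, S 2, …` of infinite strings;
`S i k` is the `k`-th letter of the `i`-th string. -/
abbrev Strings (m : ℕ) : Type := ℕ → ℕ → Fin m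

namespace Source

variable {m : ℕ} (p : Source m)

/-- The law of one letter. -/
def letterLaw : Measure (Fin m) :=
  ∑ j, ENNReal.ofReal (p.prob j) • Measure.dirac j

instance : IsProbabilityMeasure p.letterLaw := ⟨by
  simp only [letterLaw, Measure.finsetSum_apply, Measure.smul_apply, measure_univ, smul_eq_mul,
    mul_one]
  rw [← ENNReal.ofReal_sum_of_nonneg (fun j _ => (p.pos j).le), p.sum_eq_one,
    ENNReal.ofReal_one]⟩

/-- The law of one infinite string: independent letters. -/
def stringLaw : Measure (ℕ → Fin m) := Measure.infinitePi fun _ : ℕ => p.letterLaw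

instance : IsProbabilityMeasure p.stringLaw := by unfold stringLaw; infer_instance

/-- The law of the whole sequence of strings: independent strings. -/
def law : Measure (Strings m) := Measure.infinitePi fun _ : ℕ => p.stringLaw

instance : IsProbabilityMeasure p.law := by unfold law; infer_instance

/-- The entropy `h = - ∑ p_j ln p_j`. -/
def entropy : ℝ := -∑ j, p.prob j * Real.log (p.prob j)

/-- The power sum `∑ p_k ^ r`. -/
def powerSum (r : ℕ) : ℝ := ∑ k, p.prob k ^ r

/-- The source is periodic if all the ratios `log p_j / log p_k` are rational. -/
def IsPeriodic : Prop :=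
  ∀ j k, ∃ q : ℚ, Real.log (p.prob j) / Real.log (p.prob k) = (q : ℝ)

end Source

/-- The finite word `w` is a prefix of the infinite string `s`. -/
def IsPrefixOf {m : ℕ} (w : Word m) (s : ℕ → Fin m) : Prop :=
  ∀ (k : ℕ) (hk : k < w.length), w[k] = s k

/-- The trie built from the first `n` strings, given by the words that lead from the root to its
external nodes: for each `i < n`, the shortest prefix of `S i` that is not a prefix of any other
of these strings. (Almost surely the strings are distinct and every such prefix exists.) -/
def trie {m : ℕ} (n : ℕ) (S : Strings m) : Set (Word m) :=
  {w | ∃ i < n, IsPrefixOf w (S i) ∧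
    (∀ j < n, j ≠ i → ¬ IsPrefixOf w (S j)) ∧
    ∀ v : Word m, v <+: w → v ≠ w → ∃ j < n, j ≠ i ∧ IsPrefixOf v (S j)}

/-- The subtree at the node `w`, again given by the words leading to its external nodes. -/
def subtree {m : ℕ} (L : Set (Word m)) (w : Word m) : Set (Word m) := {x | w ++ x ∈ L}

/-- A motif (trie shape): a finite set of words, leading to the external nodes, such that none of
the words is a prefix of another one, and each of them, when its last letter is removed, becomes
a prefix of another one. The one-leaf trie is `{[]}`. -/
structure Motif (m : ℕ) where
  leaves : Finset (Word m)
  prefix_free : ∀ w ∈ leaves, ∀ v ∈ leaves, w <+: v → w = v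
  branching : ∀ w ∈ leaves, w ≠ [] → ∃ v ∈ leaves, v ≠ w ∧ w.dropLast <+: v

namespace Motif

variable {m : ℕ}

/-- The size of a motif: its number of external nodes that hold a string. -/
def size (T : Motif m) : ℕ := T.leaves.card

/-- `T` appears as a subtree of `T'`. -/
def AppearsIn (T T' : Motif m) : Prop :=
  ∃ w : Word m, subtree (T'.leaves : Set (Word m)) w = (T.leaves : Set (Word m))

/-- Two motifs are nonoverlapping if neither appears as a subtree in the other. -/
def Nonoverlapping (T T' : Motif m) : Prop := ¬ T.AppearsIn T' ∧ ¬ T'.AppearsIn T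

/-- `X_{n,T}`: the number of occurrences of `T` on the fringe of the trie built from the first `n`
strings, i.e. the number of nodes `w` at which the entire subtree is equal to `T`. -/
def count (T : Motif m) (n : ℕ) (S : Strings m) : ℝ :=
  (Set.ncard {w : Word m | subtree (trie n S) w = (T.leaves : Set (Word m))} : ℝ)

/-- The shape functional `Q(T)`: the probability that the trie grown on `size T` random strings
coincides with `T`. -/
def shape (p : Source m) (T : Motif m) : ℝ :=
  p.law.real {S | trie T.size S = (T.leaves : Set (Word m))}

end Motif

section Coefficients

variable {m : ℕ} (p : Source m)

/-- `Q(T) / (τ (τ - 1) h)`. -/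
def meanCoeff (T : Motif m) : ℝ :=
  T.shape p / ((T.size : ℝ) * ((T.size : ℝ) - 1) * p.entropy)

/-- `Q(T)/(τ(τ-1)h) - (2 Q(T)²/h) (2^{-2τ}/(2τ(2τ-1)) binom(2τ, τ)
  + (1/τ!²) ∑_j (-1)^j (∑_k p_k^{j+τ} / (1 - ∑_k p_k^{j+τ})) (j+2τ-2)!/j!)`. -/
def varCoeff (T : Motif m) : ℝ :=
  meanCoeff p T - 2 * T.shape p ^ 2 / p.entropy *
    (((2 : ℝ) ^ (2 * T.size))⁻¹ / (2 * (T.size : ℝ) * (2 * (T.size : ℝ) - 1)) *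
        ((2 * T.size).choose T.size : ℝ)
      + 1 / ((T.size)! : ℝ) ^ 2 *
        ∑' j : ℕ, (-1 : ℝ) ^ j *
          (p.powerSum (j + T.size) / (1 - p.powerSum (j + T.size))) *
          (((j + 2 * T.size - 2)! : ℝ) / (j ! : ℝ)))

/-- `-(2 Q(T) Q(T')/(τ! τ'! h)) (2^{-τ-τ'} (τ+τ'-2)!
  + 2^{-1} ∑_j (-1)^j (∑_k p_k^{τ+j} / (1 - ∑_k p_k^{τ+j})
      + ∑_k p_k^{τ'+j} / (1 - ∑_k p_k^{τ'+j})) (τ+τ'+j-2)!/j!)`. -/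
def covCoeff (T T' : Motif m) : ℝ :=
  -(2 * T.shape p * T'.shape p / (((T.size)! : ℝ) * ((T'.size)! : ℝ) * p.entropy)) *
    (((2 : ℝ) ^ (T.size + T'.size))⁻¹ * ((T.size + T'.size - 2)! : ℝ)
      + 2⁻¹ * ∑' j : ℕ, (-1 : ℝ) ^ j *
          (p.powerSum (T.size + j) / (1 - p.powerSum (T.size + j))
            + p.powerSum (T'.size + j) / (1 - p.powerSum (T'.size + j))) *
          (((T.size + T'.size + j - 2)! : ℝ) / (j ! : ℝ)))

end Coefficients

section Poissonization

variable {m : ℕ} (p : Source m)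

/-- The Poisson transform `e^{-z} ∑ a_n z^n / n!`, i.e. the expectation of `a_N` for a Poisson
variable `N` with mean `z`. -/
def poissonize (a : ℕ → ℝ) (z : ℝ) : ℝ :=
  Real.exp (-z) * ∑' n : ℕ, a n * (z ^ n / (n ! : ℝ))

/-- The mean of `Y_N`, with `N` Poisson of mean `z` and independent of the strings. -/
def poissonMean (Y : ℕ → Strings m → ℝ) (z : ℝ) : ℝ :=
  poissonize (fun n => ∫ S, Y n S ∂p.law) z

/-- The variance of `Y_N`, with `N` Poisson of mean `z` and independent of the strings. -/
def poissonVar (Y : ℕ → Strings m → ℝ) (z : ℝ) : ℝ :=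
  poissonize (fun n => ∫ S, Y n S ^ 2 ∂p.law) z - poissonMean p Y z ^ 2

end Poissonization

/-- A (possibly zero) fluctuating function with average value zero: a continuous function of
`log x` that vanishes if the source is aperiodic, and that, if the source is periodic, is periodic
with mean zero over a period; a period is the positive generator `d` of the additive group
generated by the numbers `log p_j`. -/
def IsFluctuation {m : ℕ} (p : Source m) (δ : ℝ → ℝ) : Prop :=
  ∃ g : ℝ → ℝ, Continuous g ∧ (∀ x > 0, δ x = g (Real.log x)) ∧
    (¬ p.IsPeriodic → ∀ t, g t = 0) ∧
    (p.IsPeriodic → ∃ d > 0,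
      AddSubgroup.closure (Set.range fun j => Real.log (p.prob j)) = AddSubgroup.zmultiples d ∧
      Function.Periodic g d ∧ ∫ t in (0 : ℝ)..d, g t = 0)

/-- `δ` is the fluctuation of the linear term of the poissonized variance of `Y`, with constant
part `A`, and `δhat` is that of the derivative of the poissonized mean, with constant part `B`:
`Var[Y_{N_z}] = (A + δ z) z + o(z)` and `(d/dz) E[Y_{N_z}] = B + δhat z + o(1)`. -/
def ArePoissonFluctuations {m : ℕ} (p : Source m) (Y : ℕ → Strings m → ℝ) (A B : ℝ)
    (δ δhat : ℝ → ℝ) : Prop :=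
  IsFluctuation p δ ∧ IsFluctuation p δhat ∧
    ((fun z : ℝ => poissonVar p Y z - (A + δ z) * z) =o[atTop] fun z : ℝ => z) ∧
    Tendsto (fun z : ℝ => deriv (poissonMean p Y) z - (B + δhat z)) atTop (𝓝 0)

/-- `u n = c n * n + o(n)`, and the error is even `O(n^{1-ε})` for some `0 < ε < 1` if the source
is periodic. -/
def LinearAsymptotics {m : ℕ} (p : Source m) (u c : ℕ → ℝ) : Prop :=
  ((fun n : ℕ => u n - c n * n) =o[atTop] fun n : ℕ => (n : ℝ)) ∧
    (p.IsPeriodic → ∃ ε : ℝ, 0 < ε ∧ ε < 1 ∧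
      (fun n : ℕ => u n - c n * n) =O[atTop] fun n : ℕ => (n : ℝ) ^ (1 - ε))

end DigitalTree

end

open DigitalTree

/-! Almost surely the strings are distinct, and then `T` sits at the node w exactly when each leaf
of the copy of `T` at w carries one string and no other string passes through w
(`subtree_eq_of_config`, `config_of_subtree_eq`). At a node of probability x this has probability
(n)_τ κ x^τ (1-x)^(n-τ), κ being the product of the leaf probabilities, and a similar formula holds
for two incomparable nodes. At comparable nodes two motifs that are equal or nonoverlapping exclude
each other, except for one motif at one node. So the first two moments are explicit sums over words
(`hasSum_occProb`, `hasSum_joint`).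

With a Poisson number of strings, incomparable nodes become independent, and the covariance reduces
to a sum over comparable pairs. Below a node w one sees the same model with z replaced by z P(w), so
this sum collapses to z times a potential V(t) = Σ_w P(w) g(t + log P(w)) at t = log z
(`poissonCov_count`). The derivative of the mean is a potential too (`hasDerivAt_poissonMean`).

A potential solves the renewal equation V(t) = g(t) + Σ_j p_j V(t + log p_j). Integrating it shows
that a weighted window integral of V, of total weight h, tends to ∫ g (`Tame.tendsto_renewalMass`).
A strong maximum principle (`IsSubsolution.le_sub_mul`) does the rest: if the log p_j generate a
dense group, V tends to ∫ g / h; if they generate dℤ, the oscillation of V along each coset shrinks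
geometrically, and V approaches a d-periodic function of mean ∫ g / h at an exponential rate
(`Tame.exists_fluctuation`). The constants are the integrals of the functions g (`integral_covFun`,
`integral_slopeFun_div`).

The return to fixed n uses an expansion of the binomial weights to second order in 1/n
(`exists_abs_binomialWeight_sub_le`). The 1/n coefficient for a pair of nodes differs from the sum
of the single ones by -(τ - x)(τ' - y), a product of logarithmic derivatives
(`exists_pairProb_bound`). Summed over all pairs this gives Cov = n (V - f f') + O(1), where f and
f' are the derivatives of the two Poisson means (`exists_abs_covariance_sub_le`). -/

namespace DigitalTree

/-! ### Sums over words, split by first letter -/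

section WordSums

variable {α : Type*}

/-- A list is either empty or consists of a head and a tail. -/
def listEquivSum (α : Type*) : Unit ⊕ (Σ _ : α, List α) ≃ List α where
  toFun := Sum.elim (fun _ => []) fun x => x.1 :: x.2
  invFun
    | [] => Sum.inl ()
    | a :: l => Sum.inr ⟨a, l⟩
  left_inv := by rintro (_ | ⟨_, _⟩) <;> rfl
  right_inv := by rintro (_ | ⟨_, _⟩) <;> rfl

theorem ennreal_tsum_list [Fintype α] (f : List α → ENNReal) :
    ∑' w, f w = f [] + ∑ j, ∑' w, f (j :: w) := by
  rw [← (listEquivSum α).tsum_eq, ENNReal.summable.tsum_sum ENNReal.summable, ENNReal.tsum_sigma']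
  simp [listEquivSum, tsum_fintype]

theorem tsum_list [Fintype α] {f : List α → ℝ} (hf : Summable f) :
    ∑' w, f w = f [] + ∑ j, ∑' w, f (j :: w) := by
  have h := (listEquivSum α).summable_iff.2 hf
  have h1 : Summable (fun x : Σ _ : α, List α => f (x.1 :: x.2)) :=
    h.comp_injective Sum.inr_injective
  rw [← (listEquivSum α).tsum_eq, Summable.tsum_sum (f := fun x => f (listEquivSum α x))
    (Summable.of_finite) h1]
  congr 1
  · simp [listEquivSum]
  · exact (h1.tsum_sigma).trans (tsum_fintype _)

end WordSums

/-! ### Word probabilities and information contents -/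

variable {m : ℕ} (p : Source m)

namespace Source

/-- The probability that a random string begins with `w`. -/
noncomputable def wordProb (w : Word m) : ℝ := (w.map p.prob).prod

@[simp] theorem wordProb_nil : p.wordProb [] = 1 := by simp [wordProb]

@[simp] theorem wordProb_cons (j : Fin m) (w : Word m) :
    p.wordProb (j :: w) = p.prob j * p.wordProb w := by simp [wordProb]

@[simp] theorem wordProb_append (v w : Word m) :
    p.wordProb (v ++ w) = p.wordProb v * p.wordProb w := by simp [wordProb]

theorem wordProb_pos (w : Word m) : 0 < p.wordProb w := by
  induction w with
  | nil => simp
  | cons j w ih => simpa using mul_pos (p.pos j) ih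

theorem prob_le_one (j : Fin m) : p.prob j ≤ 1 := by
  rw [← p.sum_eq_one]
  exact Finset.single_le_sum (fun i _ => (p.pos i).le) (Finset.mem_univ j)

theorem wordProb_le_one (w : Word m) : p.wordProb w ≤ 1 := by
  induction w with
  | nil => simp
  | cons j w ih => simpa using mul_le_one₀ (p.prob_le_one j) (p.wordProb_pos w).le ih

variable {p} in
theorem prob_lt_one (hm : 2 ≤ m) (j : Fin m) : p.prob j < 1 := by
  have : Nontrivial (Fin m) := Fin.nontrivial_iff_two_le.2 hm
  obtain ⟨i, hi⟩ := exists_ne j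
  rw [← p.sum_eq_one]
  exact Finset.single_lt_sum hi (Finset.mem_univ j) (Finset.mem_univ i) (p.pos i)
    fun k _ _ => (p.pos k).le

/-- The information content `-log p_j` of a letter. -/
noncomputable def step (j : Fin m) : ℝ := -Real.log (p.prob j)

theorem exp_neg_step (j : Fin m) : Real.exp (-p.step j) = p.prob j := by
  simp [step, Real.exp_log (p.pos j)]

variable {p} in
theorem step_pos (hm : 2 ≤ m) (j : Fin m) : 0 < p.step j :=
  neg_pos.2 (Real.log_neg (p.pos j) (prob_lt_one hm j))

theorem entropy_eq : p.entropy = ∑ j, p.prob j * p.step j := by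
  simp [entropy, step]

variable {p} in
theorem entropy_pos (hm : 2 ≤ m) : 0 < p.entropy := by
  rw [entropy_eq]
  exact Finset.sum_pos (fun j _ => mul_pos (p.pos j) (step_pos hm j)) ⟨⟨0, by omega⟩, Finset.mem_univ _⟩

variable {p} in
theorem powerSum_lt_one (hm : 2 ≤ m) {r : ℕ} (hr : 2 ≤ r) : p.powerSum r < 1 := by
  rw [← p.sum_eq_one]
  refine Finset.sum_lt_sum_of_nonempty ⟨⟨0, by omega⟩, Finset.mem_univ _⟩ fun j _ => ?_
  exact pow_lt_self_of_lt_one₀ (p.pos j) (prob_lt_one hm j) (by omega)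

theorem powerSum_nonneg (r : ℕ) : 0 ≤ p.powerSum r :=
  Finset.sum_nonneg fun j _ => pow_nonneg (p.pos j).le r

end Source

/-! ### The logistic bump and its sum over words -/

/-- The logistic density `e^t / (1 + e^t)^2`. -/
noncomputable def bump (t : ℝ) : ℝ := Real.exp t / (1 + Real.exp t) ^ 2

theorem bump_pos (t : ℝ) : 0 < bump t := by unfold bump; positivity

theorem bump_le_exp (t : ℝ) : bump t ≤ Real.exp t := by
  unfold bump
  refine div_le_self (Real.exp_pos t).le ?_
  nlinarith [Real.exp_pos t]

theorem bump_le_exp_neg (t : ℝ) : bump t ≤ Real.exp (-t) := by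
  unfold bump
  rw [Real.exp_neg, div_le_iff₀ (by positivity), inv_mul_eq_div, le_div_iff₀ (Real.exp_pos t)]
  nlinarith [Real.exp_pos t]

theorem bump_le_one (t : ℝ) : bump t ≤ 1 := by
  unfold bump
  rw [div_le_one (by positivity)]
  nlinarith [Real.exp_pos t]

/-- A shift by at most 1 changes e^t by a factor at most e in either direction, and each term of the
cross-multiplied inequality costs at most one such factor. This is what turns derivative bounds into
local Lipschitz bounds. -/
theorem bump_le_of_abs_sub_le_one {s t : ℝ} (h : |s - t| ≤ 1) :
    bump s ≤ Real.exp 1 * bump t := by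
  obtain ⟨h1, h2⟩ := abs_le.1 h
  have e1 : Real.exp s ≤ Real.exp 1 * Real.exp t := by
    rw [← Real.exp_add]; exact Real.exp_le_exp.2 (by linarith)
  have e2 : Real.exp t ≤ Real.exp 1 * Real.exp s := by
    rw [← Real.exp_add]; exact Real.exp_le_exp.2 (by linarith)
  have e3 : 1 ≤ Real.exp 1 := Real.one_le_exp zero_le_one
  unfold bump
  rw [mul_div_assoc', div_le_div_iff₀ (by positivity) (by positivity)]
  have hs := Real.exp_pos s
  have ht := Real.exp_pos t
  set x := Real.exp s
  set y := Real.exp t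
  set e := Real.exp 1
  have i1 : y * (x * y) ≤ e * x * (x * y) := mul_le_mul_of_nonneg_right e2 (by positivity)
  have i2 : 2 * (x * y) ≤ 2 * (e * (x * y)) := by nlinarith [mul_pos hs ht]
  nlinarith

/-- The logistic function e^t/(1 + e^t) is a bounded supersolution of the renewal equation whose
defect controls `bump`; iterated, it dominates the potential of `bump`. Termwise the claim is 1 + xq
≤ 1 + x with x = e^t. -/
theorem bump_supersolution (t : ℝ) :
    bump t * (1 - p.powerSum 2) ≤ Real.exp t / (1 + Real.exp t) -
      ∑ j, p.prob j * (Real.exp (t - p.step j) / (1 + Real.exp (t - p.step j))) := by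
  have h1 : Real.exp t / (1 + Real.exp t) = ∑ j, p.prob j * (Real.exp t / (1 + Real.exp t)) := by
    rw [← Finset.sum_mul, p.sum_eq_one, one_mul]
  have h2 : bump t * (1 - p.powerSum 2) = ∑ j, bump t * (p.prob j - p.prob j ^ 2) := by
    rw [← Finset.mul_sum, Finset.sum_sub_distrib, p.sum_eq_one, Source.powerSum]
  rw [h1, h2, ← Finset.sum_sub_distrib]
  refine Finset.sum_le_sum fun j _ => ?_
  have hj := p.pos j
  have hj1 := p.prob_le_one j
  rw [sub_eq_add_neg t, Real.exp_add, p.exp_neg_step]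
  have ht := Real.exp_pos t
  unfold bump
  set x := Real.exp t
  set q := p.prob j
  have e : q * (x / (1 + x)) - q * (x * q / (1 + x * q)) =
      q * (x * (1 - q) / ((1 + x) * (1 + x * q))) := by
    field_simp
    ring
  have e' : x / (1 + x) ^ 2 * (q - q ^ 2) = q * (x * (1 - q) / ((1 + x) * (1 + x))) := by
    field_simp
  rw [e, e']
  refine mul_le_mul_of_nonneg_left ?_ hj.le
  refine div_le_div_of_nonneg_left (mul_nonneg ht.le (by linarith)) (by positivity) ?_
  exact mul_le_mul_of_nonneg_left (by nlinarith) (by positivity)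

theorem log_wordProb_cons (j : Fin m) (w : Word m) :
    Real.log (p.wordProb (j :: w)) = Real.log (p.wordProb w) - p.step j := by
  rw [p.wordProb_cons, Real.log_mul (p.pos j).ne' (p.wordProb_pos w).ne', Source.step]
  ring

variable {p}

/-- Truncation at a word length turns the comparison with the supersolution into an induction: split
off the first letter and apply the bound at the shifted argument. In `ENNReal` no summability has to
be known beforehand. -/
theorem tsum_bump_aux (hm : 2 ≤ m) (k : ℕ) : ∀ t : ℝ,
    ∑' w : Word m, (if w.length < k then
      ENNReal.ofReal (p.wordProb w * bump (t + Real.log (p.wordProb w))) else 0) ≤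
    ENNReal.ofReal ((1 - p.powerSum 2)⁻¹ * (Real.exp t / (1 + Real.exp t))) := by
  have hc : 0 < 1 - p.powerSum 2 := sub_pos.2 (Source.powerSum_lt_one hm le_rfl)
  induction k with
  | zero => intro t; simp
  | succ k ih =>
    intro t
    rw [ennreal_tsum_list]
    have : ∀ j, ∑' w : Word m, (if (j :: w).length < k + 1 then
      ENNReal.ofReal (p.wordProb (j :: w) * bump (t + Real.log (p.wordProb (j :: w)))) else 0) ≤
      ENNReal.ofReal (p.prob j * ((1 - p.powerSum 2)⁻¹ *
        (Real.exp (t - p.step j) / (1 + Real.exp (t - p.step j))))) := by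
      intro j
      rw [ENNReal.ofReal_mul (p.pos j).le]
      refine le_trans (le_of_eq ?_) (mul_le_mul_right (ih (t - p.step j)) _)
      rw [← ENNReal.tsum_mul_left]
      refine tsum_congr fun w => ?_
      simp only [List.length_cons, add_lt_add_iff_right, log_wordProb_cons]
      split_ifs
      · rw [p.wordProb_cons, mul_assoc, ENNReal.ofReal_mul (p.pos j).le]
        congr 4; ring
      · simp
    refine (add_le_add le_rfl (Finset.sum_le_sum fun j _ => this j)).trans ?_
    have nn : ∀ j, 0 ≤ p.prob j * ((1 - p.powerSum 2)⁻¹ *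
        (Real.exp (t - p.step j) / (1 + Real.exp (t - p.step j)))) := fun j => by
      have := p.pos j
      positivity
    rw [← ENNReal.ofReal_sum_of_nonneg (fun j _ => nn j)]
    simp only [List.length_nil, Nat.zero_lt_succ, if_true, p.wordProb_nil, Real.log_one, add_zero,
      one_mul]
    rw [← ENNReal.ofReal_add (bump_pos t).le (Finset.sum_nonneg fun j _ => nn j)]
    refine ENNReal.ofReal_le_ofReal ?_
    have h := bump_supersolution p t
    have : ∑ j, p.prob j * ((1 - p.powerSum 2)⁻¹ *
        (Real.exp (t - p.step j) / (1 + Real.exp (t - p.step j)))) = (1 - p.powerSum 2)⁻¹ *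
        ∑ j, p.prob j * (Real.exp (t - p.step j) / (1 + Real.exp (t - p.step j))) := by
      rw [Finset.mul_sum]
      exact Finset.sum_congr rfl fun j _ => by ring
    rw [this, inv_mul_eq_div, inv_mul_eq_div, le_div_iff₀ hc, add_mul, div_mul_cancel₀ _ hc.ne']
    linarith

theorem ennreal_tsum_bump_le (hm : 2 ≤ m) (t : ℝ) :
    ∑' w : Word m, ENNReal.ofReal (p.wordProb w * bump (t + Real.log (p.wordProb w))) ≤
    ENNReal.ofReal ((1 - p.powerSum 2)⁻¹ * (Real.exp t / (1 + Real.exp t))) := by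
  rw [ENNReal.tsum_eq_iSup_sum]
  refine iSup_le fun s => ?_
  -- A finite set of words is covered by the truncation just beyond its longest word.
  refine le_trans ?_ (tsum_bump_aux hm (s.sup List.length + 1) t)
  refine le_trans (le_of_eq ?_) (ENNReal.sum_le_tsum s)
  refine Finset.sum_congr rfl fun w hw => ?_
  rw [if_pos (Nat.lt_succ_of_le (Finset.le_sup (f := List.length) hw))]

theorem summable_bump (hm : 2 ≤ m) (t : ℝ) :
    Summable fun w : Word m => p.wordProb w * bump (t + Real.log (p.wordProb w)) := by
  have h := ne_top_of_le_ne_top ENNReal.ofReal_ne_top (ennreal_tsum_bump_le (p := p) hm t)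
  refine (ENNReal.summable_toReal h).congr fun w => ?_
  exact ENNReal.toReal_ofReal (mul_pos (p.wordProb_pos w) (bump_pos _)).le

theorem tsum_bump_le (hm : 2 ≤ m) (t : ℝ) :
    ∑' w : Word m, p.wordProb w * bump (t + Real.log (p.wordProb w)) ≤
      (1 - p.powerSum 2)⁻¹ * (Real.exp t / (1 + Real.exp t)) := by
  have hc : 0 < 1 - p.powerSum 2 := sub_pos.2 (Source.powerSum_lt_one hm le_rfl)
  rw [← ENNReal.ofReal_le_ofReal_iff (by positivity)]
  refine le_trans (le_of_eq ?_) (ennreal_tsum_bump_le hm t)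
  exact ENNReal.ofReal_tsum_of_nonneg
    (fun w => (mul_pos (p.wordProb_pos w) (bump_pos _)).le) (summable_bump hm t)

end DigitalTree

/-! ### Potentials of tame functions and the renewal equation -/

namespace DigitalTree

variable {m : ℕ} {p : Source m}

/-- `g` is dominated by a multiple of `bump`, and so is its local Lipschitz constant. -/
def Tame (g : ℝ → ℝ) (K : ℝ) : Prop :=
  (∀ t, |g t| ≤ K * bump t) ∧ ∀ s t, |s - t| ≤ 1 → |g s - g t| ≤ K * |s - t| * bump t

/-- The renewal potential `∑_w P(w) g(t + log P(w))`. -/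
noncomputable def potential (p : Source m) (g : ℝ → ℝ) (t : ℝ) : ℝ :=
  ∑' w : Word m, p.wordProb w * g (t + Real.log (p.wordProb w))

theorem summable_potential (hm : 2 ≤ m) {g : ℝ → ℝ} {K : ℝ} (hg : ∀ t, |g t| ≤ K * bump t) (t : ℝ) :
    Summable fun w : Word m => p.wordProb w * g (t + Real.log (p.wordProb w)) := by
  refine Summable.of_norm_bounded ((summable_bump (p := p) hm t).mul_left K) fun w => ?_
  rw [Real.norm_eq_abs, abs_mul, abs_of_pos (p.wordProb_pos w)]
  nlinarith [hg (t + Real.log (p.wordProb w)), p.wordProb_pos w]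

theorem abs_potential_le_of_le (hm : 2 ≤ m) {g : ℝ → ℝ} {K t s : ℝ} (hK : 0 ≤ K)
    (hg : ∀ w : Word m, |g (s + Real.log (p.wordProb w))| ≤
      K * bump (t + Real.log (p.wordProb w))) :
    |potential p g s| ≤ K * ((1 - p.powerSum 2)⁻¹ * (Real.exp t / (1 + Real.exp t))) := by
  have h : ∀ w : Word m, ‖p.wordProb w * g (s + Real.log (p.wordProb w))‖ ≤
      K * (p.wordProb w * bump (t + Real.log (p.wordProb w))) := fun w => by
    rw [Real.norm_eq_abs, abs_mul, abs_of_pos (p.wordProb_pos w)]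
    nlinarith [hg w, p.wordProb_pos w]
  refine (tsum_of_norm_bounded ((summable_bump (p := p) hm t).mul_left K).hasSum h).trans ?_
  rw [tsum_mul_left]
  exact mul_le_mul_of_nonneg_left (tsum_bump_le hm t) hK

theorem exp_div_one_add_exp_le_one (t : ℝ) : Real.exp t / (1 + Real.exp t) ≤ 1 := by
  rw [div_le_one (by positivity)]; linarith

theorem exp_div_one_add_exp_le_exp (t : ℝ) : Real.exp t / (1 + Real.exp t) ≤ Real.exp t :=
  div_le_self (Real.exp_pos t).le (by linarith [Real.exp_pos t])

theorem inv_one_sub_powerSum_pos (hm : 2 ≤ m) : 0 < (1 - p.powerSum 2)⁻¹ :=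
  inv_pos.2 (sub_pos.2 (Source.powerSum_lt_one hm le_rfl))

theorem continuous_of_abs_sub_le {f : ℝ → ℝ} {K : ℝ} (hK : 0 ≤ K)
    (hf : ∀ s t, |s - t| ≤ 1 → |f s - f t| ≤ K * |s - t|) : Continuous f := by
  rw [Metric.continuous_iff]
  intro t ε hε
  refine ⟨min 1 (ε / (K + 1)), by positivity, fun s hs => ?_⟩
  rw [Real.dist_eq] at hs ⊢
  have h1 := hf s t (hs.le.trans (min_le_left _ _))
  have h2 := hs.trans_le (min_le_right _ _)
  rw [lt_div_iff₀ (by positivity)] at h2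
  nlinarith [abs_nonneg (s - t)]

namespace Tame

variable {g : ℝ → ℝ} {K : ℝ}

theorem nonneg (hg : Tame g K) : 0 ≤ K := by
  have h := (abs_nonneg _).trans (hg.1 0)
  exact nonneg_of_mul_nonneg_left h (bump_pos 0)

theorem neg (hg : Tame g K) : Tame (fun t => -g t) K := by
  refine ⟨fun t => by simpa using hg.1 t, fun s t h => ?_⟩
  have := hg.2 s t h
  rwa [← abs_neg, show -(-g s - -g t) = g s - g t by ring]

theorem continuous (hg : Tame g K) : Continuous g :=
  continuous_of_abs_sub_le hg.nonneg fun s t h => (hg.2 s t h).trans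
    (mul_le_of_le_one_right (mul_nonneg hg.nonneg (abs_nonneg _)) (bump_le_one t))

/-- The renewal equation: the empty word contributes g, and the words with a given first letter form
a shifted copy of the whole sum. -/
theorem potential_eq (hm : 2 ≤ m) (hg : Tame g K) (t : ℝ) :
    potential p g t = g t + ∑ j, p.prob j * potential p g (t - p.step j) := by
  unfold potential
  rw [tsum_list (summable_potential hm hg.1 t)]
  simp only [p.wordProb_nil, Real.log_one, add_zero, one_mul, log_wordProb_cons]
  congr 1
  refine Finset.sum_congr rfl fun j _ => ?_
  rw [← tsum_mul_left]
  refine tsum_congr fun w => ?_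
  rw [p.wordProb_cons, mul_assoc]
  congr 3
  ring

theorem abs_potential_le (hm : 2 ≤ m) (hg : Tame g K) (t : ℝ) :
    |potential p g t| ≤ K * (1 - p.powerSum 2)⁻¹ := by
  refine (abs_potential_le_of_le hm hg.nonneg fun w => hg.1 _).trans ?_
  refine mul_le_mul_of_nonneg_left ?_ hg.nonneg
  exact mul_le_of_le_one_right (inv_one_sub_powerSum_pos hm).le (exp_div_one_add_exp_le_one t)

theorem abs_potential_le_exp (hm : 2 ≤ m) (hg : Tame g K) (t : ℝ) :
    |potential p g t| ≤ K * (1 - p.powerSum 2)⁻¹ * Real.exp t := by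
  refine (abs_potential_le_of_le hm hg.nonneg fun w => hg.1 _).trans ?_
  rw [mul_assoc]
  refine mul_le_mul_of_nonneg_left ?_ hg.nonneg
  exact mul_le_mul_of_nonneg_left (exp_div_one_add_exp_le_exp t) (inv_one_sub_powerSum_pos hm).le

/-- The increment is itself the potential of u ↦ g(u + (s - t)) - g(u), which tameness bounds by K
|s - t| times `bump`. -/
theorem abs_potential_sub_le (hm : 2 ≤ m) (hg : Tame g K) {s t : ℝ} (h : |s - t| ≤ 1) :
    |potential p g s - potential p g t| ≤ K * (1 - p.powerSum 2)⁻¹ * |s - t| := by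
  have e : potential p g s - potential p g t = potential p (fun u => g (u + (s - t)) - g u) t := by
    unfold potential
    rw [← (summable_potential hm hg.1 s).tsum_sub (summable_potential hm hg.1 t)]
    refine tsum_congr fun w => ?_
    rw [← mul_sub]
    congr 3
    ring
  rw [e]
  refine (abs_potential_le_of_le (K := K * |s - t|) (t := t) hm
    (mul_nonneg hg.nonneg (abs_nonneg _)) fun w => ?_).trans ?_
  · have := hg.2 (t + Real.log (p.wordProb w) + (s - t)) (t + Real.log (p.wordProb w))
      (by simpa using h)
    simpa using this
  · have := mul_le_of_le_one_right (inv_one_sub_powerSum_pos (p := p) hm).le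
      (exp_div_one_add_exp_le_one t)
    calc _ ≤ K * |s - t| * (1 - p.powerSum 2)⁻¹ :=
          mul_le_mul_of_nonneg_left this (mul_nonneg hg.nonneg (abs_nonneg _))
      _ = _ := by ring

theorem continuous_potential (hm : 2 ≤ m) (hg : Tame g K) : Continuous (potential p g) :=
  continuous_of_abs_sub_le (mul_nonneg hg.nonneg (inv_one_sub_powerSum_pos hm).le)
    fun _ _ h => hg.abs_potential_sub_le hm h

theorem integrable (hg : Tame g K) : Integrable g := by
  have hK := hg.nonneg
  have hb : ∀ t, ‖g t‖ ≤ K * Real.exp (-|t|) := fun t => by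
    refine (hg.1 t).trans (mul_le_mul_of_nonneg_left ?_ hK)
    rcases abs_cases t with ⟨h, _⟩ | ⟨h, _⟩ <;> rw [h]
    · exact bump_le_exp_neg t
    · simpa using bump_le_exp t
  refine Integrable.mono' (Integrable.const_mul ?_ K) hg.continuous.aestronglyMeasurable
    (Eventually.of_forall hb)
  rw [← integrableOn_univ, ← Set.Iic_union_Ioi (a := (0 : ℝ))]
  refine IntegrableOn.union ?_ ?_
  · refine (integrableOn_exp_Iic 0).congr_fun (fun t ht => ?_) measurableSet_Iic
    simp [abs_of_nonpos (Set.mem_Iic.1 ht)]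
  · refine (integrableOn_exp_neg_Ioi 0).congr_fun (fun t ht => ?_) measurableSet_Ioi
    simp [abs_of_pos (Set.mem_Ioi.1 ht)]

end Tame

/-- The mass `∑_j p_j ∫_{t - ℓ_j}^t V`, which a renewal function conserves. -/
noncomputable def renewalMass (p : Source m) (V : ℝ → ℝ) (t : ℝ) : ℝ :=
  ∑ j, p.prob j * ∫ s in (t - p.step j)..t, V s

/-- Integrating the renewal equation over [a, t] telescopes to the difference of the masses at t and
a. The mass at a vanishes as a → -∞ because the potential is O(e^a), so the mass at t is the
integral of g up to t. -/
theorem Tame.tendsto_renewalMass (hm : 2 ≤ m) {g : ℝ → ℝ} {K : ℝ} (hg : Tame g K) :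
    Tendsto (renewalMass p (potential p g)) atTop (𝓝 (∫ t, g t)) := by
  have hV := hg.continuous_potential (p := p) hm
  have hint : ∀ a b, IntervalIntegrable (potential p g) volume a b := fun a b =>
    hV.intervalIntegrable a b
  have key : ∀ a t, ∫ s in a..t, g s =
      renewalMass p (potential p g) t - renewalMass p (potential p g) a := by
    intro a t
    have h1 : ∀ s, g s = ∑ j, p.prob j * (potential p g s - potential p g (s - p.step j)) := by
      intro s
      simp only [mul_sub, Finset.sum_sub_distrib, ← Finset.sum_mul, p.sum_eq_one]
      linarith [hg.potential_eq (p := p) hm s]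
    unfold renewalMass
    rw [← Finset.sum_sub_distrib]
    calc ∫ s in a..t, g s
        = ∫ s in a..t, ∑ j, p.prob j * (potential p g s - potential p g (s - p.step j)) := by
          congr 1; exact funext h1
      _ = _ := by
        rw [intervalIntegral.integral_finsetSum]
        · refine Finset.sum_congr rfl fun j _ => ?_
          have hs : IntervalIntegrable (fun s => potential p g (s - p.step j)) volume a t :=
            Continuous.intervalIntegrable (by fun_prop) _ _
          rw [intervalIntegral.integral_const_mul, intervalIntegral.integral_sub (hint _ _) hs,
            intervalIntegral.integral_comp_sub_right, ← mul_sub]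
          have e1 := intervalIntegral.integral_add_adjacent_intervals (hint a (t - p.step j))
            (hint (t - p.step j) t)
          have e2 := intervalIntegral.integral_add_adjacent_intervals (hint (a - p.step j) a)
            (hint a (t - p.step j))
          linear_combination p.prob j * e2 - p.prob j * e1
        · intro j _
          exact (Continuous.intervalIntegrable (by fun_prop) _ _)
  have hbot : Tendsto (renewalMass p (potential p g)) atBot (𝓝 0) := by
    rw [show (0 : ℝ) = ∑ j : Fin m, p.prob j * 0 by simp]
    refine tendsto_finsetSum _ fun j _ => Tendsto.const_mul _ ?_
    refine squeeze_zero_norm (a := fun t => K * (1 - p.powerSum 2)⁻¹ * Real.exp t * p.step j)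
      (fun t => ?_) ?_
    · refine (intervalIntegral.norm_integral_le_of_norm_le_const
        (C := K * (1 - p.powerSum 2)⁻¹ * Real.exp t) fun s hs => ?_).trans ?_
      · rw [Set.uIoc_of_le (by linarith [Source.step_pos (p := p) hm j])] at hs
        refine (hg.abs_potential_le_exp hm s).trans ?_
        exact mul_le_mul_of_nonneg_left (Real.exp_le_exp.2 hs.2)
          (mul_nonneg hg.nonneg (inv_one_sub_powerSum_pos hm).le)
      · rw [sub_sub_cancel, abs_of_pos (Source.step_pos hm j)]
    · simpa using (Real.tendsto_exp_atBot.const_mul (K * (1 - p.powerSum 2)⁻¹)).mul_const (p.step j)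
  have hcum : ∀ t, renewalMass p (potential p g) t = ∫ s in Set.Iic t, g s := by
    intro t
    have h1 := intervalIntegral_tendsto_integral_Iic t hg.integrable.integrableOn tendsto_id
    have h2 : Tendsto (fun a => ∫ s in a..t, g s) atBot
        (𝓝 (renewalMass p (potential p g) t - 0)) := by
      simp only [key]
      exact tendsto_const_nhds.sub hbot
    simpa using tendsto_nhds_unique h2 h1
  have := AECover.integral_tendsto_of_countably_generated
    (aecover_Iic (μ := volume) (tendsto_id (α := ℝ) (x := atTop))) hg.integrable
  exact this.congr fun t => (hcum t).symm

end DigitalTree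

/-! ### The semigroup of information contents, the maximum principle, and dense step groups -/

namespace DigitalTree

/-- With N = ⌊x/b⌋, the elements i a + (N - i) b climb from N b ≤ x in steps of a - b. The steps
needed to come within a - b of x number at most N once N ≥ b/(a - b), which dictates R. -/
theorem exists_mem_Ioc_of_sub_mem {S : AddSubmonoid ℝ} {a b : ℝ} (ha : a ∈ S) (hb : b ∈ S)
    (hb0 : 0 < b) (hab : b < a) :
    ∃ R : ℝ, 0 ≤ R ∧ ∀ x, R ≤ x → ∃ c ∈ S, x - (a - b) < c ∧ c ≤ x := by
  have hs : 0 < a - b := sub_pos.2 hab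
  refine ⟨⌈b / (a - b)⌉₊ * b, by positivity, fun x hx => ?_⟩
  have hx0 : 0 ≤ x := le_trans (by positivity) hx
  set N := ⌊x / b⌋₊
  have hN1 : (N : ℝ) * b ≤ x := (le_div_iff₀ hb0).1 (Nat.floor_le (by positivity))
  have hN2 : x < (N + 1) * b := (div_lt_iff₀ hb0).1 (Nat.lt_floor_add_one _)
  have hN3 : ⌈b / (a - b)⌉₊ ≤ N := Nat.le_floor ((le_div_iff₀ hb0).2 hx)
  set y := x - N * b
  have hy0 : 0 ≤ y := sub_nonneg.2 hN1
  have hyb : y < b := by simp only [y]; linarith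
  set i := ⌊y / (a - b)⌋₊
  have hi1 : (i : ℝ) * (a - b) ≤ y := (le_div_iff₀ hs).1 (Nat.floor_le (by positivity))
  have hi2 : y < (i + 1) * (a - b) := (div_lt_iff₀ hs).1 (Nat.lt_floor_add_one _)
  have hiN : i ≤ N := by
    refine le_trans ?_ hN3
    refine (Nat.floor_le_ceil _).trans (Nat.ceil_le_ceil ?_)
    gcongr
  refine ⟨i • a + (N - i) • b, S.add_mem (S.nsmul_mem ha _) (S.nsmul_mem hb _), ?_⟩
  rw [nsmul_eq_mul, nsmul_eq_mul, Nat.cast_sub hiN]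
  simp only [y] at hi1 hi2
  constructor <;> linarith

theorem exists_sub_of_mem_closure {X : Set ℝ} {x : ℝ} (hx : x ∈ AddSubgroup.closure X) :
    ∃ a ∈ AddSubmonoid.closure X, ∃ b ∈ AddSubmonoid.closure X, x = a - b := by
  induction hx using AddSubgroup.closure_induction with
  | mem x hx => exact ⟨x, AddSubmonoid.subset_closure hx, 0, zero_mem _, by simp⟩
  | zero => exact ⟨0, zero_mem _, 0, zero_mem _, by simp⟩
  | add x y _ _ hx hy =>
    obtain ⟨a, ha, b, hb, rfl⟩ := hx
    obtain ⟨a', ha', b', hb', rfl⟩ := hy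
    exact ⟨a + a', add_mem ha ha', b + b', add_mem hb hb', by ring⟩
  | neg x _ hx =>
    obtain ⟨a, ha, b, hb, rfl⟩ := hx
    exact ⟨b, hb, a, ha, by ring⟩

variable {m : ℕ} {p : Source m}

namespace Source

variable (p) in
/-- The information contents of the nonempty words and zero. -/
noncomputable def stepMonoid : AddSubmonoid ℝ := AddSubmonoid.closure (Set.range p.step)

variable (p) in
/-- The group generated by the information contents of the letters. -/
noncomputable def stepGroup : AddSubgroup ℝ := AddSubgroup.closure (Set.range p.step)

theorem stepMonoid_le {a : ℝ} (ha : a ∈ p.stepMonoid) : a ∈ p.stepGroup :=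
  (show p.stepMonoid ≤ p.stepGroup.toAddSubmonoid from
    AddSubmonoid.closure_le.2 AddSubgroup.subset_closure) ha

theorem step_mem (j : Fin m) : p.step j ∈ p.stepGroup := AddSubgroup.subset_closure ⟨j, rfl⟩

theorem stepMonoid_nonneg (hm : 2 ≤ m) {a : ℝ} (ha : a ∈ p.stepMonoid) : 0 ≤ a := by
  induction ha using AddSubmonoid.closure_induction with
  | mem x hx => obtain ⟨j, rfl⟩ := hx; exact (step_pos hm j).le
  | zero => rfl
  | add x y _ _ hx hy => exact add_nonneg hx hy

theorem exists_mem_stepMonoid (hm : 2 ≤ m) {d : ℝ} (hd : 0 < d) (hdG : d ∈ p.stepGroup) :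
    ∃ R : ℝ, 0 ≤ R ∧ ∀ x, R ≤ x → ∃ c ∈ p.stepMonoid, x - d < c ∧ c ≤ x := by
  obtain ⟨a, ha, b, hb, rfl⟩ := exists_sub_of_mem_closure hdG
  -- Adding one letter to both terms keeps their difference and makes the smaller one positive.
  have h0 : p.step ⟨0, by omega⟩ ∈ p.stepMonoid := AddSubmonoid.subset_closure ⟨_, rfl⟩
  have h := exists_mem_Ioc_of_sub_mem (add_mem ha h0) (add_mem hb h0)
    (add_pos_of_nonneg_of_pos (stepMonoid_nonneg hm hb) (step_pos hm _)) (by linarith)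
  simpa [stepMonoid] using h

variable (p) in
/-- An upper bound for the information contents of the letters. -/
noncomputable def totalStep : ℝ := ∑ j, p.step j

theorem step_le_totalStep (hm : 2 ≤ m) (j : Fin m) : p.step j ≤ p.totalStep :=
  Finset.single_le_sum (fun i _ => (step_pos hm i).le) (Finset.mem_univ j)

theorem totalStep_nonneg (hm : 2 ≤ m) : 0 ≤ p.totalStep :=
  Finset.sum_nonneg fun i _ => (step_pos hm i).le

theorem exists_le_step (hm : 2 ≤ m) : ∃ σ > 0, ∀ j, σ ≤ p.step j := by
  have : Nonempty (Fin m) := ⟨⟨0, by omega⟩⟩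
  obtain ⟨i, hi⟩ := Finite.exists_min p.step
  exact ⟨p.step i, step_pos hm i, hi⟩

end Source

/-- `Y` lies below its average over one letter. -/
def IsSubsolution (p : Source m) (Y : ℝ → ℝ) : Prop :=
  ∀ s, Y s ≤ ∑ j, p.prob j * Y (s - p.step j)

/-- Strong maximum principle. A deficit B - Y at t - a reaches t along a word of information content
a, reduced by the probability η of that word. The bound B is needed only on the coset of t, which
serves the periodic case; the margin `totalStep` keeps all averaged points beyond t₀. -/
theorem IsSubsolution.le_sub_mul (hm : 2 ≤ m) {a : ℝ} (ha : a ∈ p.stepMonoid) :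
    ∃ η > 0, ∀ Y, IsSubsolution p Y → ∀ B t₀ t,
      (∀ s, t₀ ≤ s → s - t ∈ p.stepGroup → Y s ≤ B) → t₀ + a + p.totalStep ≤ t →
      Y t ≤ B - η * (B - Y (t - a)) := by
  induction ha using AddSubmonoid.closure_induction with
  | mem x hx =>
    obtain ⟨j, rfl⟩ := hx
    refine ⟨p.prob j, p.pos j, fun Y hY B t₀ t hB ht => (hY t).trans ?_⟩
    have h1 : ∀ i, Y (t - p.step i) ≤ B := fun i => by
      refine hB _ ?_ ?_
      · linarith [Source.step_pos (p := p) hm j, Source.step_le_totalStep (p := p) hm i]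
      · rw [sub_sub_cancel_left]; exact neg_mem (Source.step_mem i)
    have h2 : ∑ i, p.prob i * (B - Y (t - p.step i)) = B - ∑ i, p.prob i * Y (t - p.step i) := by
      simp only [mul_sub, Finset.sum_sub_distrib, ← Finset.sum_mul, p.sum_eq_one, one_mul]
    have h3 : p.prob j * (B - Y (t - p.step j)) ≤ ∑ i, p.prob i * (B - Y (t - p.step i)) :=
      Finset.single_le_sum (f := fun i => p.prob i * (B - Y (t - p.step i)))
        (fun i _ => mul_nonneg (p.pos i).le (sub_nonneg.2 (h1 i))) (Finset.mem_univ j)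
    linarith
  | zero => exact ⟨1, one_pos, fun Y _ B t₀ t _ _ => by simp⟩
  | add x y hx hy hx' hy' =>
    obtain ⟨η, hη, h⟩ := hx'
    obtain ⟨η', hη', h'⟩ := hy'
    refine ⟨η * η', mul_pos hη hη', fun Y hY B t₀ t hB ht => ?_⟩
    have hx0 := Source.stepMonoid_nonneg hm hx
    have hy0 := Source.stepMonoid_nonneg hm hy
    have e1 := h Y hY B t₀ t hB (by linarith)
    have e2 := h' Y hY B t₀ (t - x) (fun s hs hst => hB s hs ?_) (by linarith)
    · rw [sub_sub] at e2
      nlinarith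
    · have := sub_mem hst (Source.stepMonoid_le hx)
      rwa [show s - (t - x) - x = s - t by ring] at this

theorem IsSubsolution.le_sub_mul_finset (hm : 2 ≤ m) (F : Finset ℝ)
    (hF : ∀ a ∈ F, a ∈ p.stepMonoid) :
    ∃ η > 0, ∀ a ∈ F, ∀ Y, IsSubsolution p Y → ∀ B t₀ t,
      (∀ s, t₀ ≤ s → s - t ∈ p.stepGroup → Y s ≤ B) → t₀ + a + p.totalStep ≤ t →
      Y t ≤ B - η * (B - Y (t - a)) := by
  induction F using Finset.induction_on with
  | empty => exact ⟨1, one_pos, by simp⟩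
  | insert a F _ ih =>
    obtain ⟨η, hη, h⟩ := ih fun b hb => hF b (Finset.mem_insert_of_mem hb)
    have haS := hF a (Finset.mem_insert_self a F)
    obtain ⟨η', hη', h'⟩ := IsSubsolution.le_sub_mul hm haS
    -- Decreasing η weakens the estimate, because Y(t - b) ≤ B.
    have mono : ∀ b ∈ p.stepMonoid, ∀ (Y : ℝ → ℝ) (B t₀ t : ℝ) (η₁ η₂ : ℝ), η₁ ≤ η₂ →
        (∀ s, t₀ ≤ s → s - t ∈ p.stepGroup → Y s ≤ B) → t₀ + b + p.totalStep ≤ t →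
        Y t ≤ B - η₂ * (B - Y (t - b)) → Y t ≤ B - η₁ * (B - Y (t - b)) := by
      intro b hb Y B t₀ t η₁ η₂ h12 hB ht h
      have : Y (t - b) ≤ B := hB _ (by linarith [Source.totalStep_nonneg (p := p) hm]) (by
        rw [sub_sub_cancel_left]; exact neg_mem (Source.stepMonoid_le hb))
      nlinarith
    refine ⟨min η η', lt_min hη hη', fun b hb Y hY B t₀ t hB ht => ?_⟩
    rcases Finset.mem_insert.1 hb with rfl | hb'
    · exact mono b haS Y B t₀ t _ _ (min_le_right _ _) hB ht (h' Y hY B t₀ t hB ht)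
    · exact mono b (hF b hb) Y B t₀ t _ _ (min_le_left _ _) hB ht (h b hb' Y hY B t₀ t hB ht)

/-- Beyond the window a value is at most an average of values between σ and `totalStep` earlier, so
the bound advances by σ, a lower bound of the information contents, at a time. -/
theorem IsSubsolution.le_of_le_window (hm : 2 ≤ m) {Y : ℝ → ℝ} (hY : IsSubsolution p Y)
    {B s₀ τ : ℝ}
    (hB : ∀ s, s₀ ≤ s → s ≤ s₀ + p.totalStep → s - τ ∈ p.stepGroup → Y s ≤ B) (s : ℝ)
    (hs : s₀ ≤ s) (hsτ : s - τ ∈ p.stepGroup) : Y s ≤ B := by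
  obtain ⟨σ, hσ, hσj⟩ := Source.exists_le_step (p := p) hm
  have key : ∀ n : ℕ, ∀ s, s₀ ≤ s → s ≤ s₀ + p.totalStep + n * σ → s - τ ∈ p.stepGroup →
      Y s ≤ B := by
    intro n
    induction n with
    | zero => simpa using hB
    | succ n ih =>
      intro s h1 h2 h3
      by_cases h4 : s ≤ s₀ + p.totalStep
      · exact hB s h1 h4 h3
      refine (hY s).trans ?_
      calc ∑ j, p.prob j * Y (s - p.step j) ≤ ∑ j, p.prob j * B := by
            refine Finset.sum_le_sum fun j _ => mul_le_mul_of_nonneg_left ?_ (p.pos j).le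
            refine ih _ ?_ ?_ ?_
            · linarith [Source.step_le_totalStep (p := p) hm j]
            · push_cast at h2; linarith [hσj j]
            · rw [sub_right_comm]; exact sub_mem h3 (Source.step_mem j)
        _ = B := by rw [← Finset.sum_mul, p.sum_eq_one, one_mul]
  obtain ⟨n, hn⟩ := exists_nat_ge ((s - s₀ - p.totalStep) / σ)
  refine key n s hs ?_ hsτ
  rw [div_le_iff₀ hσ] at hn
  linarith

/-- Averaging e^(-s) over one letter multiplies it by m, since p_j e^(ℓ_j) = 1 for ℓ_j = -log p_j.
As m ≥ 2, the gain (m - 1) K e^(-s) absorbs g, which is at most K e^(-s). -/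
theorem Tame.isSubsolution (hm : 2 ≤ m) {g : ℝ → ℝ} {K : ℝ} (hg : Tame g K) :
    IsSubsolution p fun s => potential p g s + K * Real.exp (-s) := by
  intro s
  have h1 : ∀ j, p.prob j * Real.exp (-(s - p.step j)) = Real.exp (-s) := by
    intro j
    rw [neg_sub', sub_neg_eq_add, Real.exp_add, ← p.exp_neg_step j, mul_comm, mul_assoc,
      ← Real.exp_add]
    simp
  have h2 : ∑ j, p.prob j * (potential p g (s - p.step j) + K * Real.exp (-(s - p.step j))) =
      ∑ j, p.prob j * potential p g (s - p.step j) + m * (K * Real.exp (-s)) := by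
    simp only [mul_add, Finset.sum_add_distrib]
    congr 1
    rw [Finset.sum_congr rfl fun j _ => show p.prob j * (K * Real.exp (-(s - p.step j))) =
      K * Real.exp (-s) by rw [mul_left_comm, h1]]
    simp
  simp only [h2]
  have h3 : g s ≤ K * Real.exp (-s) := (le_abs_self _).trans
    ((hg.1 s).trans (mul_le_mul_of_nonneg_left (bump_le_exp_neg s) hg.nonneg))
  have h4 := hg.potential_eq (p := p) hm s
  have h5 : (2 : ℝ) ≤ m := by exact_mod_cast hm
  nlinarith [mul_nonneg hg.nonneg (Real.exp_pos (-s)).le]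

theorem potential_neg (g : ℝ → ℝ) (t : ℝ) : potential p (fun t => -g t) t = -potential p g t := by
  simp [potential, tsum_neg]

/-- Let M be the limsup of V. At a time t where V(t) is nearly M, the maximum principle makes V
nearly M at points t - c_i, which by density of the group can form a fine net of a window of length
`totalStep`; Lipschitz continuity fills the gaps. The mass there is then at least (M - ε) h, and
since the mass tends to ∫ g, M is at most ∫ g / h. -/
theorem Tame.eventually_potential_lt (hm : 2 ≤ m) {g : ℝ → ℝ} {K : ℝ} (hg : Tame g K)
    (hdense : ∀ ε > 0, ∃ d ∈ p.stepGroup, 0 < d ∧ d < ε) {ε : ℝ} (hε : 0 < ε) :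
    ∀ᶠ t in atTop, potential p g t < (∫ t, g t) / p.entropy + ε := by
  have hh := Source.entropy_pos (p := p) hm
  set V := potential p g
  set M := limsup V atTop
  have hb1 : IsBoundedUnder (· ≤ ·) atTop V :=
    isBoundedUnder_of ⟨_, fun t => (abs_le.1 (hg.abs_potential_le (p := p) hm t)).2⟩
  have hb2 : IsBoundedUnder (· ≥ ·) atTop V :=
    isBoundedUnder_of ⟨_, fun t => (abs_le.1 (hg.abs_potential_le (p := p) hm t)).1⟩
  suffices hM : M ≤ (∫ t, g t) / p.entropy from
    eventually_lt_of_limsup_lt (lt_of_le_of_lt hM (by linarith)) hb1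
  refine le_of_forall_pos_le_add fun ε hε => ?_
  by_contra! hlt
  rw [← lt_sub_iff_add_lt, div_lt_iff₀ hh] at hlt
  obtain ⟨T₁, hT₁⟩ := eventually_atTop.1 ((hg.tendsto_renewalMass (p := p) hm).eventually_lt_const hlt)
  have hc := inv_one_sub_powerSum_pos (p := p) hm
  have hK := hg.nonneg
  -- The mesh s is so fine that V varies by at most ε/2 over it.
  obtain ⟨s, hsG, hs0, hs⟩ := hdense (min 1 (ε / (2 * (K * (1 - p.powerSum 2)⁻¹ + 1)))) (by positivity)
  have hs1 : s < 1 := hs.trans_le (min_le_left _ _)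
  have hs2 : K * (1 - p.powerSum 2)⁻¹ * s ≤ ε / 2 := by
    have := hs.trans_le (min_le_right _ _)
    rw [lt_div_iff₀ (by positivity)] at this
    nlinarith
  obtain ⟨R, hR0, hR⟩ := Source.exists_mem_stepMonoid hm hs0 hsG
  have hRi : ∀ i : ℕ, ∃ c ∈ p.stepMonoid, R + i * s < c ∧ c ≤ R + (i + 1) * s := fun i => by
    obtain ⟨c, hc, h1, h2⟩ := hR (R + (i + 1) * s) (by nlinarith [(Nat.cast_nonneg i : (0:ℝ) ≤ i)])
    exact ⟨c, hc, by linarith, h2⟩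
  choose c hcS hc1 hc2 using hRi
  set n := ⌊p.totalStep / s⌋₊
  obtain ⟨η, hη, hsub⟩ := IsSubsolution.le_sub_mul_finset hm ((Finset.range (n + 1)).image c)
    (by simp only [Finset.mem_image]; rintro _ ⟨i, _, rfl⟩; exact hcS i)
  -- The loss at t is divided by η when it is carried over to the points t - c_i, so ε₁ has to be
  -- small against η ε.
  set ε₁ := min (ε / 8) (η * ε / 8)
  have hε₁ : 0 < ε₁ := by positivity
  have hε₁' : ε₁ ≤ ε / 8 := min_le_left _ _
  have hε₁'' : ε₁ ≤ η * ε / 8 := min_le_right _ _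
  have hev1 : ∀ᶠ t in atTop, V t < M + ε₁ := eventually_lt_of_limsup_lt (by linarith) hb1
  have hev2 : ∀ᶠ t in atTop, K * Real.exp (-t) < ε₁ := by
    have : Tendsto (fun t => K * Real.exp (-t)) atTop (𝓝 (K * 0)) :=
      (Real.tendsto_exp_atBot.comp tendsto_neg_atTop_atBot).const_mul K
    exact this.eventually_lt_const (by simpa using hε₁)
  obtain ⟨t₀, ht₀⟩ := eventually_atTop.1 (hev1.and hev2)
  have hfreq : ∃ᶠ t in atTop, M - ε₁ < V t :=
    frequently_lt_of_lt_limsup hb2.isCoboundedUnder_le (by linarith)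
  obtain ⟨t, ht, htV⟩ := frequently_atTop.1 hfreq
    (max (t₀ + (R + p.totalStep + s) + p.totalStep) (T₁ + R))
  have ht1 := (le_max_left _ _).trans ht
  have ht2 := (le_max_right _ _).trans ht
  have hℓ := Source.totalStep_nonneg (p := p) hm
  have hpts : ∀ i ∈ Finset.range (n + 1), M - 3 * ε / 8 ≤ V (t - c i) := by
    intro i hi
    have hin : (i : ℝ) * s ≤ p.totalStep := by
      have : (i : ℝ) ≤ n := by exact_mod_cast Nat.lt_succ_iff.1 (Finset.mem_range.1 hi)
      have h2 : (n : ℝ) * s ≤ p.totalStep := (le_div_iff₀ hs0).1 (Nat.floor_le (by positivity))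
      nlinarith
    have hci : t₀ + c i + p.totalStep ≤ t := by linarith [hc2 i]
    have h := hsub (c i) (Finset.mem_image_of_mem c hi) _ (hg.isSubsolution hm) (M + 2 * ε₁) t₀ t
      (fun u hu _ => by linarith [(ht₀ u hu).1, (ht₀ u hu).2]) hci
    have hnn : 0 ≤ K * Real.exp (-t) := by positivity
    have h' := (ht₀ (t - c i) (by linarith)).2
    have h2 : η * (M + 2 * ε₁ - (V (t - c i) + K * Real.exp (-(t - c i)))) ≤ 3 * (η * ε / 8) := by
      linarith
    have h3 : M + 2 * ε₁ - (V (t - c i) + K * Real.exp (-(t - c i))) ≤ 3 * ε / 8 := by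
      refine le_of_mul_le_mul_left ?_ hη
      linarith
    linarith
  have hwin : ∀ v, t - R - p.totalStep ≤ v → v ≤ t - R → M - ε ≤ V v := by
    intro v hv1 hv2
    set i := ⌊(t - v - R) / s⌋₊
    have hi1 : (i : ℝ) * s ≤ t - v - R :=
      (le_div_iff₀ hs0).1 (Nat.floor_le (div_nonneg (by linarith) hs0.le))
    have hi2 : t - v - R < (i + 1) * s := (div_lt_iff₀ hs0).1 (Nat.lt_floor_add_one _)
    have hin : i ∈ Finset.range (n + 1) := by
      rw [Finset.mem_range, Nat.lt_succ_iff]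
      refine Nat.floor_le_floor ?_
      gcongr
      linarith
    have habs : |v - (t - c i)| ≤ s := by
      rw [abs_le]; constructor <;> linarith [hc1 i, hc2 i]
    have hL := hg.abs_potential_sub_le (p := p) hm (habs.trans hs1.le)
    have h2 : K * (1 - p.powerSum 2)⁻¹ * |v - (t - c i)| ≤ ε / 2 :=
      (mul_le_mul_of_nonneg_left habs (by positivity)).trans hs2
    have h3 := (abs_le.1 (hL.trans h2)).1
    have h4 := hpts i hin
    simp only [V] at h4 ⊢
    linarith
  -- The windows of lengths ℓ_j, weighted by p_j, have total length h.
  have hmass : (M - ε) * p.entropy ≤ renewalMass p V (t - R) := by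
    rw [p.entropy_eq, Finset.mul_sum, renewalMass]
    refine Finset.sum_le_sum fun j _ => ?_
    rw [mul_left_comm]
    refine mul_le_mul_of_nonneg_left ?_ (p.pos j).le
    have hj := Source.step_pos (p := p) hm j
    have hj' := Source.step_le_totalStep (p := p) hm j
    have e : (M - ε) * p.step j = ∫ _ in (t - R - p.step j)..(t - R), (M - ε) := by
      rw [intervalIntegral.integral_const, smul_eq_mul]; ring
    rw [e]
    refine intervalIntegral.integral_mono_on (by linarith) intervalIntegrable_const
      ((hg.continuous_potential hm).intervalIntegrable _ _) fun v hv => ?_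
    exact hwin v (by linarith [hv.1]) hv.2
  have := hT₁ (t - R) (by linarith)
  linarith

theorem Tame.tendsto_potential (hm : 2 ≤ m) {g : ℝ → ℝ} {K : ℝ} (hg : Tame g K)
    (hdense : ∀ ε > 0, ∃ d ∈ p.stepGroup, 0 < d ∧ d < ε) :
    Tendsto (potential p g) atTop (𝓝 ((∫ t, g t) / p.entropy)) := by
  rw [tendsto_order]
  constructor
  · intro a ha
    filter_upwards [hg.neg.eventually_potential_lt hm hdense (sub_pos.2 ha)] with t ht
    rw [potential_neg, integral_neg, neg_div] at ht
    linarith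
  · intro a ha
    filter_upwards [hg.eventually_potential_lt hm hdense (sub_pos.2 ha)] with t ht
    linarith

end DigitalTree

/-! ### Lattice step groups: geometric convergence to a periodic function -/

namespace DigitalTree

variable {m : ℕ} {p : Source m}

/-- All large elements of dℤ lie in the semigroup, so one point s' of a coset influences every
sufficiently late point of it. The maximum principle for V + K e^(-s) and -V + K e^(-s) at the same
s' moves both bounds inwards; V(s') cancels in the sum, which leaves the factor 1 - η and an
exponentially small term. -/
theorem Tame.oscillation_contraction (hm : 2 ≤ m) {g : ℝ → ℝ} {K : ℝ} (hg : Tame g K) {d : ℝ}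
    (hd : 0 < d) (hG : p.stepGroup = AddSubgroup.zmultiples d) :
    ∃ N > 0, ∃ η > 0, ∀ t₀ τ A B, 
      (∀ s, t₀ ≤ s → s - τ ∈ p.stepGroup → A ≤ potential p g s - K * Real.exp (-s) ∧
        potential p g s + K * Real.exp (-s) ≤ B) →
      ∃ A' B', B' - A' ≤ (1 - η) * (B - A) + η * (2 * K * Real.exp (-t₀)) ∧
        ∀ s, t₀ + N ≤ s → s - τ ∈ p.stepGroup → A' ≤ potential p g s - K * Real.exp (-s) ∧
          potential p g s + K * Real.exp (-s) ≤ B' := by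
  have hdG : d ∈ p.stepGroup := hG ▸ AddSubgroup.mem_zmultiples d
  have hℓ := Source.totalStep_nonneg (p := p) hm
  obtain ⟨R, hR0, hR⟩ := Source.exists_mem_stepMonoid hm hd hdG
  -- A semigroup element in (u - d, u] differs from u by a multiple of d, hence equals u.
  have hmem : ∀ u ∈ p.stepGroup, R ≤ u → u ∈ p.stepMonoid := by
    intro u hu hRu
    obtain ⟨c, hc, h1, h2⟩ := hR u hRu
    have hcu := sub_mem hu (Source.stepMonoid_le hc)
    rw [hG, AddSubgroup.mem_zmultiples_iff] at hcu
    obtain ⟨k, hk⟩ := hcu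
    rw [zsmul_eq_mul] at hk
    have hk1 : (k : ℝ) < 1 := by by_contra! h; nlinarith
    have hk0 : (-1 : ℝ) < k := by by_contra! h; nlinarith
    have : k = 0 := by
      have h1 : k < 1 := by exact_mod_cast hk1
      have h2 : -1 < k := by exact_mod_cast hk0
      omega
    subst this
    have : u = c := by simp at hk; linarith
    rwa [this]
  set n := ⌊(R + p.totalStep) / d⌋₊
  set F : Finset ℝ := ((Finset.range (n + 1)).image fun i : ℕ => (i : ℝ) * d).filter (R ≤ ·)
  have hFmem : ∀ u ∈ p.stepGroup, R ≤ u → u ≤ R + p.totalStep → u ∈ F := by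
    intro u hu h1 h2
    have hu' := hu
    rw [hG, AddSubgroup.mem_zmultiples_iff] at hu'
    obtain ⟨k, hk⟩ := hu'
    rw [zsmul_eq_mul] at hk
    have hk0 : 0 ≤ k := by
      by_contra! h
      have : (k : ℝ) < 0 := by exact_mod_cast h
      nlinarith
    lift k to ℕ using hk0
    refine Finset.mem_filter.2 ⟨Finset.mem_image.2 ⟨k, ?_, by simpa using hk⟩, h1⟩
    rw [Finset.mem_range, Nat.lt_succ_iff]
    refine Nat.le_floor ((le_div_iff₀ hd).2 ?_)
    push_cast at hk
    linarith
  have hFS : ∀ a ∈ F, a ∈ p.stepMonoid := by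
    intro a ha
    obtain ⟨h1, h2⟩ := Finset.mem_filter.1 ha
    obtain ⟨i, _, rfl⟩ := Finset.mem_image.1 h1
    refine hmem _ ?_ h2
    rw [hG, AddSubgroup.mem_zmultiples_iff]
    exact ⟨i, by simp⟩
  obtain ⟨η, hη, hsub⟩ := IsSubsolution.le_sub_mul_finset hm F hFS
  refine ⟨p.totalStep + d + R, by positivity, η, hη, fun t₀ τ A B hAB => ?_⟩
  obtain ⟨s', hs'1, hs'2, hs'G⟩ : ∃ s', t₀ + p.totalStep ≤ s' ∧ s' ≤ t₀ + p.totalStep + d ∧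
      s' - τ ∈ p.stepGroup := by
    refine ⟨τ + ⌈(t₀ + p.totalStep - τ) / d⌉ * d, ?_, ?_, ?_⟩
    · have := (div_le_iff₀ hd).1 (Int.le_ceil ((t₀ + p.totalStep - τ) / d))
      linarith
    · have := Int.ceil_lt_add_one ((t₀ + p.totalStep - τ) / d)
      have h2 : (t₀ + p.totalStep - τ) / d * d = t₀ + p.totalStep - τ := div_mul_cancel₀ _ hd.ne'
      nlinarith
    · rw [add_sub_cancel_left, hG, AddSubgroup.mem_zmultiples_iff]
      exact ⟨_, zsmul_eq_mul _ _⟩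
  have upper : ∀ Y, IsSubsolution p Y → ∀ B, (∀ s, t₀ ≤ s → s - τ ∈ p.stepGroup → Y s ≤ B) →
      ∀ s, t₀ + (p.totalStep + d + R) ≤ s → s - τ ∈ p.stepGroup → Y s ≤ B - η * (B - Y s') := by
    intro Y hY B hB s hs hsτ
    refine hY.le_of_le_window hm (s₀ := s' + R) (τ := τ) (fun u hu1 hu2 huτ => ?_) s
      (by linarith) hsτ
    have huG : u - s' ∈ p.stepGroup := by
      have := sub_mem huτ hs'G
      rwa [sub_sub_sub_cancel_right] at this
    have := hsub (u - s') (hFmem _ huG (by linarith) (by linarith)) Y hY B t₀ u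
      (fun v hv hvu => hB v hv (by have := add_mem hvu huτ; rwa [sub_add_sub_cancel] at this))
      (by linarith)
    rwa [sub_sub_cancel] at this
  set Vp := fun s => potential p g s + K * Real.exp (-s)
  set Vm := fun s => -potential p g s + K * Real.exp (-s)
  have hVm : IsSubsolution p Vm := by
    have := hg.neg.isSubsolution (p := p) hm
    simpa only [potential_neg] using this
  have hup := upper Vp (hg.isSubsolution hm) B fun s hs hsτ => (hAB s hs hsτ).2
  have hlo := upper Vm hVm (-A) fun s hs hsτ => by
    have := (hAB s hs hsτ).1
    simp only [Vm]; linarith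
  refine ⟨-(-A - η * (-A - Vm s')), B - η * (B - Vp s'), ?_, fun s hs hsτ => ⟨?_, hup s hs hsτ⟩⟩
  · have he : Real.exp (-s') ≤ Real.exp (-t₀) := Real.exp_le_exp.2 (by linarith)
    have h2 : Vp s' + Vm s' ≤ 2 * K * Real.exp (-t₀) := by
      simp only [Vp, Vm]
      nlinarith [hg.nonneg]
    nlinarith
  · have := hlo s hs hsτ
    simp only [Vm] at this ⊢
    linarith

/-- Iterating the contraction at the times jN gives a linear recursion for the oscillation, with
factor at most q and a forcing term that decays like e^(-jN). A ratio r strictly between q and 1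
absorbs both. -/
theorem Tame.abs_potential_sub_le_geometric (hm : 2 ≤ m) {g : ℝ → ℝ} {K : ℝ} (hg : Tame g K)
    {d : ℝ} (hd : 0 < d) (hG : p.stepGroup = AddSubgroup.zmultiples d) :
    ∃ ε > 0, ε < 1 ∧ ∃ C, ∀ t, 0 ≤ t → ∀ s, t ≤ s → s - t ∈ p.stepGroup →
      |potential p g s - potential p g t| ≤ C * Real.exp (-ε * t) := by
  obtain ⟨N, hN, η, hη, hcon⟩ := hg.oscillation_contraction hm hd hG
  have hK := hg.nonneg
  have hc := inv_one_sub_powerSum_pos (p := p) hm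
  -- q dominates the contraction factor and the decay of the forcing term over one step; 1/2 only
  -- makes positivity immediate. From e^(-N) ≤ q < r comes the exponent bound ε < 1.
  set q := max (max (1 - η) (Real.exp (-N))) (1 / 2)
  have hq1 : q < 1 := by
    refine max_lt (max_lt (by linarith) ?_) (by norm_num)
    rw [Real.exp_lt_one_iff]; linarith
  have hqη : 1 - η ≤ q := (le_max_left _ _).trans (le_max_left _ _)
  have hqN : Real.exp (-N) ≤ q := (le_max_right _ _).trans (le_max_left _ _)
  have hq0 : 0 < q := lt_of_lt_of_le (by norm_num) (le_max_right _ _)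
  set r := (1 + q) / 2
  have hqr : q < r := by simp only [r]; linarith
  have hr1 : r < 1 := by simp only [r]; linarith
  have hr0 : 0 < r := hq0.trans hqr
  set D₀ := 2 * (K * (1 - p.powerSum 2)⁻¹ + K)
  -- The first summand covers j = 0; the second makes C (r - q) absorb the forcing term.
  set C := D₀ + η * (2 * K) / (r - q)
  have hC0 : 0 ≤ C := add_nonneg (by positivity) (div_nonneg (by positivity) (by linarith))
  have hCr : η * (2 * K) ≤ C * (r - q) := by
    simp only [C]
    rw [add_mul, div_mul_cancel₀ _ (by linarith)]
    have : 0 ≤ D₀ * (r - q) := mul_nonneg (by positivity) (by linarith)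
    linarith
  have key : ∀ (j : ℕ) τ, ∃ A B, B - A ≤ C * r ^ j ∧ ∀ s, j * N ≤ s → s - τ ∈ p.stepGroup →
      A ≤ potential p g s - K * Real.exp (-s) ∧ potential p g s + K * Real.exp (-s) ≤ B := by
    intro j
    induction j with
    | zero =>
      intro τ
      refine ⟨-(K * (1 - p.powerSum 2)⁻¹ + K), K * (1 - p.powerSum 2)⁻¹ + K, ?_, fun s hs _ => ?_⟩
      · have : 0 ≤ η * (2 * K) / (r - q) := div_nonneg (by positivity) (by linarith)
        simp only [C, D₀, pow_zero]
        linarith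
      · have h1 := abs_le.1 (hg.abs_potential_le (p := p) hm s)
        have h2 : Real.exp (-s) ≤ 1 := Real.exp_le_one_iff.2 (by simpa using hs)
        have h3 : K * Real.exp (-s) ≤ K := mul_le_of_le_one_right hK h2
        constructor <;> linarith [h1.1, h1.2]
    | succ j ih =>
      intro τ
      obtain ⟨A, B, hAB, h⟩ := ih τ
      obtain ⟨A', B', hAB', h'⟩ := hcon (j * N) τ A B h
      refine ⟨A', B', hAB'.trans ?_, fun s hs => h' s (by push_cast at hs; linarith)⟩
      have h0 : 0 ≤ B - A := by
        obtain ⟨k, hk⟩ := exists_nat_ge ((j * N - τ) / d)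
        rw [div_le_iff₀ hd] at hk
        obtain ⟨h1, h2⟩ := h (τ + k * d) (by linarith) (by
          rw [hG, AddSubgroup.mem_zmultiples_iff]; exact ⟨k, by simp⟩)
        nlinarith [mul_nonneg hK (Real.exp_pos (-(τ + k * d))).le]
      have e1 : Real.exp (-(j * N)) ≤ r ^ j := by
        rw [neg_mul_eq_mul_neg, Real.exp_nat_mul]
        exact pow_le_pow_left₀ (Real.exp_pos _).le (hqN.trans hqr.le) j
      have hrj : 0 < r ^ j := pow_pos hr0 j
      calc (1 - η) * (B - A) + η * (2 * K * Real.exp (-(j * N)))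
          ≤ q * (C * r ^ j) + η * (2 * K) * r ^ j := by
            have a1 : (1 - η) * (B - A) ≤ q * (B - A) := mul_le_mul_of_nonneg_right hqη h0
            have a2 : q * (B - A) ≤ q * (C * r ^ j) := mul_le_mul_of_nonneg_left hAB hq0.le
            have a3 : η * (2 * K) * Real.exp (-(j * N)) ≤ η * (2 * K) * r ^ j :=
              mul_le_mul_of_nonneg_left e1 (by positivity)
            linarith
        _ ≤ C * r ^ (j + 1) := by
            rw [pow_succ]
            nlinarith
  have hlog : Real.log r < 0 := Real.log_neg hr0 hr1
  refine ⟨-Real.log r / N, div_pos (by linarith) hN, ?_, C * r⁻¹, fun t ht s hts hst => ?_⟩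
  · rw [div_lt_one hN, neg_lt, Real.lt_log_iff_exp_lt hr0]
    exact hqN.trans_lt hqr
  obtain ⟨A, B, hAB, h⟩ := key ⌊t / N⌋₊ t
  have hj : (⌊t / N⌋₊ : ℝ) * N ≤ t := (le_div_iff₀ hN).1 (Nat.floor_le (by positivity))
  have h1 := h t hj (by simp)
  have h2 := h s (hj.trans hts) hst
  have e1 := mul_nonneg hK (Real.exp_pos (-t)).le
  have e2 := mul_nonneg hK (Real.exp_pos (-s)).le
  have h3 : |potential p g s - potential p g t| ≤ C * r ^ ⌊t / N⌋₊ := by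
    rw [abs_le]; constructor <;> linarith [h1.1, h1.2, h2.1, h2.2]
  refine h3.trans ?_
  rw [mul_assoc]
  refine mul_le_mul_of_nonneg_left ?_ hC0
  have : r⁻¹ * Real.exp (-(-Real.log r / N) * t) = Real.exp (Real.log r * (t / N - 1)) := by
    rw [← Real.exp_log hr0, ← Real.exp_neg, ← Real.exp_add, Real.log_exp]
    congr 1
    ring
  rw [this, ← Real.rpow_natCast, Real.rpow_def_of_pos hr0]
  refine Real.exp_le_exp.2 ?_
  have := (Nat.lt_floor_add_one (t / N)).le
  nlinarith

/-- L is the limit of V along t + n d and inherits the Lipschitz bound. Its mean is read off from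
the mass: every ℓ_j is a multiple of d, so the mass of L is constantly h/d times its integral over a
period, and it agrees in the limit with the mass of V, that is with ∫ g. -/
theorem Tame.exists_periodic_limit (hm : 2 ≤ m) {g : ℝ → ℝ} {K : ℝ} (hg : Tame g K)
    {d : ℝ} (hd : 0 < d) (hG : p.stepGroup = AddSubgroup.zmultiples d) :
    ∃ L : ℝ → ℝ, Continuous L ∧ Function.Periodic L d ∧
      ∫ t in (0 : ℝ)..d, L t = d * ((∫ t, g t) / p.entropy) ∧
      ∃ ε > 0, ε < 1 ∧ ∃ C, ∀ t, 0 ≤ t → |potential p g t - L t| ≤ C * Real.exp (-ε * t) := by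
  obtain ⟨ε, hε, hε1, C, hC⟩ := hg.abs_potential_sub_le_geometric hm hd hG
  set V := potential p g
  have hC0 : 0 ≤ C := by
    have := (abs_nonneg _).trans (hC 0 le_rfl 0 le_rfl (by simp))
    simpa using this
  have hdG : ∀ k : ℕ, (k : ℝ) * d ∈ p.stepGroup := fun k => by
    rw [hG, AddSubgroup.mem_zmultiples_iff]; exact ⟨k, by simp⟩
  have hexp : Tendsto (fun t : ℝ => C * Real.exp (-ε * t)) atTop (𝓝 0) := by
    have : Tendsto (fun t : ℝ => -ε * t) atTop atBot :=
      tendsto_id.const_mul_atTop_of_neg (by linarith)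
    simpa using (Real.tendsto_exp_atBot.comp this).const_mul C
  have hseq : ∀ t, Tendsto (fun n : ℕ => t + n * d) atTop atTop := fun t =>
    tendsto_atTop_add_const_left _ _ (tendsto_natCast_atTop_atTop.atTop_mul_const hd)
  have hcau : ∀ t, CauchySeq fun n : ℕ => V (t + n * d) := by
    intro t
    rw [Metric.cauchySeq_iff']
    intro δ hδ
    obtain ⟨n, hn⟩ := (((hseq t).eventually (hexp.eventually_lt_const hδ)).and
      ((hseq t).eventually_ge_atTop 0)).exists
    refine ⟨n, fun k hk => lt_of_le_of_lt ?_ hn.1⟩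
    rw [Real.dist_eq]
    have hk' : (n : ℝ) ≤ k := by exact_mod_cast hk
    refine hC _ hn.2 _ (by nlinarith) ?_
    have := hdG (k - n)
    rw [Nat.cast_sub hk] at this
    convert this using 1
    ring
  choose L hL using fun t => cauchySeq_tendsto_of_complete (hcau t)
  have hLV : ∀ t, 0 ≤ t → |V t - L t| ≤ C * Real.exp (-ε * t) := by
    intro t ht
    refine le_of_tendsto ((tendsto_const_nhds.sub (hL t)).abs) (Eventually.of_forall fun n => ?_)
    rw [abs_sub_comm]
    refine hC t ht _ (by nlinarith [(Nat.cast_nonneg n : (0 : ℝ) ≤ n)]) ?_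
    simpa using hdG n
  have hLper : Function.Periodic L d := by
    intro t
    refine tendsto_nhds_unique (hL (t + d)) (((tendsto_add_atTop_iff_nat 1).2 (hL t)).congr ?_)
    intro n
    congr 1
    push_cast
    ring
  have hLcont : Continuous L := by
    refine continuous_of_abs_sub_le (mul_nonneg hg.nonneg (inv_one_sub_powerSum_pos (p := p) hm).le)
      fun s t h => ?_
    refine le_of_tendsto (((hL s).sub (hL t)).abs) (Eventually.of_forall fun n => ?_)
    have := hg.abs_potential_sub_le (p := p) hm (s := s + n * d) (t := t + n * d) (by simpa using h)
    simpa using this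
  refine ⟨L, hLcont, hLper, ?_, ε, hε, hε1, C, hLV⟩
  have hmassL : ∀ t, renewalMass p L t = p.entropy / d * ∫ t in (0 : ℝ)..d, L t := by
    intro t
    rw [renewalMass, p.entropy_eq, Finset.sum_div, Finset.sum_mul]
    refine Finset.sum_congr rfl fun j _ => ?_
    have hj := Source.step_mem (p := p) j
    rw [hG, AddSubgroup.mem_zmultiples_iff] at hj
    obtain ⟨k, hk⟩ := hj
    have := hLper.intervalIntegral_add_zsmul_eq k (t - p.step j)
      (fun a b => hLcont.intervalIntegrable a b)
    rw [hk, sub_add_cancel] at this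
    rw [this, hLper.intervalIntegral_add_eq _ 0, zero_add, ← hk, zsmul_eq_mul, zsmul_eq_mul]
    field_simp
  have hdiff : Tendsto (fun t => renewalMass p V t - renewalMass p L t) atTop (𝓝 0) := by
    have hVc := hg.continuous_potential (p := p) hm
    unfold renewalMass
    simp only [← Finset.sum_sub_distrib, ← mul_sub]
    rw [show (0 : ℝ) = ∑ j : Fin m, p.prob j * 0 by simp]
    refine tendsto_finsetSum _ fun j _ => Tendsto.const_mul _ ?_
    have hlim : Tendsto (fun t => C * Real.exp (-ε * (t - p.step j)) * p.step j) atTop (𝓝 0) := by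
      have h := (hexp.comp (tendsto_atTop_add_const_right _ (-p.step j) tendsto_id)).mul_const
        (p.step j)
      rw [zero_mul] at h
      exact h
    refine squeeze_zero_norm' ?_ hlim
    filter_upwards [eventually_ge_atTop (p.step j)] with t ht
    have hj := Source.step_pos (p := p) hm j
    rw [← intervalIntegral.integral_sub (hVc.intervalIntegrable _ _)
      (hLcont.intervalIntegrable _ _)]
    refine (intervalIntegral.norm_integral_le_of_norm_le_const
      (C := C * Real.exp (-ε * (t - p.step j))) fun s hs => ?_).trans ?_
    · rw [Set.uIoc_of_le (by linarith)] at hs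
      refine (hLV s (by linarith [hs.1])).trans (mul_le_mul_of_nonneg_left ?_ hC0)
      exact Real.exp_le_exp.2 (by nlinarith [hs.1])
    · rw [sub_sub_cancel, abs_of_pos hj]
  have h1 := hg.tendsto_renewalMass (p := p) hm
  have h2 : Tendsto (renewalMass p L) atTop (𝓝 (∫ t, g t)) := by
    have h := h1.sub hdiff
    rw [sub_zero] at h
    exact h.congr fun t => by ring
  have h3 := tendsto_nhds_unique (tendsto_const_nhds.congr fun t => (hmassL t).symm) h2
  have hh := Source.entropy_pos (p := p) hm
  rw [← h3]
  field_simp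

/-! ### Periodicity of the source in terms of the step group -/

namespace Source

theorem closure_range_log : AddSubgroup.closure (Set.range fun j => Real.log (p.prob j)) =
    p.stepGroup := by
  refine le_antisymm ?_ ?_ <;> refine (AddSubgroup.closure_le _).2 ?_
  · rintro _ ⟨j, rfl⟩
    simpa [step] using neg_mem (step_mem (p := p) j)
  · rintro _ ⟨j, rfl⟩
    exact neg_mem (AddSubgroup.subset_closure ⟨j, rfl⟩)

theorem log_prob_neg (hm : 2 ≤ m) (j : Fin m) : Real.log (p.prob j) < 0 :=
  Real.log_neg (p.pos j) (prob_lt_one hm j)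

/-- With D a common denominator of the ratios to log p_0, all log p_j are integer multiples of u =
log p_0 / D. So the group is not dense, hence cyclic. -/
theorem IsPeriodic.exists_period (hm : 2 ≤ m) (hp : p.IsPeriodic) :
    ∃ d > 0, p.stepGroup = AddSubgroup.zmultiples d := by
  set i₀ : Fin m := ⟨0, by omega⟩
  choose q hq using fun j => hp j i₀
  have h0 := (log_prob_neg (p := p) hm i₀).ne
  set D : ℕ := ∏ j, (q j).den
  have hD : (D : ℝ) ≠ 0 := by
    exact_mod_cast Finset.prod_ne_zero_iff.2 fun j _ => (q j).den_nz
  set u := Real.log (p.prob i₀) / D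
  have hu : u ≠ 0 := div_ne_zero h0 hD
  have hle : p.stepGroup ≤ AddSubgroup.zmultiples u := by
    rw [← closure_range_log, AddSubgroup.closure_le]
    rintro _ ⟨j, rfl⟩
    obtain ⟨e, he⟩ : (q j).den ∣ D := Finset.dvd_prod_of_mem _ (Finset.mem_univ j)
    refine AddSubgroup.mem_zmultiples_iff.2 ⟨(q j).num * e, ?_⟩
    have hqj := hq j
    rw [div_eq_iff h0, Rat.cast_def] at hqj
    have he' : (D : ℝ) = (q j).den * e := by exact_mod_cast he
    have hden : ((q j).den : ℝ) ≠ 0 := by exact_mod_cast (q j).den_nz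
    have hene : (e : ℝ) ≠ 0 := by rintro h; rw [h, mul_zero] at he'; exact hD he'
    simp only [hqj, u, zsmul_eq_mul, he']
    push_cast
    field_simp
  rcases AddSubgroup.dense_or_cyclic p.stepGroup with hd | ⟨a, ha⟩
  · obtain ⟨c, hc, hc0, hcu⟩ := hd.exists_between (abs_pos.2 hu)
    obtain ⟨k, hk⟩ := AddSubgroup.mem_zmultiples_iff.1 (hle hc)
    rw [zsmul_eq_mul] at hk
    have hk1 : |(k : ℝ)| < 1 := by
      rw [← abs_of_pos hc0, ← hk, abs_mul] at hcu
      by_contra! h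
      nlinarith [abs_nonneg u]
    have : k = 0 := Int.abs_lt_one_iff.1 (by exact_mod_cast hk1)
    simp [this] at hk
    exact absurd hk hc0.ne
  · rw [← AddSubgroup.zmultiples_eq_closure] at ha
    have ha0 : a ≠ 0 := by
      rintro rfl
      have := step_mem (p := p) i₀
      rw [ha] at this
      simp at this
      exact (step_pos hm i₀).ne' this
    refine ⟨|a|, abs_pos.2 ha0, ?_⟩
    rcases abs_choice a with h | h <;> rw [h, ha]
    exact AddSubgroup.zmultiples_neg.symm

/-- A subgroup of ℝ that is not dense is cyclic, and then all ratios of its generators log p_j are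
rational. -/
theorem exists_small_step (hm : 2 ≤ m) (hp : ¬ p.IsPeriodic) (ε : ℝ) (hε : 0 < ε) :
    ∃ d ∈ p.stepGroup, 0 < d ∧ d < ε := by
  rcases AddSubgroup.dense_or_cyclic p.stepGroup with hd | ⟨a, ha⟩
  · obtain ⟨c, hc, h1, h2⟩ := hd.exists_between hε
    exact ⟨c, hc, h1, h2⟩
  · refine absurd (fun j k => ?_) hp
    rw [← AddSubgroup.zmultiples_eq_closure] at ha
    have h := fun j => AddSubgroup.mem_zmultiples_iff.1 (ha ▸ step_mem (p := p) j)
    obtain ⟨x, hx⟩ := h j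
    obtain ⟨y, hy⟩ := h k
    rw [zsmul_eq_mul] at hx hy
    refine ⟨x / y, ?_⟩
    rw [← neg_div_neg_eq, ← step, ← step, ← hx, ← hy]
    push_cast
    rcases eq_or_ne a 0 with rfl | ha0
    · simp at hy
      exact absurd hy (step_pos hm k).ne
    · exact mul_div_mul_right _ _ ha0

end Source

theorem Tame.exists_fluctuation (hm : 2 ≤ m) {g : ℝ → ℝ} {K : ℝ} (hg : Tame g K) :
    ∃ δ, IsFluctuation p δ ∧
      Tendsto (fun z => potential p g (Real.log z) - ((∫ t, g t) / p.entropy + δ z)) atTop (𝓝 0) ∧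
      (p.IsPeriodic → ∃ ε : ℝ, 0 < ε ∧ ε < 1 ∧
        (fun z => potential p g (Real.log z) - ((∫ t, g t) / p.entropy + δ z)) =O[atTop]
          fun z => z ^ (-ε)) := by
  by_cases hp : p.IsPeriodic
  · obtain ⟨d, hd, hG⟩ := hp.exists_period hm
    obtain ⟨L, hLc, hLp, hLi, ε, hε, hε1, C, hC⟩ := hg.exists_periodic_limit hm hd hG
    have hbound : ∀ z : ℝ, 1 ≤ z → |potential p g (Real.log z) - L (Real.log z)| ≤ C * z ^ (-ε) := by
      intro z hz
      have := hC _ (Real.log_nonneg hz)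
      rwa [mul_comm (-ε), ← Real.rpow_def_of_pos (by linarith)] at this
    have hO : (fun z => potential p g (Real.log z) - ((∫ t, g t) / p.entropy +
        (L (Real.log z) - (∫ t, g t) / p.entropy))) =O[atTop] fun z => z ^ (-ε) := by
      refine IsBigO.of_bound C ?_
      filter_upwards [eventually_ge_atTop 1] with z hz
      rw [add_sub_cancel, Real.norm_eq_abs, Real.norm_of_nonneg (by positivity)]
      exact hbound z hz
    refine ⟨fun z => L (Real.log z) - (∫ t, g t) / p.entropy,
      ⟨fun t => L t - (∫ t, g t) / p.entropy, hLc.sub continuous_const, fun _ _ => rfl,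
        fun h => absurd hp h, fun _ => ⟨d, hd, by rw [Source.closure_range_log, hG], ?_, ?_⟩⟩,
      hO.trans_tendsto (tendsto_rpow_neg_atTop hε), fun _ => ⟨ε, hε, hε1, hO⟩⟩
    · intro t
      simp [hLp t]
    · rw [intervalIntegral.integral_sub (hLc.intervalIntegrable _ _) intervalIntegrable_const, hLi]
      simp [mul_div_assoc]
  · refine ⟨fun _ => 0, ⟨fun _ => 0, continuous_const, fun _ _ => rfl, fun _ _ => rfl,
      fun h => absurd h hp⟩, ?_, fun h => absurd h hp⟩
    have := (hg.tendsto_potential hm (Source.exists_small_step hm hp)).comp Real.tendsto_log_atTop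
    simpa using this.sub_const ((∫ t, g t) / p.entropy)

end DigitalTree

/-! ### Tame functions of gamma type -/

namespace DigitalTree

theorem exists_pow_le_exp (M : ℕ) {c : ℝ} (hc : 0 < c) :
    ∃ C > 0, ∀ x : ℝ, 0 ≤ x → (1 + x) ^ M ≤ C * Real.exp (c * x) := by
  refine ⟨(M ! : ℝ) / c ^ M * Real.exp c, by positivity, fun x hx => ?_⟩
  have h := Real.pow_div_factorial_le_exp (c * (1 + x)) (by positivity) M
  rw [div_le_iff₀ (by positivity), mul_pow, mul_add, mul_one, Real.exp_add] at h
  rw [mul_assoc, div_mul_eq_mul_div, le_div_iff₀ (by positivity)]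
  linarith

theorem exists_pow_mul_exp_le {k r : ℕ} (hk : r ≤ k) {c c' : ℝ} (hc : c' < c) :
    ∃ C > 0, ∀ x : ℝ, 0 ≤ x → x ^ k * Real.exp (-(c * x)) ≤ C * (x ^ r * Real.exp (-(c' * x))) := by
  obtain ⟨C, hC, h⟩ := exists_pow_le_exp (k - r) (sub_pos.2 hc)
  refine ⟨C, hC, fun x hx => ?_⟩
  have h1 : x ^ (k - r) ≤ C * Real.exp ((c - c') * x) :=
    (pow_le_pow_left₀ hx (by linarith) _).trans (h x hx)
  have h2 : Real.exp (-(c' * x)) = Real.exp ((c - c') * x) * Real.exp (-(c * x)) := by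
    rw [← Real.exp_add]; congr 1; ring
  rw [h2, ← Nat.sub_add_cancel hk, pow_add]
  calc x ^ (k - r) * x ^ r * Real.exp (-(c * x))
      ≤ C * Real.exp ((c - c') * x) * x ^ r * Real.exp (-(c * x)) := by gcongr
    _ = _ := by ring

section Tame

namespace Tame

variable {g f : ℝ → ℝ} {K K' : ℝ}

theorem of_hasDerivAt {g' : ℝ → ℝ} (hg : ∀ t, |g t| ≤ K * bump t)
    (hd : ∀ t, HasDerivAt g (g' t) t) (hg' : ∀ t, |g' t| ≤ K * bump t) :
    Tame g (K * Real.exp 1) := by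
  have hK : 0 ≤ K := nonneg_of_mul_nonneg_left ((abs_nonneg _).trans (hg 0)) (bump_pos 0)
  refine ⟨fun t => (hg t).trans ?_, fun s t hst => ?_⟩
  · refine mul_le_mul_of_nonneg_right (le_mul_of_one_le_right hK ?_) (bump_pos t).le
    exact Real.one_le_exp zero_le_one
  · have h := (convex_uIcc t s).norm_image_sub_le_of_norm_hasDerivWithin_le
      (f := g) (f' := g') (C := K * Real.exp 1 * bump t)
      (fun x _ => (hd x).hasDerivWithinAt) (fun x hx => ?_) Set.left_mem_uIcc Set.right_mem_uIcc
    · simpa [Real.norm_eq_abs, mul_right_comm] using h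
    · refine (hg' x).trans ?_
      rw [mul_assoc]
      refine mul_le_mul_of_nonneg_left (bump_le_of_abs_sub_le_one ?_) hK
      exact (Set.abs_sub_left_of_mem_uIcc hx).trans hst

theorem add (hf : Tame f K) (hg : Tame g K') : Tame (fun t => f t + g t) (K + K') := by
  refine ⟨fun t => ?_, fun s t h => ?_⟩
  · rw [add_mul]; exact (abs_add_le _ _).trans (add_le_add (hf.1 t) (hg.1 t))
  · rw [add_sub_add_comm, add_mul, add_mul]
    exact (abs_add_le _ _).trans (add_le_add (hf.2 s t h) (hg.2 s t h))

theorem const_mul (hf : Tame f K) (c : ℝ) : Tame (fun t => c * f t) (|c| * K) := by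
  refine ⟨fun t => ?_, fun s t h => ?_⟩
  · rw [abs_mul, mul_assoc]; exact mul_le_mul_of_nonneg_left (hf.1 t) (abs_nonneg c)
  · rw [← mul_sub, abs_mul, mul_assoc, mul_assoc]
    refine mul_le_mul_of_nonneg_left ?_ (abs_nonneg c)
    rw [← mul_assoc]
    exact hf.2 s t h

/-- Meant for the product of a gamma function with a potential, which is bounded and locally
Lipschitz but need not decay. -/
theorem mul_bounded {B : ℝ} (hf : Tame f K) (hb : ∀ t, |g t| ≤ B)
    (hl : ∀ s t, |s - t| ≤ 1 → |g s - g t| ≤ B * |s - t|) :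
    Tame (fun t => f t * g t) (2 * K * B) := by
  have hB := (abs_nonneg _).trans (hb 0)
  have hK := hf.nonneg
  refine ⟨fun t => ?_, fun s t h => ?_⟩
  · rw [abs_mul]
    have := mul_le_mul (hf.1 t) (hb t) (abs_nonneg _) (mul_nonneg hK (bump_pos t).le)
    nlinarith [mul_nonneg (mul_nonneg hK hB) (bump_pos t).le]
  · rw [show f s * g s - f t * g t = (f s - f t) * g s + f t * (g s - g t) by ring]
    refine (abs_add_le _ _).trans ?_
    rw [abs_mul, abs_mul]
    have h1 := mul_le_mul (hf.2 s t h) (hb s) (abs_nonneg _)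
      (mul_nonneg (mul_nonneg hK (abs_nonneg _)) (bump_pos t).le)
    have h2 := mul_le_mul (hf.1 t) (hl s t h) (abs_nonneg _) (mul_nonneg hK (bump_pos t).le)
    nlinarith

end Tame

/-- The function `x^k e^{-c x}` of `x = e^t`. -/
noncomputable def gammaFun (k : ℕ) (c t : ℝ) : ℝ := Real.exp t ^ k * Real.exp (-(c * Real.exp t))

theorem exists_abs_gammaFun_le {k : ℕ} (hk : 1 ≤ k) {c : ℝ} (hc : 0 < c) :
    ∃ K > 0, ∀ t, |gammaFun k c t| ≤ K * bump t := by
  obtain ⟨C, hC, h⟩ := exists_pow_le_exp (k + 1) hc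
  refine ⟨C, hC, fun t => ?_⟩
  have ht := Real.exp_pos t
  unfold gammaFun bump
  set x := Real.exp t
  rw [abs_of_pos (by positivity), mul_div_assoc', le_div_iff₀ (by positivity), Real.exp_neg,
    ← div_eq_mul_inv, div_mul_eq_mul_div, div_le_iff₀ (by positivity)]
  obtain ⟨k, rfl⟩ := Nat.exists_eq_add_of_le' hk
  calc x ^ (k + 1) * (1 + x) ^ 2 = x * (x ^ k * (1 + x) ^ 2) := by ring
    _ ≤ x * ((1 + x) ^ k * (1 + x) ^ 2) := by gcongr; linarith
    _ = x * (1 + x) ^ (k + 1 + 1) := by ring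
    _ ≤ x * (C * Real.exp (c * x)) := mul_le_mul_of_nonneg_left (h x ht.le) ht.le
    _ = _ := by ring

/-- The derivative in t = log x of x^k e^(-cx) is a combination of two functions of the same family.
The decay at -∞ needs k ≥ 1. -/
theorem exists_tame_gammaFun {k : ℕ} (hk : 1 ≤ k) {c : ℝ} (hc : 0 < c) :
    ∃ K, Tame (gammaFun k c) K := by
  obtain ⟨K, hK, h⟩ := exists_abs_gammaFun_le hk hc
  obtain ⟨K', hK', h'⟩ := exists_abs_gammaFun_le (Nat.le_succ_of_le hk) hc
  refine ⟨_, Tame.of_hasDerivAt (K := (k + 1) * K + c * K')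
    (g' := fun t => k * gammaFun k c t - c * gammaFun (k + 1) c t) (fun t => ?_) (fun t => ?_)
    fun t => ?_⟩
  · refine (h t).trans (mul_le_mul_of_nonneg_right ?_ (bump_pos t).le)
    nlinarith [mul_pos hc hK', (Nat.cast_nonneg k : (0 : ℝ) ≤ k)]
  · unfold gammaFun
    convert! ((Real.hasDerivAt_exp t).pow k).mul (((Real.hasDerivAt_exp t).const_mul c).neg.exp)
      using 1
    obtain ⟨k, rfl⟩ := Nat.exists_eq_add_of_le' hk
    simp
    ring
  · have h1 := mul_le_mul_of_nonneg_left (h t) (Nat.cast_nonneg k : (0 : ℝ) ≤ k)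
    have h2 := mul_le_mul_of_nonneg_left (h' t) hc.le
    refine (abs_sub _ _).trans ?_
    rw [abs_mul, abs_mul, abs_of_pos hc, Nat.abs_cast]
    nlinarith [mul_pos hK (bump_pos t)]

end Tame

/-! ### Second-order expansion of the binomial weights -/

section Depoissonization

/-- `R = 1 + a / n + O(W / n^2)`. -/
def SecondOrder (n R a W : ℝ) : Prop := 1 ≤ W ∧ |a| ≤ W ∧ |R - 1 - a / n| ≤ W / n ^ 2

namespace SecondOrder

variable {n R a W R' a' W' : ℝ}

/-- The conditions 1 ≤ W and |a| ≤ W let the bounds multiply; the three parts of the error cost 3, 2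
and 1 times W W'/n². -/
theorem mul (hn : 1 ≤ n) (h : SecondOrder n R a W) (h' : SecondOrder n R' a' W') :
    SecondOrder n (R * R') (a + a') (6 * (W * W')) := by
  obtain ⟨h1, h2, h3⟩ := h
  obtain ⟨h1', h2', h3'⟩ := h'
  have hn0 : 0 < n := by linarith
  have hWW : W ≤ W * W' := le_mul_of_one_le_right (by linarith) h1'
  have hWW' : W' ≤ W * W' := le_mul_of_one_le_left (by linarith) h1
  refine ⟨by nlinarith, (abs_add_le _ _).trans (by linarith), ?_⟩
  have hi : n⁻¹ ≤ 1 := inv_le_one_of_one_le₀ hn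
  have hi0 : 0 < n⁻¹ := inv_pos.2 hn0
  have b1 : |a / n| ≤ W := by
    rw [abs_div, abs_of_pos hn0, div_eq_mul_inv]
    exact (mul_le_of_le_one_right (abs_nonneg a) hi).trans h2
  have b1' : |a' / n| ≤ W' := by
    rw [abs_div, abs_of_pos hn0, div_eq_mul_inv]
    exact (mul_le_of_le_one_right (abs_nonneg a') hi).trans h2'
  have b2 : W' / n ^ 2 ≤ W' := div_le_self (by linarith) (one_le_pow₀ hn)
  have b3 : |R'| ≤ 3 * W' := by
    have : R' = (R' - 1 - a' / n) + 1 + a' / n := by ring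
    rw [this]
    refine (abs_add_le _ _).trans ?_
    have := abs_add_le (R' - 1 - a' / n) 1
    rw [abs_one] at this
    linarith
  have b4 : |1 + a / n| ≤ 2 * W := by
    refine (abs_add_le _ _).trans ?_
    rw [abs_one]; linarith
  have e : R * R' - 1 - (a + a') / n =
      (R - 1 - a / n) * R' + (1 + a / n) * (R' - 1 - a' / n) + a * a' / n ^ 2 := by
    field_simp; ring
  rw [e]
  refine (abs_add_le _ _).trans ((add_le_add_left (abs_add_le _ _) _).trans ?_)
  rw [abs_mul, abs_mul, abs_div, abs_mul, abs_of_pos (pow_pos hn0 2)]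
  have c1 : |R - 1 - a / n| * |R'| ≤ W / n ^ 2 * (3 * W') :=
    mul_le_mul h3 b3 (abs_nonneg _) (by positivity)
  have c2 : |1 + a / n| * |R' - 1 - a' / n| ≤ 2 * W * (W' / n ^ 2) :=
    mul_le_mul b4 h3' (abs_nonneg _) (by positivity)
  have c3 : |a| * |a'| / n ^ 2 ≤ W * W' / n ^ 2 := by
    gcongr
  calc _ ≤ W / n ^ 2 * (3 * W') + 2 * W * (W' / n ^ 2) + W * W' / n ^ 2 := by linarith
    _ = _ := by ring

theorem pow (hn : 1 ≤ n) (h : SecondOrder n R a W) (k : ℕ) :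
    SecondOrder n (R ^ k) (k * a) ((6 * W) ^ k) := by
  induction k with
  | zero => simp [SecondOrder]; positivity
  | succ k ih =>
    rw [pow_succ, show ((k + 1 : ℕ) : ℝ) * a = k * a + a by push_cast; ring,
      show (6 * W) ^ (k + 1) = 6 * ((6 * W) ^ k * W) by ring]
    exact ih.mul hn h

end SecondOrder

theorem secondOrder_descFactorial (k : ℕ) :
    ∃ W, ∀ n : ℕ, 1 ≤ n → k ≤ n →
      SecondOrder n (n.descFactorial k / (n : ℝ) ^ k) (-(k * (k - 1) / 2)) W := by
  induction k with
  | zero => exact ⟨1, fun n hn _ => by simp [SecondOrder]⟩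
  | succ k ih =>
    obtain ⟨W, hW⟩ := ih
    refine ⟨6 * (W * (k + 1)), fun n hn hkn => ?_⟩
    have hn1 : (1 : ℝ) ≤ n := by exact_mod_cast hn
    have h : SecondOrder n (1 - k / n) (-k) (k + 1) := by
      refine ⟨by simp, by simp, ?_⟩
      rw [show (1 : ℝ) - k / n - 1 - -k / n = 0 by ring]
      simp; positivity
    convert! (hW n hn (by omega)).mul hn1 h using 1
    · rw [Nat.descFactorial_succ, Nat.cast_mul, Nat.cast_sub (by omega)]
      field_simp
      ring
    · push_cast; ring

theorem abs_exp_sub_one_sub_id_le_sq {u : ℝ} (hu : u ≤ 0) : |Real.exp u - 1 - u| ≤ u ^ 2 := by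
  have h1 := Real.add_one_le_exp u
  have h2 := Real.quadratic_le_exp_of_nonneg (x := -u) (by linarith)
  have h3 : Real.exp u * Real.exp (-u) = 1 := by rw [← Real.exp_add]; simp
  have h4 : Real.exp u ≤ 1 + u + u ^ 2 := by
    have h5 : 1 ≤ (1 + u + u ^ 2) * Real.exp (-u) := by
      have : 0 ≤ 1 + u + u ^ 2 := by nlinarith [sq_nonneg (u + 1), sq_nonneg u]
      refine le_trans ?_ (mul_le_mul_of_nonneg_left h2 this)
      nlinarith [sq_nonneg u, mul_nonneg (sq_nonneg u) (neg_nonneg.2 hu), sq_nonneg (u ^ 2)]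
    have h6 := Real.exp_pos (-u)
    by_contra! h
    nlinarith
  rw [abs_le]; constructor <;> linarith

/-- With x = n q the exponent n (log(1 - q) + q) is -x²/(2n) + O(x³/n²), where q ≤ 1/2 keeps the
logarithm under control. The bound is polynomial in x, to be absorbed later by e^(-x). -/
theorem secondOrder_pow_mul_exp {n : ℕ} (hn : 1 ≤ n) {q : ℝ} (hq : 0 ≤ q) (hq2 : q ≤ 1 / 2) :
    SecondOrder n ((1 - q) ^ n * Real.exp (n * q)) (-((n * q) ^ 2 / 2)) (6 * (1 + n * q) ^ 4) := by
  have hn1 : (1 : ℝ) ≤ n := by exact_mod_cast hn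
  have hn0 : (0 : ℝ) < n := by linarith
  set x := n * q with hx
  have hx0 : 0 ≤ x := by positivity
  have hqx : q = x / n := by rw [hx]; field_simp
  have hp1 : (1 : ℝ) ≤ 1 + x := by linarith
  have hp2 : (1 + x) ^ 2 ≤ (1 + x) ^ 4 := pow_le_pow_right₀ hp1 (by norm_num)
  have hp0 : 1 ≤ (1 + x) ^ 4 := one_le_pow₀ hp1
  refine ⟨by linarith, ?_, ?_⟩
  · rw [abs_neg, abs_of_nonneg (by positivity)]
    nlinarith
  set u := n * (Real.log (1 - q) + q) with hu
  have hB : (1 - q) ^ n * Real.exp x = Real.exp u := by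
    rw [hu, mul_add, Real.exp_add, mul_comm (n : ℝ) (Real.log _), ← Real.rpow_def_of_pos (by linarith),
      Real.rpow_natCast]
  have hu0 : u ≤ 0 := by
    have := Real.log_le_sub_one_of_pos (show 0 < 1 - q by linarith)
    exact mul_nonpos_of_nonneg_of_nonpos hn0.le (by linarith)
  have habs : |q| < 1 := by rw [abs_of_nonneg hq]; linarith
  have l2 := Real.abs_log_sub_add_sum_range_le habs 2
  have l1 := Real.abs_log_sub_add_sum_range_le habs 1
  simp only [Finset.sum_range_succ, Finset.sum_range_zero, abs_of_nonneg hq] at l1 l2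
  norm_num at l1 l2
  have d1 : q ^ 2 / (1 - q) ≤ 2 * q ^ 2 := by
    rw [div_le_iff₀ (by linarith)]; nlinarith [sq_nonneg q]
  have d2 : q ^ 3 / (1 - q) ≤ 2 * q ^ 3 := by
    rw [div_le_iff₀ (by linarith)]; nlinarith [pow_nonneg hq 3]
  have u1 : |u| ≤ 2 * x ^ 2 / n := by
    rw [hu, abs_mul, abs_of_pos hn0, add_comm]
    refine (mul_le_mul_of_nonneg_left (l1.trans d1) hn0.le).trans (le_of_eq ?_)
    rw [hqx]; field_simp
  have u2 : |u + x ^ 2 / (2 * n)| ≤ 2 * x ^ 3 / n ^ 2 := by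
    have e : u + x ^ 2 / (2 * n) = n * (q + q ^ 2 / 2 + Real.log (1 - q)) := by
      rw [hu, hx]; field_simp; ring
    rw [e, abs_mul, abs_of_pos hn0]
    refine (mul_le_mul_of_nonneg_left (l2.trans d2) hn0.le).trans (le_of_eq ?_)
    rw [hqx]; field_simp
  have u3 : u ^ 2 ≤ 4 * x ^ 4 / n ^ 2 := by
    rw [← sq_abs]
    refine (pow_le_pow_left₀ (abs_nonneg u) u1 2).trans (le_of_eq ?_)
    field_simp; ring
  rw [hB]
  have e : Real.exp u - 1 - -(x ^ 2 / 2) / n = (Real.exp u - 1 - u) + (u + x ^ 2 / (2 * n)) := by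
    field_simp; ring
  rw [e]
  refine (abs_add_le _ _).trans ((add_le_add ((abs_exp_sub_one_sub_id_le_sq hu0).trans u3) u2).trans ?_)
  rw [← add_div]
  gcongr
  have p4 : x ^ 4 ≤ (1 + x) ^ 4 := pow_le_pow_left₀ hx0 (by linarith) 4
  have p3 : x ^ 3 ≤ (1 + x) ^ 4 :=
    (pow_le_pow_left₀ hx0 (by linarith) 3).trans (pow_le_pow_right₀ hp1 (by norm_num))
  linarith

theorem secondOrder_inv {n : ℕ} (hn : 1 ≤ n) {q : ℝ} (hq : 0 ≤ q) (hq2 : q ≤ 1 / 2) :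
    SecondOrder n (1 - q)⁻¹ (n * q) (2 * (1 + n * q) ^ 2) := by
  have hn1 : (1 : ℝ) ≤ n := by exact_mod_cast hn
  have hn0 : (0 : ℝ) < n := by linarith
  have hx0 : 0 ≤ n * q := by positivity
  refine ⟨by nlinarith, by rw [abs_of_nonneg hx0]; nlinarith, ?_⟩
  have e : (1 - q)⁻¹ - 1 - n * q / n = q ^ 2 / (1 - q) := by
    have : 1 - q ≠ 0 := by linarith
    field_simp; ring
  have d1 : q ^ 2 / (1 - q) ≤ 2 * q ^ 2 := by
    rw [div_le_iff₀ (by linarith)]; nlinarith [sq_nonneg q]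
  rw [e, abs_of_nonneg (div_nonneg (sq_nonneg q) (by linarith)), le_div_iff₀ (by positivity)]
  calc q ^ 2 / (1 - q) * n ^ 2 ≤ 2 * q ^ 2 * n ^ 2 := by gcongr
    _ = 2 * (n * q) ^ 2 := by ring
    _ ≤ 2 * (1 + n * q) ^ 2 := by gcongr; linarith

/-- The coefficient of `1 / n` in the expansion of `(n)_k (1 - x / n)^(n - k) / n^k e^x`. -/
noncomputable def charlierCoeff (k : ℕ) (x : ℝ) : ℝ := -((x ^ 2 - 2 * k * x + k * (k - 1)) / 2)

theorem abs_charlierCoeff_le (k : ℕ) {x : ℝ} (hx : 0 ≤ x) :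
    |charlierCoeff k x| ≤ (k + 1) ^ 2 * (1 + x) ^ 2 := by
  unfold charlierCoeff
  have hk : (0 : ℝ) ≤ k := Nat.cast_nonneg k
  have := mul_nonneg hk hx
  have := mul_nonneg hk hk
  have := mul_nonneg hk this
  rw [abs_le]
  constructor <;>
    nlinarith [mul_nonneg (mul_nonneg hk hk) hx, mul_nonneg (mul_nonneg hk hk) (mul_nonneg hx hx),
      mul_nonneg hk (mul_nonneg hx hx)]

/-- The probability weight `(n)_k (1 - q)^(n - k) / n^k`. -/
noncomputable def binomialWeight (k n : ℕ) (q : ℝ) : ℝ :=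
  n.descFactorial k / (n : ℝ) ^ k * (1 - q) ^ (n - k)

/-- For q ≤ 1/2 the expansions of (n)_k/n^k, (1 - q)^n e^(nq) and (1 - q)^(-k) are multiplied, and
half of the factor e^(-x), x = nq, pays for the polynomial in x. For q > 1/2 both terms are small
separately: n ≤ 2x, so the same half also pays for n². -/
theorem exists_abs_binomialWeight_sub_le (k : ℕ) :
    ∃ C > 0, ∀ n : ℕ, 1 ≤ n → k ≤ n → ∀ q : ℝ, 0 ≤ q → q ≤ 1 →
      |binomialWeight k n q - Real.exp (-(n * q)) * (1 + charlierCoeff k (n * q) / n)| ≤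
        C * Real.exp (-((1 / 2) * (n * q))) / n ^ 2 := by
  obtain ⟨W, hW⟩ := secondOrder_descFactorial k
  obtain ⟨C₁, hC₁, h₁⟩ := exists_pow_le_exp (4 + 2 * k) (show (0 : ℝ) < 1 / 2 by norm_num)
  obtain ⟨C₂, hC₂, h₂⟩ := exists_pow_le_exp 4 (show (0 : ℝ) < 1 / 2 by norm_num)
  -- W ≥ 1 is known only once some n is given, hence the maximum. A₁ collects the constants of the
  -- threefold product after the powers of 1 + x are pulled out; A₂ is its counterpart for q > 1/2.
  set W₀ := max W 1
  set A₁ := 6 * (6 * (W₀ * 6) * (6 * 2) ^ k)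
  set A₂ := 4 * (Real.exp k + 1 + (k + 1) ^ 2)
  refine ⟨A₁ * C₁ + A₂ * C₂, by positivity, fun n hn hkn q hq hq1 => ?_⟩
  have hn1 : (1 : ℝ) ≤ n := by exact_mod_cast hn
  have hn0 : (0 : ℝ) < n := by linarith
  set x := n * q with hx
  have hx0 : 0 ≤ x := by positivity
  have hexp : Real.exp (-x) * Real.exp ((1 / 2) * x) = Real.exp (-((1 / 2) * x)) := by
    rw [← Real.exp_add]; congr 1; ring
  suffices h : ∃ A C M, A * (1 + x) ^ M ≤ A * (C * Real.exp ((1 / 2) * x)) ∧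
      A * C ≤ A₁ * C₁ + A₂ * C₂ ∧
      |binomialWeight k n q - Real.exp (-x) * (1 + charlierCoeff k x / n)| ≤
        Real.exp (-x) * (A * (1 + x) ^ M / n ^ 2) by
    obtain ⟨A, C, M, hM, hAC, h⟩ := h
    refine h.trans ?_
    rw [mul_div_assoc']
    refine div_le_div_of_nonneg_right ?_ (by positivity)
    calc Real.exp (-x) * (A * (1 + x) ^ M)
        ≤ Real.exp (-x) * (A * (C * Real.exp ((1 / 2) * x))) := by gcongr
      _ = A * C * (Real.exp (-x) * Real.exp ((1 / 2) * x)) := by ring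
      _ ≤ _ := by rw [hexp]; gcongr
  rcases le_or_gt q (1 / 2) with hq2 | hq2
  · refine ⟨A₁, C₁, 4 + 2 * k, by gcongr; exact h₁ x hx0, by
      have : 0 < A₂ * C₂ := by positivity
      linarith, ?_⟩
    have e := ((hW n hn hkn).mul hn1 (secondOrder_pow_mul_exp hn hq hq2)).mul hn1
      ((secondOrder_inv hn hq hq2).pow hn1 k)
    obtain ⟨-, -, e3⟩ := e
    have hq' : 1 - q ≠ 0 := by linarith
    have hR : n.descFactorial k / (n : ℝ) ^ k * ((1 - q) ^ n * Real.exp (n * q)) * (1 - q)⁻¹ ^ k =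
        binomialWeight k n q * Real.exp x := by
      rw [binomialWeight, ← Nat.sub_add_cancel hkn, pow_add, Nat.sub_add_cancel hkn, ← hx, inv_pow]
      field_simp
    have ha : -((k : ℝ) * (k - 1) / 2) + -((n * q) ^ 2 / 2) + k * (n * q) = charlierCoeff k x := by
      rw [charlierCoeff, ← hx]; ring
    rw [hR, ha, ← hx] at e3
    have hfac : binomialWeight k n q - Real.exp (-x) * (1 + charlierCoeff k x / n) =
        Real.exp (-x) * (binomialWeight k n q * Real.exp x - 1 - charlierCoeff k x / n) := by
      have : Real.exp (-x) * Real.exp x = 1 := by rw [← Real.exp_add]; simp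
      linear_combination (-binomialWeight k n q) * this
    rw [hfac, abs_mul, abs_of_pos (Real.exp_pos _)]
    refine mul_le_mul_of_nonneg_left (e3.trans ?_) (Real.exp_pos _).le
    refine div_le_div_of_nonneg_right ?_ (by positivity)
    calc 6 * (6 * (W * (6 * (1 + x) ^ 4)) * (6 * (2 * (1 + x) ^ 2)) ^ k)
        ≤ 6 * (6 * (W₀ * (6 * (1 + x) ^ 4)) * (6 * (2 * (1 + x) ^ 2)) ^ k) := by
          gcongr; exact le_max_left _ _
      _ = A₁ * (1 + x) ^ (4 + 2 * k) := by
          simp only [A₁, mul_pow, pow_add, pow_mul]; ring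
  · refine ⟨A₂, C₂, 4, by gcongr; exact h₂ x hx0, by
      have : 0 < A₁ * C₁ := by positivity
      linarith, ?_⟩
    have hnx : (n : ℝ) ≤ 2 * x := by rw [hx]; nlinarith
    have b1 : |binomialWeight k n q| ≤ Real.exp (-x) * Real.exp k := by
      unfold binomialWeight
      have d1 : (n.descFactorial k : ℝ) / (n : ℝ) ^ k ≤ 1 := by
        rw [div_le_one (by positivity)]
        exact_mod_cast Nat.descFactorial_le_pow n k
      have d2 : (1 - q) ^ (n - k) ≤ Real.exp (-x) * Real.exp k := by
        have : 1 - q ≤ Real.exp (-q) := by linarith [Real.add_one_le_exp (-q)]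
        refine (pow_le_pow_left₀ (by linarith) this _).trans ?_
        rw [← Real.exp_nat_mul, ← Real.exp_add, Nat.cast_sub hkn]
        refine Real.exp_le_exp.2 ?_
        rw [hx]
        nlinarith [(Nat.cast_nonneg k : (0 : ℝ) ≤ k)]
      rw [abs_of_nonneg (mul_nonneg (by positivity) (pow_nonneg (by linarith) _))]
      exact (mul_le_of_le_one_left (pow_nonneg (by linarith) _) d1).trans d2
    have b2 : |charlierCoeff k x / n| ≤ (k + 1) ^ 2 * (1 + x) ^ 2 := by
      rw [abs_div, abs_of_pos hn0]
      exact (div_le_self (abs_nonneg _) hn1).trans (abs_charlierCoeff_le k hx0)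
    have b3 : |Real.exp (-x) * (1 + charlierCoeff k x / n)| ≤
        Real.exp (-x) * (1 + (k + 1) ^ 2 * (1 + x) ^ 2) := by
      rw [abs_mul, abs_of_pos (Real.exp_pos _)]
      gcongr
      refine (abs_add_le _ _).trans ?_
      rw [abs_one]; linarith
    have hp : 1 ≤ (1 + x) ^ 2 := one_le_pow₀ (by linarith)
    have hns : (n : ℝ) ^ 2 ≤ 4 * (1 + x) ^ 2 := by nlinarith
    calc _ ≤ |binomialWeight k n q| + |Real.exp (-x) * (1 + charlierCoeff k x / n)| := abs_sub _ _
      _ ≤ Real.exp (-x) * ((Real.exp k + 1 + (k + 1) ^ 2) * (1 + x) ^ 2) := by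
        have : Real.exp k ≤ Real.exp k * (1 + x) ^ 2 := le_mul_of_one_le_right (Real.exp_pos _).le hp
        have : Real.exp (-x) * (Real.exp k + (1 + (k + 1) ^ 2 * (1 + x) ^ 2)) ≤
          Real.exp (-x) * ((Real.exp k + 1 + (k + 1) ^ 2) * (1 + x) ^ 2) := by
            gcongr; nlinarith
        linarith
      _ ≤ _ := by
        gcongr
        rw [le_div_iff₀ (by positivity)]
        calc (Real.exp k + 1 + (k + 1) ^ 2) * (1 + x) ^ 2 * n ^ 2
            ≤ (Real.exp k + 1 + (k + 1) ^ 2) * (1 + x) ^ 2 * (4 * (1 + x) ^ 2) := by gcongr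
          _ = _ := by simp only [A₂]; ring

end Depoissonization

end DigitalTree

/-! ### Cylinders and probabilities of leaf configurations -/

namespace DigitalTree

variable {m : ℕ}

section Prefix

theorem isPrefixOf_iff {w : Word m} {s : ℕ → Fin m} :
    IsPrefixOf w s ↔ w = (List.range w.length).map s := by
  rw [List.ext_get_iff]
  simp [IsPrefixOf]

theorem isPrefixOf_map_range (s : ℕ → Fin m) (k : ℕ) : IsPrefixOf ((List.range k).map s) s := by
  rw [isPrefixOf_iff]; simp

theorem IsPrefixOf.mono {v w : Word m} {s : ℕ → Fin m} (h : IsPrefixOf w s) (hv : v <+: w) :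
    IsPrefixOf v s := fun k hk => by
  rw [hv.getElem hk]
  exact h k _

theorem map_range_prefix (s : ℕ → Fin m) {a b : ℕ} (h : a ≤ b) :
    (List.range a).map s <+: (List.range b).map s := by
  rw [List.prefix_iff_eq_take]
  simp [← List.map_take, List.take_range, min_eq_left h]

theorem IsPrefixOf.prefix_or {v w : Word m} {s : ℕ → Fin m} (hv : IsPrefixOf v s)
    (hw : IsPrefixOf w s) : v <+: w ∨ w <+: v := by
  rw [isPrefixOf_iff] at hv hw
  rw [hv, hw]
  rcases le_total v.length w.length with h | h
  · exact Or.inl (map_range_prefix s h)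
  · exact Or.inr (map_range_prefix s h)

/-- Neither word is a prefix of the other. -/
def Incomparable (v w : Word m) : Prop := ¬ v <+: w ∧ ¬ w <+: v

end Prefix

section Measure

variable (p : Source m)

/-- The infinite strings that begin with `w`. -/
def cylinder (w : Word m) : Set (ℕ → Fin m) := {s | IsPrefixOf w s}

theorem letterLaw_singleton (a : Fin m) : p.letterLaw {a} = ENNReal.ofReal (p.prob a) := by
  simp [Source.letterLaw, Set.indicator_apply, Finset.sum_ite_eq']

theorem cylinder_eq_pi (w : Word m) : cylinder w =
    Set.pi (Finset.range w.length) fun k => if h : k < w.length then {w[k]} else Set.univ := by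
  ext s
  simp only [cylinder, IsPrefixOf, Set.mem_ofPred_eq, Set.mem_pi, Finset.coe_range, Set.mem_Iio]
  refine forall₂_congr fun k hk => ?_
  rw [dif_pos hk, Set.mem_singleton_iff, eq_comm]

theorem measurableSet_cylinder (w : Word m) : MeasurableSet (cylinder w) := by
  rw [cylinder_eq_pi]
  exact MeasurableSet.pi (Finset.countable_toSet _) fun k _ => by measurability

theorem stringLaw_cylinder (w : Word m) :
    p.stringLaw (cylinder w) = ENNReal.ofReal (p.wordProb w) := by
  rw [cylinder_eq_pi, Source.stringLaw, Measure.infinitePi_pi _ (fun k _ => by measurability),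
    Finset.prod_range, Source.wordProb, ← Fin.prod_univ_fun_getElem,
    ENNReal.ofReal_prod_of_nonneg fun i _ => (p.pos _).le]
  refine Finset.prod_congr rfl fun i _ => ?_
  rw [dif_pos i.2, letterLaw_singleton]

/-- Two given strings share their first k letters with probability (Σ p_j²)^k, which tends to 0, and
there are countably many pairs. -/
theorem ae_injective_strings (hm : 2 ≤ m) : ∀ᵐ S ∂p.law, Function.Injective S := by
  have key : ∀ i j : ℕ, i ≠ j → ∀ᵐ S ∂p.law, S i ≠ S j := by
    intro i j hij
    rw [ae_iff]
    simp only [not_not]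
    have hb : ∀ k : ℕ, p.law {S | S i = S j} ≤ ENNReal.ofReal (p.powerSum 2 ^ k) := by
      intro k
      have hsub : {S : Strings m | S i = S j} ⊆ ⋃ u : Fin k → Fin m,
          Set.pi (({i, j} : Finset ℕ) : Set ℕ) fun _ => cylinder (List.ofFn u) := by
        intro S hS
        refine Set.mem_iUnion.2 ⟨fun t => S i t, ?_⟩
        have h : IsPrefixOf (List.ofFn fun t : Fin k => S i t) (S i) := fun t ht => by simp
        intro l hl
        simp only [Finset.coe_insert, Finset.coe_singleton, Set.mem_insert_iff,
          Set.mem_singleton_iff] at hl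
        rcases hl with rfl | rfl
        · exact h
        · rw [Set.mem_ofPred_eq] at hS; rw [← hS]; exact h
      refine (measure_mono hsub).trans ((measure_iUnion_le _).trans (le_of_eq ?_))
      rw [tsum_fintype, Source.powerSum, Fintype.sum_pow,
        ENNReal.ofReal_sum_of_nonneg fun u _ =>
          Finset.prod_nonneg fun t _ => pow_nonneg (p.pos _).le 2]
      refine Finset.sum_congr rfl fun u _ => ?_
      rw [Source.law, Measure.infinitePi_pi _ fun _ _ => measurableSet_cylinder _,
        Finset.prod_pair hij, stringLaw_cylinder, ← ENNReal.ofReal_mul (p.wordProb_pos _).le]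
      congr 1
      rw [Finset.prod_pow, Source.wordProb, List.map_ofFn, List.prod_ofFn, sq]
      rfl
    have hlim : Tendsto (fun k : ℕ => ENNReal.ofReal (p.powerSum 2 ^ k)) atTop (𝓝 0) := by
      rw [← ENNReal.ofReal_zero]
      exact ENNReal.tendsto_ofReal (tendsto_pow_atTop_nhds_zero_of_lt_one (p.powerSum_nonneg 2)
        (Source.powerSum_lt_one hm le_rfl))
    exact le_antisymm (ge_of_tendsto hlim (Eventually.of_forall hb)) bot_le
  have h2 : ∀ᵐ S ∂p.law, ∀ i j : ℕ, i ≠ j → S i ≠ S j := by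
    rw [ae_all_iff]; intro i; rw [ae_all_iff]; intro j
    by_cases hij : i = j
    · simp [hij]
    · filter_upwards [key i j hij] with S hS _ using hS
  filter_upwards [h2] with S hS i j hij
  by_contra h
  exact hS i j h hij

end Measure

section Configurations

/-- Among the first `n` strings exactly one begins with each word of `L`, and those that begin
with a word of `W` begin with a word of `L`. -/
def Config (L W : Finset (Word m)) (n : ℕ) (S : Strings m) : Prop :=
  (∀ l ∈ L, ∃ i < n, IsPrefixOf l (S i) ∧ ∀ j < n, IsPrefixOf l (S j) → j = i) ∧
    ∀ i < n, ∀ w ∈ W, IsPrefixOf w (S i) → ∃ l ∈ L, IsPrefixOf l (S i)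

/-- No word of the set is a prefix of another one. -/
def PrefixFree (L : Finset (Word m)) : Prop := ∀ w ∈ L, ∀ v ∈ L, w <+: v → w = v

theorem PrefixFree.eq_of_isPrefixOf {L : Finset (Word m)} (hL : PrefixFree L) {v w : Word m}
    (hv : v ∈ L) (hw : w ∈ L) {s : ℕ → Fin m} (hvs : IsPrefixOf v s) (hws : IsPrefixOf w s) :
    v = w := by
  rcases hvs.prefix_or hws with h | h
  · exact hL v hv w hw h
  · exact (hL w hw v hv h).symm

/-- The event that the string `σ l` begins with `l`, and the strings outside of the range of `σ`
begin with no word of `W`. -/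
def assignmentEvent (L W : Finset (Word m)) {n : ℕ} (σ : L ↪ Fin n) : Set (Strings m) :=
  {S | (∀ l : L, IsPrefixOf (l : Word m) (S (σ l))) ∧
    ∀ i : Fin n, i ∉ Set.range σ → ∀ w ∈ W, ¬ IsPrefixOf w (S i)}

variable {L W : Finset (Word m)} {n : ℕ}

/-- A configuration determines the string that carries each word of L, injectively because L is
prefix-free. As every word of L extends a word of W, a string outside the range of σ carries no word
of L. -/
theorem setOf_config_eq (hL : PrefixFree L) (hLW : ∀ l ∈ L, ∃ w ∈ W, w <+: l) :
    {S | Config L W n S} = ⋃ σ : L ↪ Fin n, assignmentEvent L W σ := by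
  ext S
  simp only [Set.mem_ofPred_eq, Set.mem_iUnion]
  constructor
  · rintro ⟨h1, h2⟩
    choose! f hf1 hf2 hf3 using h1
    refine ⟨⟨fun l => ⟨f l, hf1 l l.2⟩, fun l l' hll => ?_⟩, fun l => hf2 l l.2, fun i hi w hw hws => ?_⟩
    · have : f l = f l' := by simpa using hll
      exact Subtype.ext (hL.eq_of_isPrefixOf l.2 l'.2 (hf2 l l.2) (this ▸ hf2 l' l'.2))
    · obtain ⟨l, hl, hlS⟩ := h2 i i.2 w hw hws
      exact hi ⟨⟨l, hl⟩, Fin.ext (hf3 l hl i i.2 hlS).symm⟩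
  · rintro ⟨σ, h1, h2⟩
    constructor
    · intro l hl
      refine ⟨σ ⟨l, hl⟩, (σ ⟨l, hl⟩).2, h1 ⟨l, hl⟩, fun j hj hlj => ?_⟩
      by_cases hr : (⟨j, hj⟩ : Fin n) ∈ Set.range σ
      · obtain ⟨l', hl'⟩ := hr
        have h3 := h1 l'
        rw [hl'] at h3
        have : l = l' := hL.eq_of_isPrefixOf hl l'.2 hlj h3
        subst this
        exact (congrArg Fin.val hl').symm
      · obtain ⟨w, hw, hwl⟩ := hLW l hl
        exact absurd (hlj.mono hwl) (h2 ⟨j, hj⟩ hr w hw)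
    · intro i hi w hw hwi
      by_cases hr : (⟨i, hi⟩ : Fin n) ∈ Set.range σ
      · obtain ⟨l, hl⟩ := hr
        have h3 := h1 l
        rw [hl] at h3
        exact ⟨l, l.2, h3⟩
      · exact absurd hwi (h2 ⟨i, hi⟩ hr w hw)

theorem pairwise_disjoint_assignmentEvent (hL : PrefixFree L) (hLW : ∀ l ∈ L, ∃ w ∈ W, w <+: l) :
    Pairwise (Function.onFun Disjoint fun σ : L ↪ Fin n => assignmentEvent L W σ) := by
  intro σ σ' hσ
  refine Set.disjoint_left.2 fun S h h' => hσ ?_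
  ext l
  by_contra hne
  by_cases hr : σ' l ∈ Set.range σ
  · obtain ⟨l', hl'⟩ := hr
    have h1 := h.1 l'
    rw [hl'] at h1
    have : l' = l := Subtype.ext (hL.eq_of_isPrefixOf l'.2 l.2 h1 (h'.1 l))
    subst this
    exact hne (congrArg Fin.val hl')
  · obtain ⟨w, hw, hwl⟩ := hLW l l.2
    exact h.2 _ hr w hw ((h'.1 l).mono hwl)

-- The event constrains each string separately, so independence of the strings makes its probability
-- a product.
open Classical in
theorem assignmentEvent_eq_pi (σ : L ↪ Fin n) : assignmentEvent L W σ =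
    Set.pi (Finset.range n) fun i => if h : ∃ l, (σ l : ℕ) = i then cylinder (h.choose : Word m)
      else (⋃ w ∈ W, cylinder w)ᶜ := by
  ext S
  simp only [assignmentEvent, Set.mem_ofPred_eq, Set.mem_pi, Finset.coe_range, Set.mem_Iio]
  constructor
  · rintro ⟨h1, h2⟩ i hi
    split_ifs with h
    · have := h1 h.choose
      rwa [h.choose_spec] at this
    · simp only [Set.mem_compl_iff, Set.mem_iUnion, not_exists]
      intro w hw hws
      refine h2 ⟨i, hi⟩ ?_ w hw hws
      rintro ⟨l, hl⟩
      exact h ⟨l, congrArg Fin.val hl⟩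
  · intro h
    constructor
    · intro l
      have h1 := h (σ l) (σ l).2
      have hex : ∃ l', (σ l' : ℕ) = σ l := ⟨l, rfl⟩
      rw [dif_pos hex] at h1
      have : hex.choose = l := σ.injective (Fin.ext hex.choose_spec)
      rwa [this] at h1
    · intro i hi w hw hws
      have h1 := h i i.2
      rw [dif_neg] at h1
      · exact h1 (Set.mem_biUnion hw hws)
      · rintro ⟨l, hl⟩
        exact hi ⟨l, Fin.ext hl⟩

theorem measurableSet_assignmentEvent (σ : L ↪ Fin n) :
    MeasurableSet (assignmentEvent L W σ) := by
  classical
  rw [assignmentEvent_eq_pi]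
  refine MeasurableSet.pi (Finset.countable_toSet _) fun i _ => ?_
  split_ifs
  · exact measurableSet_cylinder _
  · exact (Finset.measurableSet_biUnion _ fun w _ => measurableSet_cylinder w).compl

theorem measurableSet_config (hL : PrefixFree L) (hLW : ∀ l ∈ L, ∃ w ∈ W, w <+: l) :
    MeasurableSet {S | Config L W n S} := by
  rw [setOf_config_eq hL hLW]
  exact MeasurableSet.iUnion fun σ => measurableSet_assignmentEvent σ

variable (p : Source m)

theorem stringLaw_compl_cylinders (hW : PrefixFree W) :
    p.stringLaw (⋃ w ∈ W, cylinder w)ᶜ = ENNReal.ofReal (1 - ∑ w ∈ W, p.wordProb w) := by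
  rw [prob_compl_eq_one_sub (Finset.measurableSet_biUnion _ fun w _ => measurableSet_cylinder w),
    measure_biUnion_finset _ fun w _ => measurableSet_cylinder w]
  · simp only [stringLaw_cylinder]
    rw [← ENNReal.ofReal_sum_of_nonneg fun w _ => (p.wordProb_pos w).le,
      ENNReal.ofReal_sub _ (Finset.sum_nonneg fun w _ => (p.wordProb_pos w).le), ENNReal.ofReal_one]
  · intro v hv w hw hvw
    exact Set.disjoint_left.2 fun s hs hs' => hvw (hW.eq_of_isPrefixOf hv hw hs hs')

/-- Kraft's inequality: the cylinders of a prefix-free set are disjoint. -/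
theorem sum_wordProb_le_one (hW : PrefixFree W) : ∑ w ∈ W, p.wordProb w ≤ 1 := by
  have h : p.stringLaw (⋃ w ∈ W, cylinder w) = ENNReal.ofReal (∑ w ∈ W, p.wordProb w) := by
    rw [measure_biUnion_finset _ fun w _ => measurableSet_cylinder w]
    · simp only [stringLaw_cylinder]
      rw [← ENNReal.ofReal_sum_of_nonneg fun w _ => (p.wordProb_pos w).le]
    · intro v hv w hw hvw
      exact Set.disjoint_left.2 fun s hs hs' => hvw (hW.eq_of_isPrefixOf hv hw hs hs')
  rw [← ENNReal.ofReal_le_one, ← h]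
  exact prob_le_one

theorem law_assignmentEvent (hW : PrefixFree W) (σ : L ↪ Fin n) :
    p.law (assignmentEvent L W σ) = ENNReal.ofReal
      ((∏ l ∈ L, p.wordProb l) * (1 - ∑ w ∈ W, p.wordProb w) ^ (n - L.card)) := by
  classical
  rw [assignmentEvent_eq_pi, Source.law, Measure.infinitePi_pi]
  · have hsplit : ∀ i : Fin n, p.stringLaw (if h : ∃ l, (σ l : ℕ) = i then
        cylinder (h.choose : Word m) else (⋃ w ∈ W, cylinder w)ᶜ) =
        if h : ∃ l, σ l = i then ENNReal.ofReal (p.wordProb (h.choose : Word m)) else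
          ENNReal.ofReal (1 - ∑ w ∈ W, p.wordProb w) := by
      intro i
      simp only [Fin.val_inj]
      split_ifs
      · exact stringLaw_cylinder p _
      · exact stringLaw_compl_cylinders p hW
    rw [Finset.prod_range]
    simp only [hsplit]
    rw [← Finset.prod_mul_prod_compl (Finset.univ.map σ)]
    have h1 : ∏ i ∈ Finset.univ.map σ, (if h : ∃ l, σ l = i then
        ENNReal.ofReal (p.wordProb (h.choose : Word m)) else
          ENNReal.ofReal (1 - ∑ w ∈ W, p.wordProb w)) = ENNReal.ofReal (∏ l ∈ L, p.wordProb l) := by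
      rw [Finset.prod_map, ENNReal.ofReal_prod_of_nonneg fun l _ => (p.wordProb_pos l).le,
        ← Finset.prod_coe_sort L]
      refine Finset.prod_congr rfl fun l _ => ?_
      have hex : ∃ l', σ l' = σ l := ⟨l, rfl⟩
      rw [dif_pos hex, σ.injective hex.choose_spec]
    have h2 : ∏ i ∈ (Finset.univ.map σ)ᶜ, (if h : ∃ l, σ l = i then
        ENNReal.ofReal (p.wordProb (h.choose : Word m)) else
          ENNReal.ofReal (1 - ∑ w ∈ W, p.wordProb w)) =
        ENNReal.ofReal ((1 - ∑ w ∈ W, p.wordProb w) ^ (n - L.card)) := by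
      rw [Finset.prod_congr rfl (g := fun _ => ENNReal.ofReal (1 - ∑ w ∈ W, p.wordProb w)),
        Finset.prod_const, Finset.card_compl, Finset.card_map, Finset.card_univ, Fintype.card_fin,
        Fintype.card_coe, ENNReal.ofReal_pow (sub_nonneg.2 (sum_wordProb_le_one p hW))]
      intro i hi
      rw [dif_neg]
      rintro ⟨l, hl⟩
      exact Finset.mem_compl.1 hi (Finset.mem_map.2 ⟨l, Finset.mem_univ _, hl⟩)
    rw [h1, h2, ← ENNReal.ofReal_mul (Finset.prod_nonneg fun l _ => (p.wordProb_pos l).le)]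
  · intro i _
    split_ifs
    · exact measurableSet_cylinder _
    · exact (Finset.measurableSet_biUnion _ fun w _ => measurableSet_cylinder w).compl

/-- The possible assignments are the injections of L into the n strings; their events are disjoint
and equally likely. -/
theorem law_config (hL : PrefixFree L) (hW : PrefixFree W) (hLW : ∀ l ∈ L, ∃ w ∈ W, w <+: l) :
    p.law {S | Config L W n S} = ENNReal.ofReal (n.descFactorial L.card *
      ((∏ l ∈ L, p.wordProb l) * (1 - ∑ w ∈ W, p.wordProb w) ^ (n - L.card))) := by
  rw [setOf_config_eq hL hLW, measure_iUnion (pairwise_disjoint_assignmentEvent hL hLW)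
    fun σ => measurableSet_assignmentEvent σ]
  simp only [law_assignmentEvent p hW]
  rw [tsum_fintype, Finset.sum_const, Finset.card_univ, Fintype.card_embedding_eq,
    Fintype.card_fin, Fintype.card_coe, nsmul_eq_mul, ENNReal.ofReal_mul (Nat.cast_nonneg _),
    ENNReal.ofReal_natCast]

end Configurations

end DigitalTree

/-! ### Occurrences of motifs as leaf configurations -/

namespace DigitalTree

variable {m : ℕ}

section Trie

variable {n : ℕ} {S : Strings m} {T T' : Motif m} {u v w : Word m}

/-- If one leaf over a string were a proper prefix of another, minimality of the longer one would
put a second string below the shorter one. -/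
theorem trie_eq_of_isPrefixOf {i : ℕ} (hu : u ∈ trie n S) (hv : v ∈ trie n S) (hi : i < n)
    (hui : IsPrefixOf u (S i)) (hvi : IsPrefixOf v (S i)) : u = v := by
  have key : ∀ u v : Word m, u ∈ trie n S → v ∈ trie n S → IsPrefixOf u (S i) →
      IsPrefixOf v (S i) → u <+: v → u = v := by
    intro u v hu hv hui hvi huv
    by_contra hne
    obtain ⟨j, hj, hju, hju', -⟩ := hu
    obtain ⟨k, hk, hkv, hkv', hmin⟩ := hv
    have hij : i = j := by_contra fun h => hju' i hi h hui
    have hik : i = k := by_contra fun h => hkv' i hi h hvi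
    obtain ⟨l, hl, hlk, hlu⟩ := hmin u huv hne
    exact hju' l hl (by rw [← hij, hik]; exact hlk) hlu
  rcases hui.prefix_or hvi with h | h
  · exact key u v hu hv hui hvi h
  · exact (key v u hv hu hvi hui h).symm

theorem exists_mem_trie (hS : Function.Injective S) {i : ℕ} (hi : i < n) :
    ∃ u ∈ trie n S, IsPrefixOf u (S i) := by
  classical
  have hex : ∃ k, ∀ j < n, j ≠ i → ¬ IsPrefixOf ((List.range k).map (S i)) (S j) := by
    have h : ∀ j, ∃ k, j ≠ i → S i k ≠ S j k := fun j => by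
      by_cases hj : j = i
      · exact ⟨0, fun h => absurd hj h⟩
      · obtain ⟨k, hk⟩ := Function.ne_iff.1 (hS.ne (Ne.symm hj))
        exact ⟨k, fun _ => hk⟩
    choose k hk using h
    refine ⟨(Finset.range n).sup k + 1, fun j hj hji hpre => hk j hji ?_⟩
    have hlt : k j < (Finset.range n).sup k + 1 :=
      Nat.lt_succ_of_le (Finset.le_sup (f := k) (Finset.mem_range.2 hj))
    have := hpre (k j) (by simpa using hlt)
    simpa using this
  refine ⟨(List.range (Nat.find hex)).map (S i), ⟨i, hi, isPrefixOf_map_range _ _,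
    Nat.find_spec hex, fun v hv hne => ?_⟩, isPrefixOf_map_range _ _⟩
  have hlt : v.length < Nat.find hex := by
    have h1 := hv.length_le
    have h2 : v.length ≠ ((List.range (Nat.find hex)).map (S i)).length :=
      fun h => hne (hv.eq_of_length h)
    rw [List.length_map, List.length_range] at h1 h2
    omega
  have h3 := Nat.find_min hex hlt
  push Not at h3
  rwa [← isPrefixOf_iff.1 ((isPrefixOf_map_range (S i) (Nat.find hex)).mono hv)] at h3

/-- The leaves of a copy of `T` that is rooted at `w`. -/
def Motif.shift (T : Motif m) (w : Word m) : Finset (Word m) := T.leaves.image (w ++ ·)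

theorem Motif.mem_shift : u ∈ T.shift w ↔ ∃ l ∈ T.leaves, w ++ l = u := by
  simp [Motif.shift]

theorem Motif.prefixFree_shift (T : Motif m) (w : Word m) : PrefixFree (T.shift w) := by
  intro u hu v hv huv
  obtain ⟨l, hl, rfl⟩ := Motif.mem_shift.1 hu
  obtain ⟨l', hl', rfl⟩ := Motif.mem_shift.1 hv
  rw [T.prefix_free l hl l' hl' ((List.prefix_append_right_inj w).1 huv)]

theorem Motif.card_shift (T : Motif m) (w : Word m) : (T.shift w).card = T.size :=
  Finset.card_image_of_injective _ (List.append_right_injective w)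

theorem Motif.nil_notMem (hT : 2 ≤ T.size) : [] ∉ T.leaves := by
  intro h
  have : T.leaves ⊆ {[]} := fun v hv => by
    rw [Finset.mem_singleton, T.prefix_free [] h v hv (List.nil_prefix)]
  have := Finset.card_le_card this
  rw [Finset.card_singleton] at this
  exact absurd hT (by rw [Motif.size]; omega)

/-- Every proper prefix of w ++ l is also a prefix of w ++ l' for the leaf l' that `branching`
provides, so a second string shares it. Having two leaves excludes l = []. -/
theorem mem_trie_of_config (hT : 2 ≤ T.size) (h : Config (T.shift w) {w} n S) {l : Word m}
    (hl : l ∈ T.leaves) : w ++ l ∈ trie n S := by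
  obtain ⟨i, hi, hpre, huniq⟩ := h.1 (w ++ l) (Motif.mem_shift.2 ⟨l, hl, rfl⟩)
  refine ⟨i, hi, hpre, fun j hj hji hj' => hji (huniq j hj hj'), fun v hv hne => ?_⟩
  have hnil : l ≠ [] := fun h => Motif.nil_notMem hT (h ▸ hl)
  obtain ⟨l', hl', hll', hdrop⟩ := T.branching l hl hnil
  obtain ⟨j, hj, hpre', -⟩ := h.1 (w ++ l') (Motif.mem_shift.2 ⟨l', hl', rfl⟩)
  refine ⟨j, hj, ?_, ?_⟩
  · rintro rfl
    have := (T.prefixFree_shift w).eq_of_isPrefixOf (Motif.mem_shift.2 ⟨l, hl, rfl⟩)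
      (Motif.mem_shift.2 ⟨l', hl', rfl⟩) hpre hpre'
    exact hll' (List.append_cancel_left this).symm
  · refine hpre'.mono ?_
    have h1 : v <+: w ++ l.dropLast := by
      rw [← List.dropLast_append_of_ne_nil hnil]
      refine List.prefix_of_prefix_length_le hv (List.dropLast_prefix _) ?_
      have h2 := hv.length_le
      have h3 : v.length ≠ (w ++ l).length := fun h => hne (hv.eq_of_length h)
      rw [List.length_dropLast]
      omega
    exact h1.trans ((List.prefix_append_right_inj w).2 hdrop)

theorem subtree_eq_of_config (hT : 2 ≤ T.size) (h : Config (T.shift w) {w} n S) :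
    subtree (trie n S) w = (T.leaves : Set (Word m)) := by
  ext x
  constructor
  · intro hx
    obtain ⟨i, hi, hpre, -⟩ := id hx
    obtain ⟨u, hu, hui⟩ := h.2 i hi w (Finset.mem_singleton_self w)
      (hpre.mono (List.prefix_append w x))
    obtain ⟨l, hl, rfl⟩ := Motif.mem_shift.1 hu
    have := trie_eq_of_isPrefixOf hx (mem_trie_of_config hT h hl) hi hpre hui
    rw [List.append_cancel_left this]
    exact hl
  · exact fun hx => mem_trie_of_config hT h hx

/-- The trie leaf of a string through w either extends w, as wanted, or is a prefix of w. In the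
latter case it belongs to a single string, which would have to carry all leaves of the copy of `T`,
and there are at least two of them. -/
theorem config_of_subtree_eq (hT : 2 ≤ T.size)
    (hS : ∀ i < n, ∃ u ∈ trie n S, IsPrefixOf u (S i))
    (h : subtree (trie n S) w = (T.leaves : Set (Word m))) : Config (T.shift w) {w} n S := by
  have hmem : ∀ l, l ∈ T.leaves ↔ w ++ l ∈ trie n S := fun l => by
    rw [← Finset.mem_coe, ← h]; rfl
  constructor
  · intro u hu
    obtain ⟨l, hl, rfl⟩ := Motif.mem_shift.1 hu
    obtain ⟨i, hi, hpre, huniq, -⟩ := (hmem l).1 hl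
    exact ⟨i, hi, hpre, fun j hj hj' => by_contra fun hji => huniq j hj hji hj'⟩
  · intro i hi w' hw' hpre
    rw [Finset.mem_singleton] at hw'
    subst hw'
    obtain ⟨u, hu, hui⟩ := hS i hi
    rcases hpre.prefix_or hui with ⟨x, rfl⟩ | huw
    · exact ⟨_, Motif.mem_shift.2 ⟨x, (hmem x).2 hu, rfl⟩, hui⟩
    · exfalso
      obtain ⟨l, hl, l', hl', hne⟩ := Finset.one_lt_card.1 (show 1 < T.leaves.card from hT)
      have key : ∀ l ∈ T.leaves, IsPrefixOf (w' ++ l) (S i) := by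
        intro l hl
        obtain ⟨j, hj, hprej, -⟩ := (hmem l).1 hl
        obtain ⟨k, hk, -, hku, -⟩ := id hu
        have h1 : i = k := by_contra fun h => hku i hi h hui
        have h2 : j = k := by_contra fun h => hku j hj h
          (hprej.mono (huw.trans (List.prefix_append _ _)))
        rwa [h1, ← h2]
      have := trie_eq_of_isPrefixOf ((hmem l).1 hl) ((hmem l').1 hl') hi (key l hl) (key l' hl')
      exact hne (List.append_cancel_left this)

/-- The event that the subtree at `w` of the trie on `n` strings equals `T`. -/
def occurs (T : Motif m) (n : ℕ) (w : Word m) : Set (Strings m) :=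
  {S | subtree (trie n S) w = (T.leaves : Set (Word m))}

theorem ae_mem_occurs_iff (p : Source m) (hm : 2 ≤ m) (hT : 2 ≤ T.size) (n : ℕ) (w : Word m) :
    ∀ᵐ S ∂p.law, S ∈ occurs T n w ↔ S ∈ {S | Config (T.shift w) {w} n S} := by
  filter_upwards [ae_injective_strings p hm] with S hS
  exact ⟨config_of_subtree_eq hT fun i hi => exists_mem_trie hS hi, subtree_eq_of_config hT⟩

theorem prefixFree_singleton (w : Word m) : PrefixFree {w} := by
  intro u hu v hv _
  rw [Finset.mem_singleton] at hu hv
  rw [hu, hv]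

theorem prefixFree_pair (h : Incomparable v w) : PrefixFree {v, w} := by
  intro a ha b hb hab
  simp only [Finset.mem_insert, Finset.mem_singleton] at ha hb
  rcases ha with rfl | rfl <;> rcases hb with rfl | rfl
  · rfl
  · exact absurd hab h.1
  · exact absurd hab h.2
  · rfl

theorem prefix_of_mem_shift (hu : u ∈ T.shift w) : w <+: u := by
  obtain ⟨l, _, rfl⟩ := Motif.mem_shift.1 hu
  exact List.prefix_append w l

theorem Incomparable.not_isPrefixOf (h : Incomparable v w) {s : ℕ → Fin m} (hv : IsPrefixOf v s) :
    ¬ IsPrefixOf w s := fun hw => (hv.prefix_or hw).elim h.1 h.2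

theorem Incomparable.disjoint_shift (h : Incomparable v w) : Disjoint (T.shift v) (T'.shift w) := by
  refine Finset.disjoint_left.2 fun u hu hu' => ?_
  rcases List.prefix_or_prefix_of_prefix (prefix_of_mem_shift hu) (prefix_of_mem_shift hu')
    with h1 | h1
  · exact h.1 h1
  · exact h.2 h1

theorem Incomparable.prefixFree_union (h : Incomparable v w) :
    PrefixFree (T.shift v ∪ T'.shift w) := by
  have key : ∀ {T T' : Motif m} {v w a b : Word m}, Incomparable v w → a ∈ T.shift v →
      b ∈ T'.shift w → ¬ a <+: b := by
    intro T T' v w a b h ha hb hab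
    rcases List.prefix_or_prefix_of_prefix ((prefix_of_mem_shift ha).trans hab)
      (prefix_of_mem_shift hb) with h1 | h1
    · exact h.1 h1
    · exact h.2 h1
  intro a ha b hb hab
  rcases Finset.mem_union.1 ha with ha | ha <;> rcases Finset.mem_union.1 hb with hb | hb
  · exact T.prefixFree_shift v a ha b hb hab
  · exact absurd hab (key h ha hb)
  · exact absurd hab (key ⟨h.2, h.1⟩ ha hb)
  · exact T'.prefixFree_shift w a ha b hb hab

/-- No string passes through two incomparable nodes, so the joint condition decouples. -/
theorem Incomparable.config_union_iff (h : Incomparable v w) :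
    Config (T.shift v ∪ T'.shift w) {v, w} n S ↔
      Config (T.shift v) {v} n S ∧ Config (T'.shift w) {w} n S := by
  constructor
  · rintro ⟨h1, h2⟩
    refine ⟨⟨fun l hl => h1 l (Finset.mem_union_left _ hl), fun i hi u hu hui => ?_⟩,
      ⟨fun l hl => h1 l (Finset.mem_union_right _ hl), fun i hi u hu hui => ?_⟩⟩ <;>
    rw [Finset.mem_singleton] at hu <;> subst hu
    · obtain ⟨l, hl, hli⟩ := h2 i hi u (by simp) hui
      rcases Finset.mem_union.1 hl with hl | hl
      · exact ⟨l, hl, hli⟩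
      · exact absurd (hli.mono (prefix_of_mem_shift hl)) (h.not_isPrefixOf hui)
    · obtain ⟨l, hl, hli⟩ := h2 i hi u (by simp) hui
      rcases Finset.mem_union.1 hl with hl | hl
      · exact absurd hui (h.not_isPrefixOf (hli.mono (prefix_of_mem_shift hl)))
      · exact ⟨l, hl, hli⟩
  · rintro ⟨⟨h1, h2⟩, ⟨h3, h4⟩⟩
    refine ⟨fun l hl => (Finset.mem_union.1 hl).elim (h1 l) (h3 l), fun i hi u hu hui => ?_⟩
    rcases Finset.mem_insert.1 hu with rfl | hu
    · obtain ⟨l, hl, hli⟩ := h2 i hi u (Finset.mem_singleton_self u) hui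
      exact ⟨l, Finset.mem_union_left _ hl, hli⟩
    · obtain ⟨l, hl, hli⟩ := h4 i hi u hu hui
      exact ⟨l, Finset.mem_union_right _ hl, hli⟩

/-- Occurrences of the two motifs are disjoint unless they coincide. -/
def Motif.Compatible (T T' : Motif m) : Prop := T = T' ∨ T.Nonoverlapping T'

theorem Motif.Compatible.symm (h : T.Compatible T') : T'.Compatible T :=
  h.imp Eq.symm fun h => ⟨h.2, h.1⟩

theorem subtree_subtree (L : Set (Word m)) (v w : Word m) :
    subtree (subtree L v) w = subtree L (v ++ w) := by
  ext x; simp [subtree]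

/-- An occurrence below another one is a subtree of the upper motif. Nonoverlapping motifs exclude
this, and for equal motifs a longest leaf cannot be prolonged. -/
theorem Motif.Compatible.append_eq (h : T.Compatible T') (hT : 2 ≤ T.size)
    (h1 : S ∈ occurs T n v) (h2 : S ∈ occurs T' n (v ++ u)) : T = T' ∧ u = [] := by
  have h3 : subtree (T.leaves : Set (Word m)) u = (T'.leaves : Set (Word m)) := by
    rw [← h1, subtree_subtree]; exact h2
  rcases h with rfl | h
  · refine ⟨rfl, ?_⟩
    have hne : T.leaves.Nonempty := Finset.card_pos.1 (show 0 < T.size by omega)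
    obtain ⟨l, hl, hmax⟩ := Finset.exists_max_image T.leaves List.length hne
    have : l ∈ subtree (T.leaves : Set (Word m)) u := by rw [h3]; exact hl
    have := hmax _ this
    simpa using this
  · exact absurd ⟨u, h3⟩ h.2

theorem Motif.Compatible.eq_of_mem_occurs (h : T.Compatible T') (hT : 2 ≤ T.size)
    (hT' : 2 ≤ T'.size) (hvw : ¬ Incomparable v w)
    (h1 : S ∈ occurs T n v) (h2 : S ∈ occurs T' n w) : T = T' ∧ v = w := by
  unfold Incomparable at hvw
  by_cases hp : v <+: w
  · obtain ⟨u, rfl⟩ := hp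
    obtain ⟨rfl, rfl⟩ := h.append_eq hT h1 h2
    simp
  · have : w <+: v := by by_contra h; exact hvw ⟨hp, h⟩
    obtain ⟨u, rfl⟩ := this
    obtain ⟨rfl, rfl⟩ := h.symm.append_eq hT' h2 h1
    simp

/-- The empty motif appears in every motif, below any word that is longer than all leaves. -/
theorem Motif.Nonoverlapping.nonempty (hm : 2 ≤ m) (h : T.Nonoverlapping T') :
    T.leaves.Nonempty := by
  by_contra hT
  rw [Finset.not_nonempty_iff_eq_empty] at hT
  refine h.1 ⟨List.replicate (T'.leaves.sup List.length + 1) ⟨0, by omega⟩, ?_⟩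
  ext x
  simp only [hT, Finset.coe_empty, Set.mem_empty_iff_false, iff_false]
  intro hx
  have h1 := Finset.le_sup (f := List.length) (show _ ∈ T'.leaves from hx)
  rw [List.length_append, List.length_replicate] at h1
  omega

theorem Motif.Nonoverlapping.symm (h : T.Nonoverlapping T') : T'.Nonoverlapping T := ⟨h.2, h.1⟩

/-- The one-leaf motif appears at each leaf of any nonempty motif. Hence the covariance statement
needs no condition on the sizes. -/
theorem Motif.Nonoverlapping.two_le_size (hm : 2 ≤ m) (h : T.Nonoverlapping T') : 2 ≤ T.size := by
  have h0 : 0 < T.leaves.card := (h.nonempty hm).card_pos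
  by_contra hlt
  obtain ⟨l, hl⟩ := Finset.card_eq_one.1 (show T.leaves.card = 1 by rw [Motif.size] at hlt; omega)
  have hnil : l = [] := by
    by_contra hne
    obtain ⟨v, hv, hvl, -⟩ := T.branching l (by simp [hl]) hne
    rw [hl, Finset.mem_singleton] at hv
    exact hvl hv
  subst hnil
  obtain ⟨l', hl'⟩ := h.symm.nonempty hm
  refine h.1 ⟨l', ?_⟩
  ext x
  simp only [hl, Finset.coe_singleton, Set.mem_singleton_iff]
  constructor
  · intro hx
    have := T'.prefix_free l' hl' _ hx (List.prefix_append l' x)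
    simpa using this
  · rintro rfl
    simpa [subtree] using hl'

end Trie

end DigitalTree

/-! ### Moments of the counts for a fixed number of strings -/

namespace DigitalTree

variable {m : ℕ}

section Moments

variable (p : Source m) (T T' : Motif m)

/-- The product of the probabilities of the leaves of a motif. -/
noncomputable def Motif.leafProd : ℝ := ∏ l ∈ T.leaves, p.wordProb l

theorem Motif.leafProd_pos : 0 < T.leafProd p := Finset.prod_pos fun l _ => p.wordProb_pos l

theorem Motif.prod_shift (w : Word m) :
    ∏ l ∈ T.shift w, p.wordProb l = T.leafProd p * p.wordProb w ^ T.size := by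
  rw [Motif.shift, Finset.prod_image (List.append_right_injective w).injOn]
  simp only [p.wordProb_append, Finset.prod_mul_distrib, Finset.prod_const]
  rw [mul_comm]
  rfl

/-- The probability that the subtree at a node of probability `x` of the trie on `n` strings
equals `T`. -/
noncomputable def Motif.occProb (n : ℕ) (x : ℝ) : ℝ :=
  n.descFactorial T.size * (T.leafProd p * x ^ T.size * (1 - x) ^ (n - T.size))

/-- The probability that the subtrees at two incomparable nodes of probabilities `x` and `y` of
the trie on `n` strings equal `T` and `T'`. -/
noncomputable def Motif.pairProb (n : ℕ) (x y : ℝ) : ℝ :=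
  n.descFactorial (T.size + T'.size) * (T.leafProd p * x ^ T.size *
    (T'.leafProd p * y ^ T'.size) * (1 - (x + y)) ^ (n - (T.size + T'.size)))

variable {T T'}

theorem law_occurs (hm : 2 ≤ m) (hT : 2 ≤ T.size) (n : ℕ) (w : Word m) :
    p.law (occurs T n w) = ENNReal.ofReal (T.occProb p n (p.wordProb w)) := by
  rw [measure_congr (eventuallyEq_set.2 (ae_mem_occurs_iff p hm hT n w)),
    law_config p (T.prefixFree_shift w) (prefixFree_singleton w)
      fun l hl => ⟨w, Finset.mem_singleton_self w, prefix_of_mem_shift hl⟩,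
    T.card_shift, T.prod_shift, Finset.sum_singleton, Motif.occProb]

theorem law_occurs_inter (hm : 2 ≤ m) (hT : 2 ≤ T.size) (hT' : 2 ≤ T'.size) (n : ℕ) {v w : Word m}
    (h : Incomparable v w) : p.law (occurs T n v ∩ occurs T' n w) =
      ENNReal.ofReal (T.pairProb p T' n (p.wordProb v) (p.wordProb w)) := by
  have hne : v ≠ w := by rintro rfl; exact h.1 (List.prefix_refl v)
  have hae : ∀ᵐ S ∂p.law, S ∈ occurs T n v ∩ occurs T' n w ↔
      S ∈ {S | Config (T.shift v ∪ T'.shift w) {v, w} n S} := by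
    filter_upwards [ae_mem_occurs_iff p hm hT n v, ae_mem_occurs_iff p hm hT' n w] with S h1 h2
    rw [Set.mem_inter_iff, h1, h2]
    exact h.config_union_iff.symm
  rw [measure_congr (eventuallyEq_set.2 hae), law_config p h.prefixFree_union (prefixFree_pair h),
    Finset.card_union_of_disjoint h.disjoint_shift, Finset.prod_union h.disjoint_shift,
    T.card_shift, T'.card_shift, T.prod_shift, T'.prod_shift, Finset.sum_pair hne, Motif.pairProb]
  intro l hl
  rcases Finset.mem_union.1 hl with hl | hl
  · exact ⟨v, by simp, prefix_of_mem_shift hl⟩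
  · exact ⟨w, by simp, prefix_of_mem_shift hl⟩

/-- This is the occurrence probability at the root for n = τ, where x = 1 and the last factor is 0^0
= 1. -/
theorem shape_eq (hm : 2 ≤ m) (hT : 2 ≤ T.size) : T.shape p = (T.size)! * T.leafProd p := by
  have h : {S : Strings m | trie T.size S = (T.leaves : Set (Word m))} = occurs T T.size [] := by
    ext S; simp [occurs, subtree]
  rw [Motif.shape, h, Measure.real, law_occurs p hm hT, Motif.occProb, p.wordProb_nil,
    Nat.descFactorial_self, ENNReal.toReal_ofReal]
  · simp
  · have := (T.leafProd_pos p).le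
    simp only [one_pow, sub_self, tsub_self, pow_zero]
    positivity

theorem occProb_nonneg (n : ℕ) (w : Word m) : 0 ≤ T.occProb p n (p.wordProb w) := by
  have h1 := (T.leafProd_pos p).le
  have h2 := (p.wordProb_pos w).le
  have h3 : 0 ≤ 1 - p.wordProb w := sub_nonneg.2 (p.wordProb_le_one w)
  unfold Motif.occProb
  positivity

theorem wordProb_add_le_one {v w : Word m} (h : Incomparable v w) :
    p.wordProb v + p.wordProb w ≤ 1 := by
  have hne : v ≠ w := by rintro rfl; exact h.1 (List.prefix_refl v)
  simpa [Finset.sum_pair hne] using sum_wordProb_le_one p (prefixFree_pair h)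

theorem pairProb_nonneg (n : ℕ) {v w : Word m} (h : Incomparable v w) :
    0 ≤ T.pairProb p T' n (p.wordProb v) (p.wordProb w) := by
  have h1 := (T.leafProd_pos p).le
  have h2 := (p.wordProb_pos v).le
  have h1' := (T'.leafProd_pos p).le
  have h2' := (p.wordProb_pos w).le
  have h3 : 0 ≤ 1 - (p.wordProb v + p.wordProb w) := sub_nonneg.2 (wordProb_add_le_one p h)
  unfold Motif.pairProb
  positivity

theorem nullMeasurableSet_occurs (hm : 2 ≤ m) (hT : 2 ≤ T.size) (n : ℕ) (w : Word m) :
    NullMeasurableSet (occurs T n w) p.law :=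
  ((measurableSet_config (T.prefixFree_shift w) fun _ hl =>
    ⟨w, Finset.mem_singleton_self w, prefix_of_mem_shift hl⟩).nullMeasurableSet).congr
    (eventuallyEq_set.2 (ae_mem_occurs_iff p hm hT n w)).symm

/-- Appending one fixed leaf to the occurrence nodes gives distinct leaves of the trie, hence
distinct strings. -/
theorem finite_occurrences (hT : 2 ≤ T.size) (n : ℕ) (S : Strings m) :
    {w | S ∈ occurs T n w}.Finite ∧ {w | S ∈ occurs T n w}.ncard ≤ n := by
  obtain ⟨l, hl⟩ : T.leaves.Nonempty := Finset.card_pos.1 (show 0 < T.size by omega)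
  have hmem : ∀ w ∈ {w | S ∈ occurs T n w}, w ++ l ∈ trie n S := by
    intro w hw
    have : l ∈ (T.leaves : Set (Word m)) := hl
    rw [← show subtree (trie n S) w = T.leaves from hw] at this
    exact this
  have hex : ∀ w ∈ {w | S ∈ occurs T n w}, ∃ i < n, IsPrefixOf (w ++ l) (S i) := fun w hw => by
    obtain ⟨i, hi, h, -⟩ := hmem w hw
    exact ⟨i, hi, h⟩
  choose! f hf1 hf2 using hex
  have hinj : Set.InjOn f {w | S ∈ occurs T n w} := fun w hw w' hw' h => by
    have := trie_eq_of_isPrefixOf (hmem w hw) (hmem w' hw') (hf1 w hw) (hf2 w hw) (h ▸ hf2 w' hw')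
    exact List.append_cancel_right this
  refine ⟨Set.Finite.of_injOn (t := Set.Iio n) hf1 hinj (Set.finite_Iio n), ?_⟩
  have := Set.ncard_le_ncard_of_injOn (t := Set.Iio n) f hf1 hinj (Set.finite_Iio n)
  simpa using this

theorem count_nonneg (n : ℕ) (S : Strings m) : 0 ≤ T.count n S := Nat.cast_nonneg _

theorem count_le (hT : 2 ≤ T.size) (n : ℕ) (S : Strings m) : T.count n S ≤ n :=
  Nat.cast_le.2 (finite_occurrences hT n S).2

theorem ofReal_count (hT : 2 ≤ T.size) (n : ℕ) (S : Strings m) :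
    ENNReal.ofReal (T.count n S) = ∑' w, (occurs T n w).indicator 1 S := by
  have h1 : ∀ w, (occurs T n w).indicator (1 : Strings m → ENNReal) S =
      {w | S ∈ occurs T n w}.indicator (fun _ => 1) w := fun w => by
    by_cases h : S ∈ occurs T n w <;> simp [h]
  simp only [h1]
  rw [← tsum_subtype {w | S ∈ occurs T n w} (fun _ => (1 : ENNReal)), ENNReal.tsum_set_one,
    ← (finite_occurrences hT n S).1.cast_ncard_eq, Motif.count, ENNReal.ofReal_natCast]
  rfl

theorem aemeasurable_indicator (hm : 2 ≤ m) (hT : 2 ≤ T.size) (n : ℕ) (w : Word m) :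
    AEMeasurable ((occurs T n w).indicator (1 : Strings m → ENNReal)) p.law :=
  aemeasurable_one.indicator₀ (nullMeasurableSet_occurs p hm hT n w)

theorem aemeasurable_count (hm : 2 ≤ m) (hT : 2 ≤ T.size) (n : ℕ) :
    AEMeasurable (T.count n) p.law := by
  have h := (AEMeasurable.ennreal_tsum fun w => aemeasurable_indicator p hm hT n w).ennreal_toReal
  refine h.congr (Eventually.of_forall fun S => ?_)
  simp only [← ofReal_count hT n S, ENNReal.toReal_ofReal (count_nonneg n S)]

theorem memLp_count (hm : 2 ≤ m) (hT : 2 ≤ T.size) (n : ℕ) : MemLp (T.count n) 2 p.law :=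
  MemLp.of_bound (aemeasurable_count p hm hT n).aestronglyMeasurable n
    (Eventually.of_forall fun S => by
      rw [Real.norm_of_nonneg (count_nonneg n S)]; exact count_le hT n S)

theorem hasSum_of_tsum_ofReal_eq {ι : Type*} {f : ι → ℝ} (hf : ∀ i, 0 ≤ f i) {a : ℝ} (ha : 0 ≤ a)
    (h : ∑' i, ENNReal.ofReal (f i) = ENNReal.ofReal a) : HasSum f a := by
  have h1 := ENNReal.hasSum_toReal (f := fun i => ENNReal.ofReal (f i))
    (by rw [h]; exact ENNReal.ofReal_ne_top)
  rw [← ENNReal.tsum_toReal_eq fun _ => ENNReal.ofReal_ne_top, h, ENNReal.toReal_ofReal ha] at h1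
  simpa only [ENNReal.toReal_ofReal (hf _)] using h1

theorem hasSum_occProb (hm : 2 ≤ m) (hT : 2 ≤ T.size) (n : ℕ) :
    HasSum (fun w => T.occProb p n (p.wordProb w)) (∫ S, T.count n S ∂p.law) := by
  refine hasSum_of_tsum_ofReal_eq (fun w => occProb_nonneg p n w)
    (integral_nonneg fun S => count_nonneg n S) ?_
  rw [ofReal_integral_eq_lintegral_ofReal ((memLp_count p hm hT n).integrable (by norm_num))
    (Eventually.of_forall fun S => count_nonneg n S)]
  simp only [ofReal_count hT n]
  rw [lintegral_tsum fun w => aemeasurable_indicator p hm hT n w]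
  refine tsum_congr fun w => ?_
  rw [lintegral_indicator_one₀ (nullMeasurableSet_occurs p hm hT n w), law_occurs p hm hT]

theorem integrable_count_mul (hm : 2 ≤ m) (hT : 2 ≤ T.size) (hT' : 2 ≤ T'.size) (n : ℕ) :
    Integrable (fun S => T.count n S * T'.count n S) p.law :=
  (memLp_count p hm hT n).integrable_mul (memLp_count p hm hT' n)

-- The product of the counts is expanded over pairs of nodes; at pairs that are neither incomparable
-- nor a node paired with itself for equal motifs, the two occurrences exclude each other.
open Classical in
theorem hasSum_joint (hm : 2 ≤ m) (hT : 2 ≤ T.size) (hT' : 2 ≤ T'.size) (h : T.Compatible T')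
    (n : ℕ) :
    HasSum (fun x : Word m × Word m =>
      (if T = T' ∧ x.1 = x.2 then T.occProb p n (p.wordProb x.1) else 0) +
        if Incomparable x.1 x.2 then T.pairProb p T' n (p.wordProb x.1) (p.wordProb x.2) else 0)
      (∫ S, T.count n S * T'.count n S ∂p.law) := by
  refine hasSum_of_tsum_ofReal_eq (fun x => add_nonneg ?_ ?_)
    (integral_nonneg fun S => mul_nonneg (count_nonneg n S) (count_nonneg n S)) ?_
  · split_ifs
    · exact occProb_nonneg p n _
    · rfl
  · split_ifs with hi
    · exact pairProb_nonneg p n hi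
    · rfl
  rw [ofReal_integral_eq_lintegral_ofReal (integrable_count_mul p hm hT hT' n)
    (Eventually.of_forall fun S => mul_nonneg (count_nonneg n S) (count_nonneg n S))]
  simp only [ENNReal.ofReal_mul (count_nonneg n _), ofReal_count hT n, ofReal_count hT' n,
    ← ENNReal.tsum_mul_right]
  simp only [← ENNReal.tsum_mul_left]
  have hmeas : ∀ v w, AEMeasurable (fun S => (occurs T n v).indicator (1 : Strings m → ENNReal) S *
      (occurs T' n w).indicator (1 : Strings m → ENNReal) S) p.law := fun v w =>
    (aemeasurable_indicator p hm hT n v).mul (aemeasurable_indicator p hm hT' n w)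
  rw [lintegral_tsum fun v => AEMeasurable.ennreal_tsum fun w => hmeas v w]
  simp only [lintegral_tsum (hmeas _)]
  rw [ENNReal.tsum_prod']
  refine tsum_congr fun v => tsum_congr fun w => ?_
  have hind : ∀ S, (occurs T n v).indicator (1 : Strings m → ENNReal) S *
      (occurs T' n w).indicator (1 : Strings m → ENNReal) S =
      (occurs T n v ∩ occurs T' n w).indicator 1 S := fun S => by
    rw [Set.inter_indicator_one]; rfl
  simp only [hind]
  rw [lintegral_indicator_one₀ ((nullMeasurableSet_occurs p hm hT n v).inter
    (nullMeasurableSet_occurs p hm hT' n w))]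
  by_cases hi : Incomparable v w
  · rw [if_pos hi, law_occurs_inter p hm hT hT' n hi, if_neg, zero_add]
    rintro ⟨-, rfl⟩
    exact hi.1 (List.prefix_refl v)
  · rw [if_neg hi, add_zero]
    split_ifs with he
    · obtain ⟨rfl, rfl⟩ := he
      rw [Set.inter_self, law_occurs p hm hT]
    · have hemp : occurs T n v ∩ occurs T' n w = ∅ :=
        Set.eq_empty_of_forall_notMem fun S hS => he (h.eq_of_mem_occurs hT hT' hi hS.1 hS.2)
      rw [hemp, measure_empty, ENNReal.ofReal_zero]

end Moments

end DigitalTree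

/-! ### The Poisson model: mean and covariance as potentials -/

namespace DigitalTree

variable {m : ℕ}

section Poisson

theorem hasSum_descFactorial (k : ℕ) (A r z : ℝ) :
    HasSum (fun n : ℕ => (n.descFactorial k : ℝ) * (A * r ^ (n - k)) * (z ^ n / (n ! : ℝ)))
      (A * z ^ k * Real.exp (r * z)) := by
  have h0 : ∑ i ∈ Finset.range k,
      (i.descFactorial k : ℝ) * (A * r ^ (i - k)) * (z ^ i / (i ! : ℝ)) = 0 :=
    Finset.sum_eq_zero fun i hi => by
      rw [Nat.descFactorial_of_lt (Finset.mem_range.1 hi)]; simp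
  rw [← hasSum_nat_add_iff' k, h0, sub_zero]
  have h := (NormedSpace.expSeries_div_hasSum_exp (r * z)).mul_left (A * z ^ k)
  rw [← Real.exp_eq_exp_ℝ] at h
  refine h.congr_fun fun n => ?_
  have h1 : ((n + k)! : ℝ) = n ! * ((n + k).descFactorial k : ℝ) := by
    have := Nat.factorial_mul_descFactorial (Nat.le_add_left k n)
    rw [Nat.add_sub_cancel] at this
    exact_mod_cast this.symm
  have h2 : ((n + k).descFactorial k : ℝ) ≠ 0 := by
    rw [Nat.cast_ne_zero, Ne, Nat.descFactorial_eq_zero_iff_lt]; omega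
  rw [h1, Nat.add_sub_cancel]
  have h3 : (n ! : ℝ) ≠ 0 := by positivity
  field_simp
  ring

/-- Tonelli: all terms are nonnegative, so the Poisson average passes inside the sum over nodes. -/
theorem hasSum_poissonize {ι : Type*} {a : ι → ℕ → ℝ} {A : ℕ → ℝ} {b : ι → ℝ} {z : ℝ} (hz : 0 ≤ z)
    (ha : ∀ i n, 0 ≤ a i n) (hA : ∀ n, HasSum (fun i => a i n) (A n))
    (hab : ∀ i, HasSum (fun n => a i n * (z ^ n / (n ! : ℝ))) (Real.exp z * b i))
    (hb : Summable b) : HasSum b (poissonize A z) := by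
  have hnn : ∀ i n, 0 ≤ a i n * (z ^ n / (n ! : ℝ)) := fun i n =>
    mul_nonneg (ha i n) (by positivity)
  have hA0 : ∀ n, 0 ≤ A n := fun n => (hA n).nonneg fun i => ha i n
  have hb0 : ∀ i, 0 ≤ Real.exp z * b i := fun i => (hab i).nonneg (hnn i)
  have h1 : HasSum (fun n => A n * (z ^ n / (n ! : ℝ))) (Real.exp z * ∑' i, b i) := by
    refine hasSum_of_tsum_ofReal_eq (fun n => mul_nonneg (hA0 n) (by positivity))
      ((hb.hasSum.mul_left _).nonneg hb0) ?_
    have e1 : ∀ n, ENNReal.ofReal (A n * (z ^ n / (n ! : ℝ))) =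
        ∑' i, ENNReal.ofReal (a i n * (z ^ n / (n ! : ℝ))) := fun n => by
      have h := (hA n).mul_right (z ^ n / (n ! : ℝ))
      rw [← h.tsum_eq, ENNReal.ofReal_tsum_of_nonneg (fun i => hnn i n) h.summable]
    simp only [e1]
    rw [ENNReal.tsum_comm, ← tsum_mul_left,
      ENNReal.ofReal_tsum_of_nonneg hb0 (hb.mul_left _)]
    refine tsum_congr fun i => ?_
    rw [← ENNReal.ofReal_tsum_of_nonneg (hnn i) (hab i).summable, (hab i).tsum_eq]
  rw [poissonize, h1.tsum_eq, ← mul_assoc, ← Real.exp_add, neg_add_cancel, Real.exp_zero, one_mul]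
  exact hb.hasSum

variable (p : Source m) (T T' : Motif m)

/-- The probability that the subtree at a node equals `T` in the Poisson model, if the expected
number of strings through the node is `x`. -/
noncomputable def Motif.poissonProb (x : ℝ) : ℝ := T.leafProd p * x ^ T.size * Real.exp (-x)

/-- The function whose potential is the normalized mean in the Poisson model. -/
noncomputable def Motif.meanFun (t : ℝ) : ℝ := T.leafProd p * gammaFun (T.size - 1) 1 t

variable {T T'}

theorem exists_tame_meanFun (hT : 2 ≤ T.size) : ∃ K, Tame (T.meanFun p) K := by
  obtain ⟨K, hK⟩ := exists_tame_gammaFun (k := T.size - 1) (by omega) one_pos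
  exact ⟨_, hK.const_mul _⟩

theorem poissonProb_eq_mul_meanFun (hT : 2 ≤ T.size) (t : ℝ) :
    T.poissonProb p (Real.exp t) = Real.exp t * T.meanFun p t := by
  obtain ⟨k, hk⟩ := Nat.exists_eq_add_of_le' (show 1 ≤ T.size by omega)
  rw [Motif.poissonProb, Motif.meanFun, gammaFun, hk, Nat.add_sub_cancel, one_mul]
  ring

theorem exp_log_add_log_wordProb {z : ℝ} (hz : 0 < z) (w : Word m) :
    Real.exp (Real.log z + Real.log (p.wordProb w)) = z * p.wordProb w := by
  rw [Real.exp_add, Real.exp_log hz, Real.exp_log (p.wordProb_pos w)]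

theorem poissonProb_nonneg {x : ℝ} (hx : 0 ≤ x) : 0 ≤ T.poissonProb p x := by
  have := (T.leafProd_pos p).le
  unfold Motif.poissonProb
  positivity

variable {p}

theorem hasSum_poissonProb (hm : 2 ≤ m) (hT : 2 ≤ T.size) {z : ℝ} (hz : 0 < z) :
    HasSum (fun w => T.poissonProb p (z * p.wordProb w))
      (z * potential p (T.meanFun p) (Real.log z)) := by
  obtain ⟨K, hK⟩ := exists_tame_meanFun p hT
  have h := ((summable_potential (p := p) hm hK.1 (Real.log z)).hasSum).mul_left z
  refine h.congr_fun fun w => ?_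
  rw [← exp_log_add_log_wordProb p hz, poissonProb_eq_mul_meanFun p hT,
    exp_log_add_log_wordProb p hz, mul_assoc]

theorem summable_poissonProb (hm : 2 ≤ m) (hT : 2 ≤ T.size) {z : ℝ} (hz : 0 < z) :
    Summable fun w => T.poissonProb p (z * p.wordProb w) := (hasSum_poissonProb hm hT hz).summable

theorem hasSum_occProb_poisson (q z : ℝ) :
    HasSum (fun n => T.occProb p n q * (z ^ n / (n ! : ℝ)))
      (Real.exp z * T.poissonProb p (z * q)) := by
  have h := hasSum_descFactorial T.size (T.leafProd p * q ^ T.size) (1 - q) z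
  convert! h using 1
  rw [Motif.poissonProb, show (1 - q) * z = z + -(z * q) by ring, Real.exp_add]
  ring

/-- The joint probability factorises: with a Poisson number of strings, those through two
incomparable nodes are independent. -/
theorem hasSum_pairProb_poisson (q r z : ℝ) :
    HasSum (fun n => T.pairProb p T' n q r * (z ^ n / (n ! : ℝ)))
      (Real.exp z * (T.poissonProb p (z * q) * T'.poissonProb p (z * r))) := by
  have h := hasSum_descFactorial (T.size + T'.size)
    (T.leafProd p * q ^ T.size * (T'.leafProd p * r ^ T'.size)) (1 - (q + r)) z
  convert! h using 1
  rw [Motif.poissonProb, Motif.poissonProb,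
    show (1 - (q + r)) * z = z + -(z * q) + -(z * r) by ring, Real.exp_add, Real.exp_add]
  ring

theorem poissonMean_count (hm : 2 ≤ m) (hT : 2 ≤ T.size) {z : ℝ} (hz : 0 < z) :
    poissonMean p T.count z = z * potential p (T.meanFun p) (Real.log z) := by
  have h := hasSum_poissonize hz.le (fun w n => occProb_nonneg p n w)
    (fun n => hasSum_occProb p hm hT n) (fun w => hasSum_occProb_poisson (p.wordProb w) z)
    (summable_poissonProb hm hT hz)
  exact h.unique (hasSum_poissonProb hm hT hz)

open Classical in
/-- `c` if the motifs are equal and zero otherwise. -/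
noncomputable def diag (T T' : Motif m) (c : ℝ) : ℝ := if T = T' then c else 0

theorem hasSum_diag {ι : Type*} {f : ι → ℝ} {s : ℝ} [DecidableEq ι] (hf : HasSum f s) :
    HasSum (fun x : ι × ι => if x.1 = x.2 then f x.1 else 0) s := by
  have hinj : Function.Injective fun i : ι => (i, i) := fun i j h => (Prod.ext_iff.1 h).1
  refine (hinj.hasSum_iff fun x hx => ?_).1 (by simpa [Function.comp_def] using hf)
  refine if_neg fun h => hx ⟨x.1, ?_⟩
  ext <;> simp [h]

open Classical in
theorem hasSum_diag_motif {f : Word m → ℝ} {s : ℝ} (hf : HasSum f s) :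
    HasSum (fun x : Word m × Word m => if T = T' ∧ x.1 = x.2 then f x.1 else 0) (diag T T' s) := by
  by_cases h : T = T'
  · simpa [diag, h] using hasSum_diag hf
  · simp [diag, h]

open Classical in
theorem hasSum_prefix {a b : Word m → ℝ} (ha : Summable a) (hb : Summable b) (ha0 : ∀ w, 0 ≤ a w)
    (hb0 : ∀ w, 0 ≤ b w) :
    HasSum (fun x : Word m × Word m => if x.1 <+: x.2 then a x.1 * b x.2 else 0)
      (∑' v, a v * ∑' u, b (v ++ u)) := by
  have hs : Summable fun x : Word m × Word m => if x.1 <+: x.2 then a x.1 * b x.2 else 0 := by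
    refine Summable.of_nonneg_of_le (fun x => ?_) (fun x => ?_) (ha.mul_of_nonneg hb ha0 hb0)
    · split_ifs
      · exact mul_nonneg (ha0 _) (hb0 _)
      · rfl
    · split_ifs
      · rfl
      · exact mul_nonneg (ha0 _) (hb0 _)
  convert hs.hasSum using 1
  rw [hs.tsum_prod]
  refine tsum_congr fun v => ?_
  rw [← tsum_mul_left]
  have hinj : Function.Injective fun u : Word m => v ++ u := List.append_right_injective v
  have := hinj.tsum_eq (f := fun w => if v <+: w then a v * b w else 0) (fun w hw => by
    have : v <+: w := by by_contra h; simp [h] at hw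
    exact this)
  rw [← this]
  simp

-- Inclusion–exclusion over the two directions of the prefix relation, which overlap on the
-- diagonal.
open Classical in
theorem hasSum_comparable {a b : Word m → ℝ} (ha : Summable a) (hb : Summable b)
    (ha0 : ∀ w, 0 ≤ a w) (hb0 : ∀ w, 0 ≤ b w) :
    HasSum (fun x : Word m × Word m => if Incomparable x.1 x.2 then 0 else a x.1 * b x.2)
      (∑' v, a v * ∑' u, b (v ++ u) + ∑' v, b v * ∑' u, a (v ++ u) - ∑' v, a v * b v) := by
  have h1 := hasSum_prefix ha hb ha0 hb0
  have h2 := (Equiv.prodComm (Word m) (Word m)).hasSum_iff.2 (hasSum_prefix hb ha hb0 ha0)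
  have hab : Summable fun v => a v * b v := by
    have := (ha.mul_of_nonneg hb ha0 hb0).comp_injective
      (i := fun v : Word m => (v, v)) fun i j h => (Prod.ext_iff.1 h).1
    exact this
  have h3 := hasSum_diag hab.hasSum
  refine ((h1.add h2).sub h3).congr_fun fun x => ?_
  obtain ⟨v, w⟩ := x
  simp only [Function.comp_apply, Equiv.prodComm_apply, Prod.swap_prod_mk, Incomparable]
  by_cases hv : v <+: w <;> by_cases hw : w <+: v
  · have : v = w := hv.eq_of_length (le_antisymm hv.length_le hw.length_le)
    subst this
    simp [mul_comm]
  · have : v ≠ w := by rintro rfl; exact hw hv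
    simp [hv, hw, this]
  · have : v ≠ w := by rintro rfl; exact hv hw
    simp [hv, hw, this, mul_comm]
  · have : v ≠ w := by rintro rfl; exact hv (List.prefix_refl _)
    simp [hv, hw, this]

variable (p T T') in
/-- The function whose potential is the normalized covariance in the Poisson model. -/
noncomputable def covFun (t : ℝ) : ℝ :=
  diag T T' (T.meanFun p t) +
    (-(T.leafProd p * gammaFun T.size 1 t * potential p (T'.meanFun p) t) +
      (-(T'.leafProd p * gammaFun T'.size 1 t * potential p (T.meanFun p) t) +
        T.leafProd p * T'.leafProd p * gammaFun (T.size + T'.size - 1) 2 t))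

theorem exists_tame_covFun (hm : 2 ≤ m) (hT : 2 ≤ T.size) (hT' : 2 ≤ T'.size) :
    ∃ K, Tame (covFun p T T') K := by
  have key : ∀ {T T' : Motif m}, 2 ≤ T.size → 2 ≤ T'.size →
      ∃ K, Tame (fun t => -(T.leafProd p * gammaFun T.size 1 t *
        potential p (T'.meanFun p) t)) K := by
    intro T T' hT hT'
    obtain ⟨K, hK⟩ := exists_tame_gammaFun (k := T.size) (by omega) one_pos
    obtain ⟨K', hK'⟩ := exists_tame_meanFun p hT'
    exact ⟨_, ((hK.const_mul (T.leafProd p)).mul_bounded (hK'.abs_potential_le (p := p) hm)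
      fun s t h => hK'.abs_potential_sub_le hm h).neg⟩
  obtain ⟨K₁, h₁⟩ := exists_tame_meanFun p hT
  obtain ⟨K₂, h₂⟩ := key hT hT'
  obtain ⟨K₃, h₃⟩ := key hT' hT
  obtain ⟨K₄, h₄⟩ := exists_tame_gammaFun (k := T.size + T'.size - 1) (by omega) two_pos
  have h₁' : ∃ K, Tame (fun t => diag T T' (T.meanFun p t)) K := by
    by_cases h : T = T'
    · exact ⟨K₁, by simpa [diag, h] using h ▸ h₁⟩
    · refine ⟨0 * K₁, ?_⟩
      simpa [diag, h] using h₁.const_mul 0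
  obtain ⟨K₅, h₅⟩ := h₁'
  exact ⟨_, h₅.add (h₂.add (h₃.add (h₄.const_mul (T.leafProd p * T'.leafProd p))))⟩

open Classical in
theorem poissonize_joint (hm : 2 ≤ m) (hT : 2 ≤ T.size) (hT' : 2 ≤ T'.size)
    (h : T.Compatible T') {z : ℝ} (hz : 0 < z) :
    HasSum (fun x : Word m × Word m =>
      (if T = T' ∧ x.1 = x.2 then T.poissonProb p (z * p.wordProb x.1) else 0) +
        if Incomparable x.1 x.2 then T.poissonProb p (z * p.wordProb x.1) *
          T'.poissonProb p (z * p.wordProb x.2) else 0)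
      (poissonize (fun n => ∫ S, T.count n S * T'.count n S ∂p.law) z) := by
  have hs := summable_poissonProb (p := p) hm hT hz
  have hs' := summable_poissonProb (p := p) hm hT' hz
  have hn : ∀ w, 0 ≤ T.poissonProb p (z * p.wordProb w) := fun w =>
    poissonProb_nonneg p (mul_pos hz (p.wordProb_pos w)).le
  have hn' : ∀ w, 0 ≤ T'.poissonProb p (z * p.wordProb w) := fun w =>
    poissonProb_nonneg p (mul_pos hz (p.wordProb_pos w)).le
  refine hasSum_poissonize hz.le (fun x n => add_nonneg ?_ ?_)
    (fun n => hasSum_joint p hm hT hT' h n) (fun x => ?_) (Summable.add ?_ ?_)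
  · split_ifs
    · exact occProb_nonneg p n _
    · rfl
  · split_ifs with hi
    · exact pairProb_nonneg p n hi
    · rfl
  · simp only [add_mul, mul_add]
    refine HasSum.add ?_ ?_
    · split_ifs
      · exact hasSum_occProb_poisson _ z
      · simp
    · split_ifs
      · exact hasSum_pairProb_poisson _ _ z
      · simp
  · exact (hasSum_diag_motif hs.hasSum).summable
  · refine Summable.of_nonneg_of_le (fun x => ?_) (fun x => ?_) (hs.mul_of_nonneg hs' hn hn')
    · split_ifs
      · exact mul_nonneg (hn _) (hn' _)
      · rfl
    · split_ifs
      · rfl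
      · exact mul_nonneg (hn _) (hn' _)

/-- The part of the trie below v is the Poisson model with mean z P(v), so this is the mean count at
that parameter. -/
theorem tsum_poissonProb_append (hm : 2 ≤ m) (hT : 2 ≤ T.size) {z : ℝ} (hz : 0 < z) (v : Word m) :
    ∑' u, T.poissonProb p (z * p.wordProb (v ++ u)) = z * p.wordProb v *
      potential p (T.meanFun p) (Real.log z + Real.log (p.wordProb v)) := by
  simp only [p.wordProb_append, ← mul_assoc]
  rw [(hasSum_poissonProb hm hT (mul_pos hz (p.wordProb_pos v))).tsum_eq,
    Real.log_mul hz.ne' (p.wordProb_pos v).ne']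

/-- By independence the incomparable pairs cancel against the product of the means. What remains is
the diagonal term minus the sum over comparable pairs, where the inner sum below v is a mean at
parameter z P(v); so the whole is again a potential. -/
theorem poissonCov_count (hm : 2 ≤ m) (hT : 2 ≤ T.size) (hT' : 2 ≤ T'.size)
    (h : T.Compatible T') {z : ℝ} (hz : 0 < z) :
    poissonize (fun n => ∫ S, T.count n S * T'.count n S ∂p.law) z -
      poissonMean p T.count z * poissonMean p T'.count z =
      z * potential p (covFun p T T') (Real.log z) := by
  classical
  have hs := hasSum_poissonProb (p := p) hm hT hz
  have hs' := hasSum_poissonProb (p := p) hm hT' hz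
  have hn : ∀ w, 0 ≤ T.poissonProb p (z * p.wordProb w) := fun w =>
    poissonProb_nonneg p (mul_pos hz (p.wordProb_pos w)).le
  have hn' : ∀ w, 0 ≤ T'.poissonProb p (z * p.wordProb w) := fun w =>
    poissonProb_nonneg p (mul_pos hz (p.wordProb_pos w)).le
  have hprod : HasSum (fun x : Word m × Word m => T.poissonProb p (z * p.wordProb x.1) *
      T'.poissonProb p (z * p.wordProb x.2))
      (poissonMean p T.count z * poissonMean p T'.count z) := by
    rw [poissonMean_count hm hT hz, poissonMean_count hm hT' hz]
    exact hs.mul hs' (hs.summable.mul_of_nonneg hs'.summable hn hn')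
  have h1 := (poissonize_joint (p := p) hm hT hT' h hz).sub hprod
  have h2 := (hasSum_diag_motif (T := T) (T' := T') hs).sub
    (hasSum_comparable hs.summable hs'.summable hn hn')
  have h3 := h1.unique (h2.congr_fun fun x => by
    by_cases hi : Incomparable x.1 x.2 <;> simp [hi])
  rw [h3]
  simp only [tsum_poissonProb_append hm hT hz, tsum_poissonProb_append hm hT' hz]
  obtain ⟨K₁, t₁⟩ := exists_tame_meanFun p hT
  obtain ⟨K₂, t₂⟩ := exists_tame_meanFun p hT'
  obtain ⟨G₁, g₁⟩ := exists_tame_gammaFun (k := T.size) (by omega) one_pos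
  obtain ⟨G₂, g₂⟩ := exists_tame_gammaFun (k := T'.size) (by omega) one_pos
  obtain ⟨K₄, t₄⟩ := exists_tame_gammaFun (k := T.size + T'.size - 1) (by omega) two_pos
  have s₂ := summable_potential (p := p) hm ((g₁.const_mul (T.leafProd p)).mul_bounded
    (t₂.abs_potential_le (p := p) hm) fun s t h => t₂.abs_potential_sub_le hm h).1 (Real.log z)
  have s₃ := summable_potential (p := p) hm ((g₂.const_mul (T'.leafProd p)).mul_bounded
    (t₁.abs_potential_le (p := p) hm) fun s t h => t₁.abs_potential_sub_le hm h).1 (Real.log z)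
  have s₄ := summable_potential (p := p) hm
    (t₄.const_mul (T.leafProd p * T'.leafProd p)).1 (Real.log z)
  obtain ⟨a₂, e₂⟩ : ∃ a, HasSum _ a := ⟨_, s₂.hasSum.mul_left z⟩
  obtain ⟨a₃, e₃⟩ : ∃ a, HasSum _ a := ⟨_, s₃.hasSum.mul_left z⟩
  obtain ⟨a₄, e₄⟩ : ∃ a, HasSum _ a := ⟨_, s₄.hasSum.mul_left z⟩
  have e₁ : HasSum (fun w => z * (p.wordProb w *
      diag T T' (T.meanFun p (Real.log z + Real.log (p.wordProb w)))))
      (diag T T' (z * potential p (T.meanFun p) (Real.log z))) := by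
    by_cases hTT : T = T'
    · simp only [diag, if_pos hTT]
      exact (summable_potential (p := p) hm t₁.1 (Real.log z)).hasSum.mul_left z
    · simp [diag, hTT]
  have hcov : z * potential p (covFun p T T') (Real.log z) =
      diag T T' (z * potential p (T.meanFun p) (Real.log z)) - a₂ - a₃ + a₄ := by
    rw [potential, ← tsum_mul_left, ← (((e₁.sub e₂).sub e₃).add e₄).tsum_eq]
    refine tsum_congr fun w => ?_
    simp only [covFun]
    ring
  have f : ∀ (T : Motif m) (w : Word m), T.poissonProb p (z * p.wordProb w) =
      T.leafProd p * gammaFun T.size 1 (Real.log z + Real.log (p.wordProb w)) := fun T w => by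
    rw [Motif.poissonProb, gammaFun, exp_log_add_log_wordProb p hz, one_mul, mul_assoc]
  have c₂ : ∑' v, T.poissonProb p (z * p.wordProb v) * (z * p.wordProb v *
      potential p (T'.meanFun p) (Real.log z + Real.log (p.wordProb v))) = a₂ := by
    rw [← e₂.tsum_eq]
    exact tsum_congr fun w => by rw [f]; ring
  have c₃ : ∑' v, T'.poissonProb p (z * p.wordProb v) * (z * p.wordProb v *
      potential p (T.meanFun p) (Real.log z + Real.log (p.wordProb v))) = a₃ := by
    rw [← e₃.tsum_eq]
    exact tsum_congr fun w => by rw [f]; ring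
  -- At one node the two exponentials combine to rate 2, and one factor x = z P(w) becomes the
  -- weight of the potential.
  have c₄ : ∑' v, T.poissonProb p (z * p.wordProb v) * T'.poissonProb p (z * p.wordProb v) =
      a₄ := by
    rw [← e₄.tsum_eq]
    refine tsum_congr fun w => ?_
    rw [f, f]
    obtain ⟨k, hk⟩ := Nat.exists_eq_add_of_le' (show 1 ≤ T.size by omega)
    have : T.size + T'.size - 1 = k + T'.size := by omega
    rw [this, hk]
    simp only [gammaFun]
    rw [show -(2 * Real.exp (Real.log z + Real.log (p.wordProb w))) =
      -(1 * Real.exp (Real.log z + Real.log (p.wordProb w))) +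
      -(1 * Real.exp (Real.log z + Real.log (p.wordProb w))) by ring, Real.exp_add (-_),
      exp_log_add_log_wordProb p hz]
    ring
  rw [c₂, c₃, c₄, hcov]
  ring

end Poisson

end DigitalTree

/-! ### Integrals of the gamma functions and the alternating series -/

namespace DigitalTree

variable {m : ℕ}

section Integrals

theorem integral_comp_exp (g : ℝ → ℝ) :
    ∫ t, Real.exp t * g (Real.exp t) = ∫ x in Set.Ioi 0, g x := by
  have h := integral_image_eq_integral_abs_deriv_smul (MeasurableSet.univ (α := ℝ))
    (fun x _ => (Real.hasDerivAt_exp x).hasDerivWithinAt)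
    (fun x _ y _ hxy => Real.exp_injective hxy) g
  rw [Set.image_univ, Real.range_exp] at h
  simpa [abs_of_pos (Real.exp_pos _)] using h.symm

theorem integral_gammaFun {k : ℕ} (hk : 1 ≤ k) {c : ℝ} (hc : 0 < c) :
    ∫ t, gammaFun k c t = ((k - 1)! : ℝ) / c ^ k := by
  obtain ⟨k, rfl⟩ := Nat.exists_eq_add_of_le' hk
  have h1 : ∀ t, gammaFun (k + 1) c t =
      Real.exp t * (fun x : ℝ => x ^ k * Real.exp (-(c * x))) (Real.exp t) := fun t => by
    simp only [gammaFun]; ring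
  have h2 := Real.integral_rpow_mul_exp_neg_mul_Ioi (a := (k : ℝ) + 1) (r := c) (by positivity) hc
  simp only [add_sub_cancel_right, Real.rpow_natCast] at h2
  rw [(integral_congr_ae (ae_of_all _ h1)).trans 
    (integral_comp_exp fun x : ℝ => x ^ k * Real.exp (-(c * x))), h2, Real.Gamma_nat_eq_factorial, Nat.add_sub_cancel, ← Nat.cast_succ, Real.rpow_natCast,
    one_div, inv_pow, inv_mul_eq_div]

variable (p : Source m) (T T' : Motif m)

/-- The function whose potential is the derivative of the mean in the Poisson model. -/
noncomputable def Motif.slopeFun (t : ℝ) : ℝ :=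
  T.leafProd p * (T.size * gammaFun (T.size - 1) 1 t + -1 * gammaFun T.size 1 t)

variable {p T T'}

theorem exists_tame_slopeFun (hT : 2 ≤ T.size) : ∃ K, Tame (T.slopeFun p) K := by
  obtain ⟨K, hK⟩ := exists_tame_gammaFun (k := T.size - 1) (by omega) one_pos
  obtain ⟨K', hK'⟩ := exists_tame_gammaFun (k := T.size) (by omega) one_pos
  exact ⟨_, ((hK.const_mul T.size).add (hK'.const_mul (-1))).const_mul _⟩

theorem integrable_gammaFun {k : ℕ} (hk : 1 ≤ k) {c : ℝ} (hc : 0 < c) :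
    Integrable (gammaFun k c) := by
  obtain ⟨K, hK⟩ := exists_tame_gammaFun hk hc
  exact hK.integrable

/-- τ (τ - 2)! - (τ - 1)! = (τ - 2)!, so this agrees with the integral of `meanFun`. -/
theorem integral_slopeFun (hT : 2 ≤ T.size) :
    ∫ t, T.slopeFun p t = T.leafProd p * ((T.size - 2)! : ℝ) := by
  obtain ⟨k, hk⟩ := Nat.exists_eq_add_of_le' hT
  simp only [Motif.slopeFun]
  rw [integral_const_mul, integral_add ((integrable_gammaFun (by omega) one_pos).const_mul _)
    ((integrable_gammaFun (by omega) one_pos).const_mul _), integral_const_mul, integral_const_mul,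
    integral_gammaFun (by omega) one_pos, integral_gammaFun (by omega) one_pos, hk]
  simp only [Nat.add_sub_cancel, one_pow, div_one, Nat.reduceSubDiff, Nat.factorial_succ]
  push_cast
  ring

theorem shape_div_eq (hm : 2 ≤ m) (hT : 2 ≤ T.size) :
    T.shape p / ((T.size : ℝ) * ((T.size : ℝ) - 1)) = T.leafProd p * ((T.size - 2)! : ℝ) := by
  obtain ⟨k, hk⟩ := Nat.exists_eq_add_of_le' hT
  rw [shape_eq p hm hT, hk, Nat.add_sub_cancel, Nat.factorial_succ, Nat.factorial_succ]
  have h1 : ((k : ℝ) + 2) ≠ 0 := by positivity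
  have h2 : ((k : ℝ) + 1) ≠ 0 := by positivity
  have h3 : ((k : ℝ) + 2 - 1) ≠ 0 := by
    have : (k : ℝ) + 2 - 1 = k + 1 := by ring
    rwa [this]
  push_cast
  rw [div_eq_iff (mul_ne_zero h1 h3)]
  ring

theorem integral_slopeFun_div (hm : 2 ≤ m) (hT : 2 ≤ T.size) :
    (∫ t, T.slopeFun p t) / p.entropy = meanCoeff p T := by
  rw [integral_slopeFun hT, ← shape_div_eq hm hT, meanCoeff, div_div]

theorem summable_wordProb_pow (hm : 2 ≤ m) {r : ℕ} (hr : 2 ≤ r) :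
    Summable fun w : Word m => p.wordProb w ^ r := by
  have h2 : Summable fun w : Word m => p.wordProb w ^ 2 := by
    refine Summable.of_nonneg_of_le (fun w => by have := p.wordProb_pos w; positivity) (fun w => ?_)
      ((summable_bump (p := p) hm 0).mul_left 4)
    rw [zero_add, bump, Real.exp_log (p.wordProb_pos w)]
    have h0 := p.wordProb_pos w
    have h1 := p.wordProb_le_one w
    rw [mul_div_assoc', mul_div_assoc', le_div_iff₀ (by positivity)]
    have : (1 + p.wordProb w) ^ 2 ≤ 4 := by nlinarith
    nlinarith [sq_nonneg (p.wordProb w)]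
  refine Summable.of_nonneg_of_le (fun w => by have := p.wordProb_pos w; positivity) (fun w => ?_) h2
  exact pow_le_pow_of_le_one (p.wordProb_pos w).le (p.wordProb_le_one w) hr

/-- P is multiplicative, so splitting off the first letter gives a linear equation for the sum. -/
theorem tsum_wordProb_pow (hm : 2 ≤ m) {r : ℕ} (hr : 2 ≤ r) :
    ∑' w : Word m, p.wordProb w ^ r = 1 / (1 - p.powerSum r) := by
  have h := tsum_list (summable_wordProb_pow (p := p) hm hr)
  simp only [p.wordProb_nil, one_pow, p.wordProb_cons, mul_pow, tsum_mul_left] at h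
  rw [← Finset.sum_mul] at h
  have h1 : 0 < 1 - p.powerSum r := sub_pos.2 (Source.powerSum_lt_one hm hr)
  rw [eq_div_iff h1.ne', Source.powerSum]
  linarith

/-- The integrals of the products in the covariance function. -/
theorem integral_gammaFun_mul_potential (hm : 2 ≤ m) {k r : ℕ} (hk : 1 ≤ k) (hr : 1 ≤ r) :
    ∫ t, gammaFun k 1 t * potential p (gammaFun r 1) t =
      ∑' u : Word m, ((k + r - 1)! : ℝ) * (p.wordProb u ^ (r + 1) / (1 + p.wordProb u) ^ (k + r)) := by
  -- The exponentials with rates 1 and P(u) merge into one with rate 1 + P(u), so each term is a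
  -- gamma integral.
  have hterm : ∀ (u : Word m) t, gammaFun k 1 t * (p.wordProb u *
      gammaFun r 1 (t + Real.log (p.wordProb u))) =
      p.wordProb u ^ (r + 1) * gammaFun (k + r) (1 + p.wordProb u) t := by
    intro u t
    simp only [gammaFun, Real.exp_add, Real.exp_log (p.wordProb_pos u)]
    rw [show -((1 + p.wordProb u) * Real.exp t) =
      -(1 * Real.exp t) + -(1 * (Real.exp t * p.wordProb u)) by ring, Real.exp_add]
    ring
  have hpos : ∀ u : Word m, 0 < 1 + p.wordProb u := fun u => by linarith [p.wordProb_pos u]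
  have hint : ∀ u : Word m, Integrable fun t => gammaFun k 1 t * (p.wordProb u *
      gammaFun r 1 (t + Real.log (p.wordProb u))) := fun u => by
    simp only [hterm]
    exact (integrable_gammaFun (by omega) (hpos u)).const_mul _
  have hval : ∀ u : Word m, ∫ t, gammaFun k 1 t * (p.wordProb u *
      gammaFun r 1 (t + Real.log (p.wordProb u))) =
      ((k + r - 1)! : ℝ) * (p.wordProb u ^ (r + 1) / (1 + p.wordProb u) ^ (k + r)) := fun u => by
    simp only [hterm]
    rw [integral_const_mul, integral_gammaFun (by omega) (hpos u)]
    ring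
  have hnorm : ∀ u : Word m, ∫ t, ‖gammaFun k 1 t * (p.wordProb u *
      gammaFun r 1 (t + Real.log (p.wordProb u)))‖ =
      ((k + r - 1)! : ℝ) * (p.wordProb u ^ (r + 1) / (1 + p.wordProb u) ^ (k + r)) := fun u => by
    rw [← hval u]
    congr 1
    ext t
    refine Real.norm_of_nonneg ?_
    have := p.wordProb_pos u
    simp only [gammaFun]
    positivity
  have hsum : Summable fun u : Word m => ∫ t, ‖gammaFun k 1 t * (p.wordProb u *
      gammaFun r 1 (t + Real.log (p.wordProb u)))‖ := by
    simp only [hnorm]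
    refine Summable.mul_left _ (Summable.of_nonneg_of_le (fun u => ?_) (fun u => ?_)
      (summable_wordProb_pow (p := p) hm (show 2 ≤ r + 1 by omega)))
    · have := p.wordProb_pos u
      positivity
    · exact div_le_self (pow_nonneg (p.wordProb_pos u).le _)
        (one_le_pow₀ (by linarith [p.wordProb_pos u]))
  have h := integral_tsum_of_summable_integral_norm hint hsum
  simp only [hval] at h
  rw [h]
  congr 1
  ext t
  rw [potential, tsum_mul_left]

theorem hasSum_cons {α : Type*} [Fintype α] {f : List α → ℝ} (hf : Summable f) :
    HasSum (fun x : Σ _ : α, List α => f (x.1 :: x.2)) (∑' w, f w - f []) := by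
  have h1 : Summable fun x : Σ _ : α, List α => f (x.1 :: x.2) :=
    ((listEquivSum α).summable_iff.2 hf).comp_injective Sum.inr_injective
  rw [tsum_list hf, add_sub_cancel_left]
  have h2 := h1.hasSum
  rwa [h1.tsum_sigma, tsum_fintype] at h2

/-- Expand 1/(1 + x)^(N+1) at x = P(u) as a negative binomial series and sum over u first. At the
empty word x = 1 and the series diverges, so that word is kept apart; all other words have x ≤ θ <
1, which makes the double series absolutely convergent. Summability is recorded because two such
series get added. -/
theorem tsum_wordProb_div_eq (hm : 2 ≤ m) (N r : ℕ) (hr : 2 ≤ r) :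
    ∑' u : Word m, (N ! : ℝ) * (p.wordProb u ^ r / (1 + p.wordProb u) ^ (N + 1)) =
      (N ! : ℝ) / 2 ^ (N + 1) + ∑' j : ℕ, (-1 : ℝ) ^ j *
        (p.powerSum (r + j) / (1 - p.powerSum (r + j))) * (((N + j)! : ℝ) / (j ! : ℝ)) ∧
      Summable fun j : ℕ => (-1 : ℝ) ^ j *
        (p.powerSum (r + j) / (1 - p.powerSum (r + j))) * (((N + j)! : ℝ) / (j ! : ℝ)) := by
  have : Nonempty (Fin m) := ⟨⟨0, by omega⟩⟩
  obtain ⟨i₀, hi₀⟩ := Finite.exists_max p.prob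
  set θ := p.prob i₀
  have hθ1 : θ < 1 := Source.prob_lt_one hm i₀
  have hθ0 : 0 < θ := p.pos i₀
  have hpθ : ∀ (j : Fin m) (w : Word m), p.wordProb (j :: w) ≤ θ := fun j w => by
    rw [p.wordProb_cons]
    exact (mul_le_of_le_one_right (p.pos j).le (p.wordProb_le_one w)).trans (hi₀ j)
  have hgeo : ∀ q : ℝ, |q| < 1 → HasSum (fun j : ℕ => (N ! : ℝ) * (((j + N).choose N : ℝ) * q ^ j))
      ((N ! : ℝ) * (1 / (1 - q) ^ (N + 1))) := fun q hq => by
    have h := hasSum_choose_mul_geometric_of_norm_lt_one (𝕜 := ℝ) N (r := q)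
      (by rwa [Real.norm_eq_abs])
    exact HasSum.mul_left (N ! : ℝ) h
  have hch : ∀ j : ℕ, (N ! : ℝ) * ((j + N).choose N : ℝ) = ((N + j)! : ℝ) / (j ! : ℝ) := fun j => by
    rw [eq_div_iff (by positivity), add_comm j N]
    have := Nat.add_choose_mul_factorial_mul_factorial N j
    rw [← Nat.choose_symm_add] at this
    have h' : ((N + j).choose N : ℝ) * N ! * j ! = (N + j)! := by exact_mod_cast this
    rw [← h']; ring
  set f : Word m → ℝ := fun u => (N ! : ℝ) * (p.wordProb u ^ r / (1 + p.wordProb u) ^ (N + 1))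
  have hf : Summable f := by
    refine Summable.mul_left _ (Summable.of_nonneg_of_le (fun u => ?_) (fun u => ?_)
      (summable_wordProb_pow (p := p) hm hr))
    · have := p.wordProb_pos u
      positivity
    · exact div_le_self (pow_nonneg (p.wordProb_pos u).le _)
        (one_le_pow₀ (by linarith [p.wordProb_pos u]))
  set F : (Σ _ : Fin m, Word m) × ℕ → ℝ := fun x =>
    p.wordProb (x.1.1 :: x.1.2) ^ r * ((N ! : ℝ) * (((x.2 + N).choose N : ℝ) *
      (-p.wordProb (x.1.1 :: x.1.2)) ^ x.2))
  have hcons : ∀ s : ℕ, 2 ≤ s → HasSum (fun x : Σ _ : Fin m, Word m =>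
      p.wordProb (x.1 :: x.2) ^ s) (p.powerSum s / (1 - p.powerSum s)) := by
    intro s hs
    have h := hasSum_cons (summable_wordProb_pow (p := p) hm hs)
    have h1 : 0 < 1 - p.powerSum s := sub_pos.2 (Source.powerSum_lt_one hm hs)
    rw [tsum_wordProb_pow hm hs, p.wordProb_nil, one_pow] at h
    rwa [show p.powerSum s / (1 - p.powerSum s) = 1 / (1 - p.powerSum s) - 1 by
      field_simp; ring]
  have hF : Summable F := by
    refine Summable.of_norm_bounded (g := fun x : (Σ _ : Fin m, Word m) × ℕ =>
      p.wordProb (x.1.1 :: x.1.2) ^ r * ((N ! : ℝ) * (((x.2 + N).choose N : ℝ) * θ ^ x.2))) ?_ ?_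
    · refine (hcons r hr).summable.mul_of_nonneg
        (hgeo θ (by rwa [abs_of_pos hθ0])).summable (fun x => ?_) fun j => ?_
      · exact pow_nonneg (p.wordProb_pos _).le r
      · exact mul_nonneg (by positivity) (mul_nonneg (by positivity) (pow_nonneg hθ0.le _))
    · intro x
      have h0 := p.wordProb_pos (x.1.1 :: x.1.2)
      simp only [F, norm_mul, norm_pow, norm_neg, Real.norm_of_nonneg h0.le, Real.norm_natCast]
      have := pow_le_pow_left₀ h0.le (hpθ x.1.1 x.1.2) x.2
      gcongr
  have hrow : ∀ x : Σ _ : Fin m, Word m, ∑' j, F (x, j) = f (x.1 :: x.2) := by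
    intro x
    have h0 := p.wordProb_pos (x.1 :: x.2)
    have h1 := (hpθ x.1 x.2).trans_lt hθ1
    have := (hgeo (-p.wordProb (x.1 :: x.2)) (by rwa [abs_neg, abs_of_pos h0])).mul_left
      (p.wordProb (x.1 :: x.2) ^ r)
    simp only [F]
    rw [this.tsum_eq, sub_neg_eq_add]
    simp only [f]
    ring
  have hcol : ∀ j : ℕ, HasSum (fun x : Σ _ : Fin m, Word m => F (x, j)) ((-1 : ℝ) ^ j *
        (p.powerSum (r + j) / (1 - p.powerSum (r + j))) * (((N + j)! : ℝ) / (j ! : ℝ))) := by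
    intro j
    have := (hcons (r + j) (by omega)).mul_left ((-1 : ℝ) ^ j * (((N + j)! : ℝ) / (j ! : ℝ)))
    convert! this using 1
    · ext x
      simp only [F]
      rw [← hch, neg_pow, pow_add]
      ring
    · ring
  have hswap : Summable fun j : ℕ => ∑' x : Σ _ : Fin m, Word m, F (x, j) := by
    have := ((Equiv.prodComm ℕ (Σ _ : Fin m, Word m)).summable_iff.2 hF)
    exact this.prod
  simp only [fun j => (hcol j).tsum_eq] at hswap
  refine ⟨?_, hswap⟩
  have e1 := (hasSum_cons hf).tsum_eq
  rw [eq_sub_iff_add_eq', eq_comm] at e1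
  rw [e1]
  congr 1
  · simp only [f, p.wordProb_nil]
    norm_num
    ring
  · rw [← tsum_congr hrow, ← hF.tsum_comm' (f := fun x j => F (x, j)) (fun x => hF.prod_factor x)
      fun j => (hcol j).summable]
    exact tsum_congr fun j => (hcol j).tsum_eq

end Integrals

end DigitalTree

/-! ### Evaluation of the variance and covariance constants -/

namespace DigitalTree

variable {m : ℕ} {p : Source m} {T T' : Motif m}

section Coefficients

theorem potential_const_mul (c : ℝ) (g : ℝ → ℝ) (t : ℝ) :
    potential p (fun t => c * g t) t = c * potential p g t := by
  rw [potential, potential, ← tsum_mul_left]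
  exact tsum_congr fun w => by ring

/-- Put N = τ + τ' - 2. Up to the leaf products, each product with a potential gives -N!/2^(N+1)
from the empty word, and the gamma term of rate 2 gives +N!/2^(N+1); the net value is -2 · 2^(-τ-τ')
N!. The nonempty words give the two alternating series. -/
theorem integral_covFun (hm : 2 ≤ m) (hT : 2 ≤ T.size) (hT' : 2 ≤ T'.size) :
    (∫ t, covFun p T T' t) / p.entropy = diag T T' (meanCoeff p T) + covCoeff p T T' := by
  have hpot : ∀ {T : Motif m} t, potential p (T.meanFun p) t =
      T.leafProd p * potential p (gammaFun (T.size - 1) 1) t := fun t => potential_const_mul _ _ t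
  have key : ∀ {T T' : Motif m}, 2 ≤ T.size → 2 ≤ T'.size →
      Integrable (fun t => -(T.leafProd p * gammaFun T.size 1 t * potential p (T'.meanFun p) t)) ∧
      ∫ t, -(T.leafProd p * gammaFun T.size 1 t * potential p (T'.meanFun p) t) =
        -(T.leafProd p * T'.leafProd p * (((T.size + T'.size - 2)! : ℝ) / 2 ^ (T.size + T'.size - 1) +
          ∑' j : ℕ, (-1 : ℝ) ^ j * (p.powerSum (T'.size + j) / (1 - p.powerSum (T'.size + j))) *
            (((T.size + T'.size - 2 + j)! : ℝ) / (j ! : ℝ)))) := by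
    intro T T' hT hT'
    constructor
    · obtain ⟨K, hK⟩ := exists_tame_gammaFun (k := T.size) (by omega) one_pos
      obtain ⟨K', hK'⟩ := exists_tame_meanFun p hT'
      exact ((hK.const_mul (T.leafProd p)).mul_bounded (hK'.abs_potential_le (p := p) hm)
        fun s t h => hK'.abs_potential_sub_le hm h).neg.integrable
    · rw [integral_neg]
      have e : ∀ t, T.leafProd p * gammaFun T.size 1 t * potential p (T'.meanFun p) t =
          T.leafProd p * T'.leafProd p *
            (gammaFun T.size 1 t * potential p (gammaFun (T'.size - 1) 1) t) := fun t => by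
        rw [hpot]; ring
      simp only [e]
      rw [integral_const_mul, integral_gammaFun_mul_potential hm (by omega) (by omega)]
      have h1 : T'.size - 1 + 1 = T'.size := by omega
      have h2 : T.size + (T'.size - 1) = T.size + T'.size - 2 + 1 := by omega
      have h3 : T.size + T'.size - 1 = T.size + T'.size - 2 + 1 := by omega
      rw [h1, h2, h3, Nat.add_sub_cancel, (tsum_wordProb_div_eq hm _ _ hT').1]
  obtain ⟨i₂, v₂⟩ := key hT hT'
  obtain ⟨i₃, v₃⟩ := key hT' hT
  obtain ⟨K₁, t₁⟩ := exists_tame_meanFun p hT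
  have i₁ : Integrable fun t => diag T T' (T.meanFun p t) := by
    by_cases h : T = T'
    · simpa only [diag, if_pos h] using t₁.integrable
    · simp [diag, h]
  have v₁ : ∫ t, diag T T' (T.meanFun p t) =
      diag T T' (T.leafProd p * ((T.size - 2)! : ℝ)) := by
    by_cases h : T = T'
    · simp only [diag, if_pos h, Motif.meanFun]
      rw [integral_const_mul, integral_gammaFun (by omega) one_pos, one_pow, div_one, Nat.sub_sub]
    · simp [diag, h]
  have i₄ := (integrable_gammaFun (k := T.size + T'.size - 1) (by omega) two_pos).const_mul
    (T.leafProd p * T'.leafProd p)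
  have i₃₄ : Integrable fun t => -(T'.leafProd p * gammaFun T'.size 1 t *
      potential p (T.meanFun p) t) +
      T.leafProd p * T'.leafProd p * gammaFun (T.size + T'.size - 1) 2 t := i₃.add i₄
  have i₂₃₄ : Integrable fun t => -(T.leafProd p * gammaFun T.size 1 t *
      potential p (T'.meanFun p) t) + (-(T'.leafProd p * gammaFun T'.size 1 t *
      potential p (T.meanFun p) t) +
      T.leafProd p * T'.leafProd p * gammaFun (T.size + T'.size - 1) 2 t) := i₂.add i₃₄
  have hh := (Source.entropy_pos (p := p) hm).ne'
  have hdiag : diag T T' (meanCoeff p T) =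
      diag T T' (T.leafProd p * ((T.size - 2)! : ℝ)) / p.entropy := by
    rw [← shape_div_eq hm hT, meanCoeff]
    by_cases h : T = T'
    · simp only [diag, if_pos h, div_div]
    · simp [diag, h]
  simp only [covFun]
  rw [integral_add i₁ i₂₃₄, integral_add i₂ i₃₄, integral_add i₃ i₄, v₁, v₂,
    v₃, integral_const_mul, integral_gammaFun (by omega) two_pos, hdiag, covCoeff,
    shape_eq p hm hT, shape_eq p hm hT']
  have s₁ := (tsum_wordProb_div_eq (p := p) hm (T.size + T'.size - 2) _ hT).2
  have s₂ := (tsum_wordProb_div_eq (p := p) hm (T.size + T'.size - 2) _ hT').2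
  rw [show T'.size + T.size = T.size + T'.size from add_comm _ _]
  have hts : (∑' j : ℕ, (-1 : ℝ) ^ j *
      (p.powerSum (T.size + j) / (1 - p.powerSum (T.size + j))
        + p.powerSum (T'.size + j) / (1 - p.powerSum (T'.size + j))) *
      (((T.size + T'.size + j - 2)! : ℝ) / (j ! : ℝ))) =
      (∑' j : ℕ, (-1 : ℝ) ^ j * (p.powerSum (T.size + j) / (1 - p.powerSum (T.size + j))) *
        (((T.size + T'.size - 2 + j)! : ℝ) / (j ! : ℝ))) +
      ∑' j : ℕ, (-1 : ℝ) ^ j * (p.powerSum (T'.size + j) / (1 - p.powerSum (T'.size + j))) *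
        (((T.size + T'.size - 2 + j)! : ℝ) / (j ! : ℝ)) := by
    rw [← s₁.tsum_add s₂]
    refine tsum_congr fun j => ?_
    rw [show T.size + T'.size + j - 2 = T.size + T'.size - 2 + j by omega]
    ring
  rw [hts, show T.size + T'.size - 1 - 1 = T.size + T'.size - 2 by omega]
  obtain ⟨N, hN⟩ := Nat.exists_eq_add_of_le' (show 2 ≤ T.size + T'.size by omega)
  rw [hN, Nat.add_sub_cancel, show N + 2 - 1 = N + 1 by omega]
  have f₁ : ((T.size)! : ℝ) ≠ 0 := by positivity
  have f₂ : ((T'.size)! : ℝ) ≠ 0 := by positivity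
  rw [pow_succ, pow_succ]
  field_simp
  ring

/-- For equal motifs the two series coincide, and binom(2τ, τ)/(2τ(2τ - 1)) = (2τ - 2)!/τ!². -/
theorem varCoeff_eq (hT : 2 ≤ T.size) : varCoeff p T = meanCoeff p T + covCoeff p T T := by
  rw [varCoeff, covCoeff, sub_eq_add_neg]
  congr 1
  have hts : (∑' j : ℕ, (-1 : ℝ) ^ j *
      (p.powerSum (T.size + j) / (1 - p.powerSum (T.size + j))
        + p.powerSum (T.size + j) / (1 - p.powerSum (T.size + j))) *
      (((T.size + T.size + j - 2)! : ℝ) / (j ! : ℝ))) =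
      2 * ∑' j : ℕ, (-1 : ℝ) ^ j *
          (p.powerSum (j + T.size) / (1 - p.powerSum (j + T.size))) *
          (((j + 2 * T.size - 2)! : ℝ) / (j ! : ℝ)) := by
    rw [← tsum_mul_left]
    refine tsum_congr fun j => ?_
    rw [show T.size + T.size + j - 2 = j + 2 * T.size - 2 by omega, add_comm T.size j]
    ring
  rw [hts]
  obtain ⟨N, hN⟩ := Nat.exists_eq_add_of_le' (show 2 ≤ 2 * T.size by omega)
  have hch : ((2 * T.size).choose T.size : ℝ) / (2 * (T.size : ℝ) * (2 * (T.size : ℝ) - 1)) =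
      ((T.size + T.size - 2)! : ℝ) / ((T.size)! : ℝ) ^ 2 := by
    have h1 := Nat.choose_mul_factorial_mul_factorial (show T.size ≤ 2 * T.size by omega)
    rw [show 2 * T.size - T.size = T.size by omega] at h1
    have h2 : (((2 * T.size).choose T.size : ℕ) : ℝ) * (T.size)! * (T.size)! = (2 * T.size)! := by
      exact_mod_cast h1
    have h3 : ((2 * T.size)! : ℝ) =
        2 * (T.size : ℝ) * (2 * (T.size : ℝ) - 1) * (T.size + T.size - 2)! := by
      rw [show T.size + T.size - 2 = N by omega, hN, Nat.factorial_succ, Nat.factorial_succ]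
      have : 2 * (T.size : ℝ) = N + 2 := by exact_mod_cast hN
      rw [this]
      push_cast
      ring
    have h4 : (2 : ℝ) ≤ T.size := by exact_mod_cast hT
    have h5 : 2 * (T.size : ℝ) * (2 * (T.size : ℝ) - 1) ≠ 0 := by
      refine mul_ne_zero (by positivity) ?_
      linarith
    rw [div_eq_div_iff h5 (by positivity)]
    linear_combination h2 + h3
  have e : ((2 : ℝ) ^ (2 * T.size))⁻¹ / (2 * (T.size : ℝ) * (2 * (T.size : ℝ) - 1)) *
      ((2 * T.size).choose T.size : ℝ) = ((2 : ℝ) ^ (2 * T.size))⁻¹ *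
      (((T.size + T.size - 2)! : ℝ) / ((T.size)! : ℝ) ^ 2) := by
    rw [← hch]; ring
  rw [e, show T.size + T.size = 2 * T.size by ring]
  have f₁ : ((T.size)! : ℝ) ≠ 0 := by positivity
  -- Positivity of h is not available without a bound on m; if h = 0, both sides vanish because
  -- division by zero is zero.
  by_cases hh : p.entropy = 0
  · simp [hh]
  · field_simp

end Coefficients

/-! ### The derivative of the Poisson mean -/

section Derivative

/-- The Poisson weight times `τ - x`, i.e. `x` times its derivative. -/
noncomputable def Motif.slopeProb (p : Source m) (T : Motif m) (x : ℝ) : ℝ :=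
  T.poissonProb p x * (T.size - x)

theorem slopeProb_eq_mul_slopeFun (hT : 2 ≤ T.size) (t : ℝ) :
    T.slopeProb p (Real.exp t) = Real.exp t * T.slopeFun p t := by
  obtain ⟨k, hk⟩ := Nat.exists_eq_add_of_le' (show 1 ≤ T.size by omega)
  simp only [Motif.slopeProb, Motif.poissonProb, Motif.slopeFun, gammaFun, hk, Nat.add_sub_cancel,
    one_mul]
  ring

theorem hasSum_slopeProb (hm : 2 ≤ m) (hT : 2 ≤ T.size) {z : ℝ} (hz : 0 < z) :
    HasSum (fun w => T.slopeProb p (z * p.wordProb w))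
      (z * potential p (T.slopeFun p) (Real.log z)) := by
  obtain ⟨K, hK⟩ := exists_tame_slopeFun (p := p) hT
  have h := ((summable_potential (p := p) hm hK.1 (Real.log z)).hasSum).mul_left z
  refine h.congr_fun fun w => ?_
  rw [← exp_log_add_log_wordProb p hz, slopeProb_eq_mul_slopeFun hT,
    exp_log_add_log_wordProb p hz, mul_assoc]

theorem hasDerivAt_poissonProb (hT : 2 ≤ T.size) {x : ℝ} (hx : x ≠ 0) :
    HasDerivAt (T.poissonProb p) (T.slopeProb p x / x) x := by
  obtain ⟨k, hk⟩ := Nat.exists_eq_add_of_le' (show 1 ≤ T.size by omega)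
  unfold Motif.slopeProb Motif.poissonProb
  convert! ((hasDerivAt_pow T.size x).const_mul (T.leafProd p)).mul (hasDerivAt_neg x).exp using 1
  rw [hk, Nat.add_sub_cancel]
  push_cast
  field_simp
  ring

/-- The series is differentiated term by term on (0, 2z). Since `bump` is at most e^t, the
derivative at the node w is at most 2 K z P(w)², which is summable. -/
theorem hasDerivAt_poissonMean (hm : 2 ≤ m) (hT : 2 ≤ T.size) {z : ℝ} (hz : 0 < z) :
    HasDerivAt (poissonMean p T.count) (potential p (T.slopeFun p) (Real.log z)) z := by
  obtain ⟨K, hK⟩ := exists_tame_slopeFun (p := p) hT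
  have heq : (fun y => ∑' w, T.poissonProb p (y * p.wordProb w)) =ᶠ[𝓝 z]
      poissonMean p T.count := by
    filter_upwards [eventually_gt_nhds hz] with y hy
    rw [poissonMean_count hm hT hy, (hasSum_poissonProb hm hT hy).tsum_eq]
  have hslope : ∀ (w : Word m) (y : ℝ), 0 < y → T.slopeProb p (y * p.wordProb w) / y =
      p.wordProb w * T.slopeFun p (Real.log y + Real.log (p.wordProb w)) := fun w y hy => by
    rw [← exp_log_add_log_wordProb p hy, slopeProb_eq_mul_slopeFun hT,
      exp_log_add_log_wordProb p hy]
    field_simp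
  have h := hasDerivAt_tsum_of_isPreconnected (t := Set.Ioo 0 (2 * z)) (y₀ := z) (y := z)
    (g := fun w y => T.poissonProb p (y * p.wordProb w))
    (g' := fun w y => T.slopeProb p (y * p.wordProb w) / y)
    (u := fun w => K * (2 * z) * p.wordProb w ^ 2)
    ((summable_wordProb_pow hm le_rfl).mul_left _) isOpen_Ioo isPreconnected_Ioo ?_ ?_
    ⟨hz, by linarith⟩ (summable_poissonProb hm hT hz) ⟨hz, by linarith⟩
  · refine (h.congr_of_eventuallyEq heq.symm).congr_deriv ?_
    exact tsum_congr fun w => hslope w z hz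
  · intro w y hy
    have hw := p.wordProb_pos w
    have h1 := (hasDerivAt_poissonProb (p := p) hT (mul_pos hy.1 hw).ne').comp y
      ((hasDerivAt_id y).mul_const (p.wordProb w))
    convert! h1 using 1
    have := hy.1.ne'
    field_simp
  · intro w y hy
    have hw := p.wordProb_pos w
    rw [hslope w y hy.1, Real.norm_eq_abs, abs_mul, abs_of_pos hw]
    have h1 := (hK.1 (Real.log y + Real.log (p.wordProb w))).trans
      (mul_le_mul_of_nonneg_left (bump_le_exp _) hK.nonneg)
    rw [exp_log_add_log_wordProb p hy.1] at h1
    have h2 : y * p.wordProb w ≤ 2 * z * p.wordProb w :=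
      mul_le_mul_of_nonneg_right hy.2.le hw.le
    calc _ ≤ p.wordProb w * (K * (2 * z * p.wordProb w)) :=
          mul_le_mul_of_nonneg_left (h1.trans (mul_le_mul_of_nonneg_left h2 hK.nonneg)) hw.le
      _ = _ := by ring

end Derivative

end DigitalTree

/-! ### Uniform pointwise bounds and depoissonization -/

namespace DigitalTree

variable {m : ℕ} {p : Source m} {T T' : Motif m}

section Envelope

/-- A common bound, up to constants, for the probabilities of all motifs. -/
noncomputable def envelope (x : ℝ) : ℝ := x ^ 2 * Real.exp (-((1 / 4) * x))

theorem envelope_nonneg (x : ℝ) : 0 ≤ envelope x := by unfold envelope; positivity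

theorem hasSum_envelope (hm : 2 ≤ m) {z : ℝ} (hz : 0 < z) :
    HasSum (fun w => envelope (z * p.wordProb w))
      (z * potential p (gammaFun 1 (1 / 4)) (Real.log z)) := by
  obtain ⟨K, hK⟩ := exists_tame_gammaFun (k := 1) le_rfl (c := 1 / 4) (by norm_num)
  have h := ((summable_potential (p := p) hm hK.1 (Real.log z)).hasSum).mul_left z
  refine h.congr_fun fun w => ?_
  rw [gammaFun, exp_log_add_log_wordProb p hz, envelope]
  ring

-- The sum below a node v is at most B₁ z P(v), not merely B₁ z. Therefore the comparable pairs
-- contribute only O(z), through another potential, although the sum over all pairs is bounded only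
-- by O(z²).
open Classical in
theorem exists_tsum_envelope_le (hm : 2 ≤ m) : ∃ B > 0, ∀ z > 0,
    ∑' w, envelope (z * p.wordProb w) ≤ B * z ∧
    ∑' x : Word m × Word m, (if Incomparable x.1 x.2 then 0 else
      envelope (z * p.wordProb x.1) * envelope (z * p.wordProb x.2)) ≤ B * z := by
  obtain ⟨K₁, h₁⟩ := exists_tame_gammaFun (k := 1) le_rfl (c := 1 / 4) (by norm_num)
  obtain ⟨K₂, h₂⟩ := exists_tame_gammaFun (k := 2) one_le_two (c := 1 / 4) (by norm_num)
  have hr := inv_one_sub_powerSum_pos (p := p) hm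
  set B₁ := K₁ * (1 - p.powerSum 2)⁻¹
  set B₂ := K₂ * (1 - p.powerSum 2)⁻¹
  have hB₁ : 0 ≤ B₁ := mul_nonneg h₁.nonneg hr.le
  have hB₂ : 0 ≤ B₂ := mul_nonneg h₂.nonneg hr.le
  have hsum : ∀ z > 0, ∑' w, envelope (z * p.wordProb w) ≤ B₁ * z := fun z hz => by
    rw [(hasSum_envelope hm hz).tsum_eq, mul_comm]
    exact mul_le_mul_of_nonneg_right
      ((le_abs_self _).trans (h₁.abs_potential_le hm (Real.log z))) hz.le
  refine ⟨B₁ + 2 * (B₁ * B₂) + 1, by positivity, fun z hz => ⟨(hsum z hz).trans ?_, ?_⟩⟩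
  · exact mul_le_mul_of_nonneg_right (by nlinarith) hz.le
  have hs := (hasSum_envelope (p := p) hm hz).summable
  have h0 : ∀ w, 0 ≤ envelope (z * p.wordProb w) := fun w => envelope_nonneg _
  rw [(hasSum_comparable hs hs h0 h0).tsum_eq]
  have h3 : 0 ≤ ∑' v, envelope (z * p.wordProb v) * envelope (z * p.wordProb v) :=
    tsum_nonneg fun v => mul_nonneg (h0 v) (h0 v)
  have hs2 := ((summable_potential (p := p) hm h₂.1 (Real.log z)).hasSum).mul_left (B₁ * z)
  have hterm : ∀ v, envelope (z * p.wordProb v) * ∑' u, envelope (z * p.wordProb (v ++ u)) ≤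
      B₁ * z * (p.wordProb v * gammaFun 2 (1 / 4) (Real.log z + Real.log (p.wordProb v))) := by
    intro v
    have h4 := hsum (z * p.wordProb v) (mul_pos hz (p.wordProb_pos v))
    simp only [p.wordProb_append, ← mul_assoc]
    refine (mul_le_mul_of_nonneg_left h4 (h0 v)).trans_eq ?_
    rw [gammaFun, exp_log_add_log_wordProb p hz, envelope]
    ring
  have hnn : ∀ v, 0 ≤ envelope (z * p.wordProb v) * ∑' u, envelope (z * p.wordProb (v ++ u)) :=
    fun v => mul_nonneg (h0 v) (tsum_nonneg fun u => envelope_nonneg _)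
  have h5 := (Summable.of_nonneg_of_le hnn hterm hs2.summable).tsum_le_tsum hterm hs2.summable
  rw [hs2.tsum_eq] at h5
  have h6 : potential p (gammaFun 2 (1 / 4)) (Real.log z) ≤ B₂ :=
    (le_abs_self _).trans (h₂.abs_potential_le hm (Real.log z))
  have h7 := mul_le_mul_of_nonneg_left h6 (mul_nonneg hB₁ hz.le)
  unfold potential at h7
  nlinarith [mul_nonneg hB₁ hz.le]

end Envelope

section Pointwise

theorem exists_binomialWeight_bounds {k : ℕ} (hk : 2 ≤ k) : ∃ W : ℝ, 1 ≤ W ∧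
    (∀ n : ℕ, 1 ≤ n → k ≤ n → ∀ q : ℝ, 0 ≤ q → q ≤ 1 →
      |binomialWeight k n q - Real.exp (-(n * q)) * (1 + charlierCoeff k (n * q) / n)| ≤
        W * Real.exp (-((1 / 2) * (n * q))) / n ^ 2) ∧
    (∀ x : ℝ, 0 ≤ x → |Real.exp (-x) * charlierCoeff k x| ≤ W * Real.exp (-((1 / 2) * x))) ∧
    ∀ x : ℝ, 0 ≤ x → x ^ k * Real.exp (-((1 / 2) * x)) ≤ W * envelope x := by
  obtain ⟨C₁, hC₁, h₁⟩ := exists_abs_binomialWeight_sub_le k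
  obtain ⟨C₂, hC₂, h₂⟩ := exists_pow_le_exp 2 (show (0 : ℝ) < 1 / 2 by norm_num)
  obtain ⟨C₃, hC₃, h₃⟩ := exists_pow_mul_exp_le hk (show (1 / 4 : ℝ) < 1 / 2 by norm_num)
  have hk2 : (0 : ℝ) ≤ (k + 1) ^ 2 * C₂ := by positivity
  refine ⟨1 + C₁ + (k + 1) ^ 2 * C₂ + C₃, by linarith, fun n hn hkn q hq hq1 => ?_,
    fun x hx => ?_, fun x hx => ?_⟩
  · refine (h₁ n hn hkn q hq hq1).trans ?_
    gcongr
    linarith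
  · rw [abs_mul, Real.abs_exp]
    have e : Real.exp (-((1 / 2) * x)) = Real.exp (-x) * Real.exp (1 / 2 * x) := by
      rw [← Real.exp_add]; ring_nf
    calc _ ≤ Real.exp (-x) * ((k + 1) ^ 2 * (C₂ * Real.exp (1 / 2 * x))) := by
          refine mul_le_mul_of_nonneg_left ((abs_charlierCoeff_le k hx).trans ?_)
            (Real.exp_pos _).le
          exact mul_le_mul_of_nonneg_left (h₂ x hx) (by positivity)
      _ = (k + 1) ^ 2 * C₂ * Real.exp (-((1 / 2) * x)) := by rw [e]; ring
      _ ≤ _ := by gcongr; linarith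
  · refine (h₃ x hx).trans ?_
    exact mul_le_mul_of_nonneg_right (by linarith) (envelope_nonneg x)

theorem occProb_eq {n : ℕ} (hn : 1 ≤ n) (q : ℝ) :
    T.occProb p n q = T.leafProd p * (n * q) ^ T.size * binomialWeight T.size n q := by
  have : (n : ℝ) ≠ 0 := by positivity
  rw [Motif.occProb, binomialWeight, mul_pow]
  field_simp

theorem pairProb_eq {n : ℕ} (hn : 1 ≤ n) (q r : ℝ) :
    T.pairProb p T' n q r = T.leafProd p * T'.leafProd p * (n * q) ^ T.size * (n * r) ^ T'.size *
      binomialWeight (T.size + T'.size) n (q + r) := by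
  have : (n : ℝ) ≠ 0 := by positivity
  rw [Motif.pairProb, binomialWeight, mul_pow, mul_pow, pow_add]
  field_simp

theorem exists_occProb_bounds (hT : 2 ≤ T.size) : ∃ C > 0, ∀ n : ℕ, 1 ≤ n → T.size ≤ n →
    ∀ q : ℝ, 0 ≤ q → q ≤ 1 →
      |T.occProb p n q - T.poissonProb p (n * q)| ≤ C / n * envelope (n * q) ∧
      |T.occProb p n q| ≤ C * envelope (n * q) ∧
      |T.poissonProb p (n * q)| ≤ C * envelope (n * q) ∧
      |T.slopeProb p (n * q)| ≤ C * envelope (n * q) := by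
  obtain ⟨W, hW1, hW2, hW3, hW4⟩ := exists_binomialWeight_bounds hT
  obtain ⟨C₁, hC₁, h₁⟩ := exists_pow_mul_exp_le hT (show (1 / 4 : ℝ) < 1 by norm_num)
  obtain ⟨C₂, hC₂, h₂⟩ := exists_pow_mul_exp_le (Nat.le_succ_of_le hT)
    (show (1 / 4 : ℝ) < 1 by norm_num)
  have hκ := T.leafProd_pos p
  set κ := T.leafProd p
  have hpois : ∀ x : ℝ, 0 ≤ x → |T.poissonProb p x| ≤ κ * C₁ * envelope x := fun x hx => by
    rw [abs_of_nonneg (poissonProb_nonneg p hx), Motif.poissonProb, mul_assoc, mul_assoc]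
    have := h₁ x hx
    rw [one_mul] at this
    exact mul_le_mul_of_nonneg_left this hκ.le
  have hslope : ∀ x : ℝ, 0 ≤ x → |T.slopeProb p x| ≤ κ * (T.size * C₁ + C₂) * envelope x := by
    intro x hx
    have e1 := h₁ x hx
    have e2 := h₂ x hx
    rw [one_mul] at e1 e2
    have e3 : |(T.size : ℝ) - x| ≤ T.size + x := by
      have : (0 : ℝ) ≤ T.size := Nat.cast_nonneg _
      rw [abs_le]; constructor <;> linarith
    rw [Motif.slopeProb, abs_mul, abs_of_nonneg (poissonProb_nonneg p hx), Motif.poissonProb]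
    calc _ ≤ T.leafProd p * x ^ T.size * Real.exp (-x) * (T.size + x) :=
          mul_le_mul_of_nonneg_left e3 (by positivity)
      _ = κ * (T.size * (x ^ T.size * Real.exp (-x)) + x ^ (T.size + 1) * Real.exp (-x)) := by
          rw [pow_succ]; ring
      _ ≤ κ * (T.size * (C₁ * envelope x) + C₂ * envelope x) := by
          unfold envelope
          gcongr
      _ = _ := by ring
  have hdiff : ∀ n : ℕ, 1 ≤ n → T.size ≤ n → ∀ q : ℝ, 0 ≤ q → q ≤ 1 →
      |T.occProb p n q - T.poissonProb p (n * q)| ≤ κ * (2 * W ^ 2) / n * envelope (n * q) := by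
    intro n hn hkn q hq hq1
    have hn1 : (1 : ℝ) ≤ n := by exact_mod_cast hn
    have hn0 : (0 : ℝ) < n := by linarith
    have hx : 0 ≤ n * q := by positivity
    set x := n * q
    have b1 := hW2 n hn hkn q hq hq1
    have b2 := hW3 x hx
    have b3 := hW4 x hx
    set u := Real.exp (-((1 / 2) * x))
    have hu : 0 < u := Real.exp_pos _
    have b4 : |binomialWeight T.size n q - Real.exp (-x)| ≤ 2 * W * u / n := by
      have : binomialWeight T.size n q - Real.exp (-x) =
          (binomialWeight T.size n q - Real.exp (-x) * (1 + charlierCoeff T.size x / n)) +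
            Real.exp (-x) * charlierCoeff T.size x / n := by ring
      rw [this]
      refine (abs_add_le _ _).trans ?_
      have b5 : W * u / n ^ 2 ≤ W * u / n := by
        apply div_le_div_of_nonneg_left (by positivity) hn0
        nlinarith
      have b6 : |Real.exp (-x) * charlierCoeff T.size x / n| ≤ W * u / n := by
        rw [abs_div, abs_of_pos hn0]
        gcongr
      calc _ ≤ W * u / n + W * u / n := add_le_add (b1.trans b5) b6
        _ = _ := by ring
    rw [occProb_eq hn, Motif.poissonProb, ← mul_sub, abs_mul, abs_of_nonneg (by positivity)]
    calc _ ≤ κ * x ^ T.size * (2 * W * u / n) := mul_le_mul_of_nonneg_left b4 (by positivity)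
      _ = κ * (2 * W) / n * (x ^ T.size * u) := by ring
      _ ≤ κ * (2 * W) / n * (W * envelope x) := mul_le_mul_of_nonneg_left b3 (by positivity)
      _ = _ := by ring
  set C := κ * C₁ + κ * (T.size * C₁ + C₂) + κ * (2 * W ^ 2) with hC
  have q1 : 0 < κ * C₁ := by positivity
  have q2 : 0 < κ * (T.size * C₁ + C₂) := by positivity
  have q3 : 0 < κ * (2 * W ^ 2) := by positivity
  refine ⟨C, by positivity, fun n hn hkn q hq hq1 => ?_⟩
  have hn1 : (1 : ℝ) ≤ n := by exact_mod_cast hn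
  have hn0 : (0 : ℝ) < n := by linarith
  have hx : 0 ≤ n * q := by positivity
  have hE := envelope_nonneg (n * q)
  have d := hdiff n hn hkn q hq hq1
  have d' := hpois _ hx
  refine ⟨d.trans ?_, ?_, d'.trans ?_, (hslope _ hx).trans ?_⟩
  · gcongr; linarith
  · have d2 : κ * (2 * W ^ 2) / n ≤ κ * (2 * W ^ 2) := div_le_self q3.le hn1
    have d3 := mul_le_mul_of_nonneg_right d2 hE
    have d4 : |T.occProb p n q| ≤ |T.occProb p n q - T.poissonProb p (n * q)| +
        |T.poissonProb p (n * q)| := by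
      simpa using abs_add_le (T.occProb p n q - T.poissonProb p (n * q)) (T.poissonProb p (n * q))
    rw [hC, add_mul, add_mul]
    nlinarith [mul_nonneg q2.le hE]
  · gcongr; linarith
  · gcongr; linarith

/-- Fixing n makes two incomparable nodes negatively or positively correlated at order 1/n, by minus
the product of the slopes. All further terms are O(1/n²) with exponentials that the envelopes
absorb. -/
theorem exists_pairProb_bound (hT : 2 ≤ T.size) (hT' : 2 ≤ T'.size) : ∃ C > 0, ∀ n : ℕ, 1 ≤ n →
    T.size + T'.size ≤ n → ∀ q r : ℝ, 0 ≤ q → 0 ≤ r → q + r ≤ 1 →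
      |T.pairProb p T' n q r - T.occProb p n q * T'.occProb p n r +
          T.slopeProb p (n * q) * T'.slopeProb p (n * r) / n| ≤
        C / n ^ 2 * (envelope (n * q) * envelope (n * r)) := by
  obtain ⟨W₀, hW₀, h₀, -, -⟩ :=
    exists_binomialWeight_bounds (show 2 ≤ T.size + T'.size by omega)
  obtain ⟨W₁, hW₁, h₁, a₁, e₁⟩ := exists_binomialWeight_bounds hT
  obtain ⟨W₂, hW₂, h₂, a₂, e₂⟩ := exists_binomialWeight_bounds hT'
  have hκ := T.leafProd_pos p
  have hκ' := T'.leafProd_pos p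
  refine ⟨T.leafProd p * T'.leafProd p * (W₁ * W₂) *
    (W₀ + W₁ * W₂ + W₁ * (1 + W₂) + (1 + W₁) * W₂ + W₁ * W₂), by positivity,
    fun n hn hkn q r hq hr hqr => ?_⟩
  have hn1 : (1 : ℝ) ≤ n := by exact_mod_cast hn
  have hn0 : (0 : ℝ) < n := by linarith
  have hx : 0 ≤ n * q := by positivity
  have hy : 0 ≤ n * r := by positivity
  have g₀ := h₀ n hn hkn (q + r) (by linarith) hqr
  have g₁ := h₁ n hn (by omega) q hq (by linarith)
  have g₂ := h₂ n hn (by omega) r hr (by linarith)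
  have b₁ := a₁ _ hx
  have b₂ := a₂ _ hy
  have c₁ := e₁ _ hx
  have c₂ := e₂ _ hy
  rw [pairProb_eq hn, occProb_eq hn, occProb_eq hn]
  unfold Motif.slopeProb Motif.poissonProb
  rw [mul_add (n : ℝ) q r] at g₀
  set x := n * q
  set y := n * r
  set u := Real.exp (-((1 / 2) * x)) with hu
  set v := Real.exp (-((1 / 2) * y)) with hv
  have huv : Real.exp (-((1 / 2) * (x + y))) = u * v := by
    rw [hu, hv, ← Real.exp_add]; ring_nf
  have hxy : Real.exp (-(x + y)) = Real.exp (-x) * Real.exp (-y) := by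
    rw [← Real.exp_add]; ring_nf
  have hu0 : 0 < u := Real.exp_pos _
  have hv0 : 0 < v := Real.exp_pos _
  have hxu : Real.exp (-x) ≤ u := Real.exp_le_exp.2 (by linarith)
  have hyv : Real.exp (-y) ≤ v := Real.exp_le_exp.2 (by linarith)
  rw [huv] at g₀
  -- The cross terms of the quadratic polynomial factor; they are the whole correlation at order
  -- 1/n.
  have hch : charlierCoeff (T.size + T'.size) (x + y) =
      charlierCoeff T.size x + charlierCoeff T'.size y - (T.size - x) * (T'.size - y) := by
    unfold charlierCoeff; push_cast; ring
  set α := charlierCoeff T.size x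
  set β := charlierCoeff T'.size y
  rw [hch, hxy] at g₀
  set R₀ := binomialWeight (T.size + T'.size) n (q + r) - Real.exp (-x) * Real.exp (-y) *
    (1 + (α + β - (T.size - x) * (T'.size - y)) / n) with hR₀
  set R₁ := binomialWeight T.size n q - Real.exp (-x) * (1 + α / n) with hR₁
  set R₂ := binomialWeight T'.size n r - Real.exp (-y) * (1 + β / n) with hR₂
  have id : T.leafProd p * T'.leafProd p * x ^ T.size * y ^ T'.size *
      binomialWeight (T.size + T'.size) n (q + r) -
      T.leafProd p * x ^ T.size * binomialWeight T.size n q *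
        (T'.leafProd p * y ^ T'.size * binomialWeight T'.size n r) +
      T.leafProd p * x ^ T.size * Real.exp (-x) * (T.size - x) *
        (T'.leafProd p * y ^ T'.size * Real.exp (-y) * (T'.size - y)) / n =
      T.leafProd p * T'.leafProd p * x ^ T.size * y ^ T'.size *
        (R₀ - Real.exp (-x) * α * (Real.exp (-y) * β) / n ^ 2 -
          R₁ * (Real.exp (-y) * (1 + β / n)) - Real.exp (-x) * (1 + α / n) * R₂ - R₁ * R₂) := by
    rw [hR₀, hR₁, hR₂]
    field_simp
    ring
  have hmain : ∀ {a w W : ℝ}, 0 < W → 0 < w → ∀ z : ℝ, Real.exp (-z) ≤ w →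
      |Real.exp (-z) * a| ≤ W * w → |Real.exp (-z) * (1 + a / n)| ≤ (1 + W) * w := by
    intro a w W hW hw z hz ha
    have : Real.exp (-z) * (1 + a / n) = Real.exp (-z) + Real.exp (-z) * a / n := by ring
    rw [this]
    refine (abs_add_le _ _).trans ?_
    rw [Real.abs_exp, abs_div, abs_of_pos hn0, one_add_mul]
    exact add_le_add hz ((div_le_self (abs_nonneg _) hn1).trans ha)
  have m₁ := hmain (by linarith) hu0 x hxu b₁
  have m₂ := hmain (by linarith) hv0 y hyv b₂
  have t₂ : |Real.exp (-x) * α * (Real.exp (-y) * β) / n ^ 2| ≤ W₁ * W₂ * (u * v) / n ^ 2 := by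
    rw [abs_div, abs_mul, abs_of_pos (by positivity : (0 : ℝ) < n ^ 2)]
    refine div_le_div_of_nonneg_right ?_ (by positivity)
    calc _ ≤ W₁ * u * (W₂ * v) := mul_le_mul b₁ b₂ (abs_nonneg _) (by positivity)
      _ = _ := by ring
  have t₃ : |R₁ * (Real.exp (-y) * (1 + β / n))| ≤ W₁ * (1 + W₂) * (u * v) / n ^ 2 := by
    rw [abs_mul]
    calc _ ≤ W₁ * u / n ^ 2 * ((1 + W₂) * v) := mul_le_mul g₁ m₂ (abs_nonneg _) (by positivity)
      _ = _ := by ring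
  have t₄ : |Real.exp (-x) * (1 + α / n) * R₂| ≤ (1 + W₁) * W₂ * (u * v) / n ^ 2 := by
    rw [abs_mul]
    calc _ ≤ (1 + W₁) * u * (W₂ * v / n ^ 2) := mul_le_mul m₁ g₂ (abs_nonneg _) (by positivity)
      _ = _ := by ring
  have t₅ : |R₁ * R₂| ≤ W₁ * W₂ * (u * v) / n ^ 2 := by
    rw [abs_mul]
    have : W₂ * v / n ^ 2 ≤ W₂ * v := div_le_self (by positivity) (one_le_pow₀ hn1)
    calc _ ≤ W₁ * u / n ^ 2 * (W₂ * v) :=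
          mul_le_mul g₁ (g₂.trans this) (abs_nonneg _) (by positivity)
      _ = _ := by ring
  have tot : |R₀ - Real.exp (-x) * α * (Real.exp (-y) * β) / n ^ 2 -
      R₁ * (Real.exp (-y) * (1 + β / n)) - Real.exp (-x) * (1 + α / n) * R₂ - R₁ * R₂| ≤
      (W₀ + W₁ * W₂ + W₁ * (1 + W₂) + (1 + W₁) * W₂ + W₁ * W₂) * (u * v) / n ^ 2 := by
    refine (abs_sub _ _).trans ((add_le_add_left ((abs_sub _ _).trans (add_le_add_left
      ((abs_sub _ _).trans (add_le_add_left ((abs_sub _ _).trans (add_le_add g₀ t₂)) _))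
      _)) _).trans ?_)
    calc _ ≤ _ := add_le_add (add_le_add (add_le_add le_rfl t₃) t₄) t₅
      _ = _ := by ring
  rw [id, abs_mul, abs_of_nonneg (by positivity)]
  calc _ ≤ _ := mul_le_mul_of_nonneg_left tot (by positivity)
    _ = T.leafProd p * T'.leafProd p *
        (W₀ + W₁ * W₂ + W₁ * (1 + W₂) + (1 + W₁) * W₂ + W₁ * W₂) / n ^ 2 *
        ((x ^ T.size * u) * (y ^ T'.size * v)) := by ring
    _ ≤ T.leafProd p * T'.leafProd p *
        (W₀ + W₁ * W₂ + W₁ * (1 + W₂) + (1 + W₁) * W₂ + W₁ * W₂) / n ^ 2 *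
        ((W₁ * envelope x) * (W₂ * envelope y)) :=
      mul_le_mul_of_nonneg_left (mul_le_mul c₁ c₂ (by positivity)
        (mul_nonneg (by linarith) (envelope_nonneg x))) (by positivity)
    _ = _ := by ring

end Pointwise

section Depoissonization

/-- For comparable pairs an error of order 1/n is enough, because their envelopes sum to O(n) only.
-/
theorem abs_pair_error_le {o o' q q' s s' C C' e e' n : ℝ} (hn : 1 ≤ n)
    (h₁ : |o - q| ≤ C / n * e) (h₂ : |o' - q'| ≤ C' / n * e') (h₃ : |q| ≤ C * e)
    (h₄ : |o'| ≤ C' * e') (h₅ : |s| ≤ C * e) (h₆ : |s'| ≤ C' * e') :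
    |q * q' - o * o' + s * s' / n| ≤ 3 * (C * C') / n * (e * e') := by
  have hn0 : 0 < n := by linarith
  have h7 := mul_le_mul h₃ h₂ (abs_nonneg _) ((abs_nonneg _).trans h₃)
  have h8 := mul_le_mul h₁ h₄ (abs_nonneg _) ((abs_nonneg _).trans h₁)
  have h9 := mul_le_mul h₅ h₆ (abs_nonneg _) ((abs_nonneg _).trans h₅)
  rw [← abs_mul] at h7 h8 h9
  have h10 : |s * s' / n| ≤ C * e * (C' * e') / n := by
    rw [abs_div, abs_of_pos hn0]
    gcongr
  have e1 : q * q' - o * o' + s * s' / n = -(q * (o' - q')) - (o - q) * o' + s * s' / n := by ring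
  rw [e1]
  calc _ ≤ |q * (o' - q')| + |(o - q) * o'| + |s * s' / n| := by
        refine (abs_add_le _ _).trans (add_le_add_left ((abs_sub _ _).trans ?_) _)
        rw [abs_neg]
    _ ≤ _ := add_le_add (add_le_add h7 h8) h10
    _ = _ := by ring

/-- The exact covariance, the Poisson covariance and the product of the slopes are sums over the
same pairs of nodes and are compared term by term. The errors carry C₁/n on the diagonal, C₃/n² on
all pairs and 3 C₁ C₂/n on comparable pairs, against envelope sums O(n), O(n²) and O(n), so every
total is bounded. -/
theorem exists_abs_covariance_sub_le (hm : 2 ≤ m) (hT : 2 ≤ T.size) (hT' : 2 ≤ T'.size)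
    (h : T.Compatible T') : ∃ C, ∀ n : ℕ, T.size + T'.size ≤ n →
    |covariance (T.count n) (T'.count n) p.law - (potential p (covFun p T T') (Real.log n) -
      potential p (T.slopeFun p) (Real.log n) * potential p (T'.slopeFun p) (Real.log n)) * n| ≤
      C := by
  classical
  obtain ⟨C₁, hC₁, h₁⟩ := exists_occProb_bounds (p := p) hT
  obtain ⟨C₂, hC₂, h₂⟩ := exists_occProb_bounds (p := p) hT'
  obtain ⟨C₃, hC₃, h₃⟩ := exists_pairProb_bound (p := p) hT hT'
  obtain ⟨B, hB, hB'⟩ := exists_tsum_envelope_le (p := p) hm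
  refine ⟨C₁ * B + C₃ * B ^ 2 + 3 * (C₁ * C₂) * B, fun n hkn => ?_⟩
  have hn : 1 ≤ n := by omega
  have hn1 : (1 : ℝ) ≤ n := by exact_mod_cast hn
  have hn0 : (0 : ℝ) < n := by linarith
  have hq0 : ∀ w, 0 ≤ p.wordProb w := fun w => (p.wordProb_pos w).le
  have k₁ := fun w => h₁ n hn (by omega) (p.wordProb w) (hq0 w) (p.wordProb_le_one w)
  have k₂ := fun w => h₂ n hn (by omega) (p.wordProb w) (hq0 w) (p.wordProb_le_one w)
  have sE := hasSum_envelope (p := p) hm hn0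
  obtain ⟨hE1, hE2⟩ := hB' n hn0
  have hE0 : ∀ w, 0 ≤ envelope (n * p.wordProb w) := fun w => envelope_nonneg _
  have prod : ∀ {f g : Word m → ℝ} {a b c d : ℝ}, HasSum f a → HasSum g b →
      (∀ w, |f w| ≤ c * envelope (n * p.wordProb w)) →
      (∀ w, |g w| ≤ d * envelope (n * p.wordProb w)) →
      HasSum (fun x : Word m × Word m => f x.1 * g x.2) (a * b) := by
    intro f g a b c d hf hg hfc hgd
    refine hf.mul hg (summable_mul_of_summable_norm ?_ ?_)
    · exact Summable.of_nonneg_of_le (fun _ => norm_nonneg _) hfc (sE.summable.mul_left c)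
    · exact Summable.of_nonneg_of_le (fun _ => norm_nonneg _) hgd (sE.summable.mul_left d)
  have c₁ := hasSum_joint p hm hT hT' h n
  have c₂ := prod (hasSum_occProb p hm hT n) (hasSum_occProb p hm hT' n)
    (fun w => (k₁ w).2.1) fun w => (k₂ w).2.1
  have c₃ := poissonize_joint (p := p) hm hT hT' h hn0
  have c₄ := prod (hasSum_poissonProb (p := p) hm hT hn0) (hasSum_poissonProb hm hT' hn0)
    (fun w => (k₁ w).2.2.1) fun w => (k₂ w).2.2.1
  have c₅ := (prod (hasSum_slopeProb (p := p) hm hT hn0) (hasSum_slopeProb hm hT' hn0)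
    (fun w => (k₁ w).2.2.2) fun w => (k₂ w).2.2.2).div_const (n : ℝ)
  -- By independence the terms of c₃ and c₄ agree on incomparable pairs.
  have total := ((c₁.sub c₂).sub (c₃.sub c₄)).add c₅
  rw [← poissonMean_count hm hT hn0, ← poissonMean_count hm hT' hn0,
    poissonCov_count hm hT hT' h hn0] at total
  have d₁ := hasSum_diag (sE.mul_left (C₁ / n))
  have d₂ := (prod sE sE (c := 1) (d := 1) (fun w => by rw [abs_of_nonneg (hE0 w), one_mul])
    fun w => by rw [abs_of_nonneg (hE0 w), one_mul]).mul_left (C₃ / n ^ 2)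
  have d₃ := (hasSum_comparable sE.summable sE.summable hE0 hE0).mul_left (3 * (C₁ * C₂) / n)
  have hbound := ((d₁.add d₂).add d₃)
  have hle := total.norm_le_of_bounded hbound fun x => ?_
  · have hcov : covariance (T.count n) (T'.count n) p.law = ∫ S, T.count n S * T'.count n S ∂p.law -
        (∫ S, T.count n S ∂p.law) * ∫ S, T'.count n S ∂p.law :=
      covariance_eq_sub (memLp_count p hm hT n) (memLp_count p hm hT' n)
    rw [(hasSum_comparable sE.summable sE.summable hE0 hE0).tsum_eq] at hE2
    rw [sE.tsum_eq] at hE1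
    have hE3 := sE.nonneg hE0
    refine (le_of_eq ?_).trans (hle.trans (add_le_add (add_le_add ?_ ?_) ?_))
    · rw [Real.norm_eq_abs, hcov]
      congr 1
      field_simp
      ring
    · rw [div_mul_eq_mul_div, div_le_iff₀ hn0, mul_assoc]
      exact mul_le_mul_of_nonneg_left hE1 hC₁.le
    · rw [div_mul_eq_mul_div, div_le_iff₀ (by positivity)]
      refine (mul_le_mul_of_nonneg_left (mul_le_mul hE1 hE1 hE3 (by positivity)) hC₃.le).trans_eq ?_
      ring
    · rw [div_mul_eq_mul_div, div_le_iff₀ hn0, mul_assoc (3 * (C₁ * C₂))]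
      exact mul_le_mul_of_nonneg_left hE2 (by positivity)
  · obtain ⟨v, w⟩ := x
    obtain ⟨a₁, a₂, a₃, a₄⟩ := k₁ v
    obtain ⟨b₁, b₂, b₃, b₄⟩ := k₂ w
    have hEE := mul_nonneg (hE0 v) (hE0 w)
    rw [Real.norm_eq_abs]
    by_cases hi : Incomparable v w
    · have hne : v ≠ w := by rintro rfl; exact hi.1 (List.prefix_refl v)
      simp only [hi, hne, and_false, if_true, if_false, zero_add, mul_zero, add_zero, sub_self,
        sub_zero]
      exact h₃ n hn hkn _ _ (hq0 v) (hq0 w) (wordProb_add_le_one p hi)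
    · simp only [hi, if_false, add_zero]
      have hd : |(if T = T' ∧ v = w then T.occProb p n (p.wordProb v) else 0) -
          (if T = T' ∧ v = w then T.poissonProb p (n * p.wordProb v) else 0)| ≤
          if v = w then C₁ / n * envelope (n * p.wordProb v) else 0 := by
        by_cases hvw : v = w
        · by_cases hTT : T = T'
          · simp only [hTT, hvw, and_self, if_true] at a₁ ⊢
            exact a₁
          · simp only [hTT, hvw, false_and, if_false, if_true, sub_self, abs_zero]
            exact (abs_nonneg _).trans (hvw ▸ a₁)
        · simp [hvw]
      have he := abs_pair_error_le hn1 a₁ b₁ a₃ b₂ a₄ b₄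
      have e : ∀ a b c d f : ℝ, a - b - (c - d) + f = a - c + (d - b + f) := fun a b c d f => by
        ring
      rw [e]
      refine (abs_add_le _ _).trans ?_
      have h0 : 0 ≤ C₃ / (n : ℝ) ^ 2 * (envelope (n * p.wordProb v) * envelope (n * p.wordProb w)) :=
        by positivity
      linarith

end Depoissonization

end DigitalTree

/-! ### Calculus of fluctuating functions -/

namespace DigitalTree

variable {m : ℕ} {p : Source m} {T T' : Motif m}

section Fluctuation

theorem eq_of_zmultiples_eq {d d' : ℝ} (hd : 0 < d) (hd' : 0 < d')
    (h : AddSubgroup.zmultiples d = AddSubgroup.zmultiples d') : d = d' := by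
  have key : ∀ {a b : ℝ}, 0 < a → 0 < b → a ∈ AddSubgroup.zmultiples b → b ≤ a := by
    intro a b ha hb hab
    obtain ⟨k, rfl⟩ := AddSubgroup.mem_zmultiples_iff.1 hab
    rw [zsmul_eq_mul] at ha ⊢
    have hk : (0 : ℝ) < k := pos_of_mul_pos_left ha hb.le
    have hk1 : (1 : ℝ) ≤ k := by exact_mod_cast Int.add_one_le_iff.2 (Int.cast_pos.1 hk)
    exact le_mul_of_one_le_left hb.le hk1
  refine le_antisymm (key hd' hd ?_) (key hd hd' ?_)
  · rw [h]; exact AddSubgroup.mem_zmultiples d'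
  · rw [← h]; exact AddSubgroup.mem_zmultiples d

/-- The positive generator of the group is unique, so both functions have the same period. -/
theorem IsFluctuation.add {δ δ' : ℝ → ℝ} (h : IsFluctuation p δ) (h' : IsFluctuation p δ') :
    IsFluctuation p fun x => δ x + δ' x := by
  obtain ⟨g, hc, hg, ha, hp⟩ := h
  obtain ⟨g', hc', hg', ha', hp'⟩ := h'
  refine ⟨fun t => g t + g' t, hc.add hc', fun x hx => by simp only [hg x hx, hg' x hx],
    fun h t => by simp only [ha h t, ha' h t, add_zero], fun h => ?_⟩
  obtain ⟨d, hd, hcl, hper, hint⟩ := hp h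
  obtain ⟨d', hd', hcl', hper', hint'⟩ := hp' h
  obtain rfl := eq_of_zmultiples_eq hd hd' (hcl.symm.trans hcl')
  refine ⟨d, hd, hcl, hper.add hper', ?_⟩
  rw [intervalIntegral.integral_add (hc.intervalIntegrable _ _) (hc'.intervalIntegrable _ _), hint,
    hint', add_zero]

theorem IsFluctuation.const_mul {δ : ℝ → ℝ} (h : IsFluctuation p δ) (c : ℝ) :
    IsFluctuation p fun x => c * δ x := by
  obtain ⟨g, hc, hg, ha, hp⟩ := h
  refine ⟨fun t => c * g t, continuous_const.mul hc, fun x hx => by simp only [hg x hx],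
    fun h t => by simp only [ha h t, mul_zero], fun h => ?_⟩
  obtain ⟨d, hd, hcl, hper, hint⟩ := hp h
  refine ⟨d, hd, hcl, fun t => by simp only [hper t], ?_⟩
  rw [intervalIntegral.integral_const_mul, hint, mul_zero]

/-- A function tends to zero, with a power rate if the source is periodic. -/
def Vanishes (p : Source m) (e : ℝ → ℝ) : Prop :=
  e =o[atTop] (fun _ => (1 : ℝ)) ∧
    (p.IsPeriodic → ∃ ε : ℝ, 0 < ε ∧ ε < 1 ∧ e =O[atTop] fun z : ℝ => z ^ (-ε))

theorem rpow_neg_isBigO {ε ε' : ℝ} (h : ε' ≤ ε) :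
    (fun z : ℝ => z ^ (-ε)) =O[atTop] fun z : ℝ => z ^ (-ε') := by
  refine IsBigO.of_bound 1 ?_
  filter_upwards [eventually_ge_atTop 1] with z hz
  have hz0 : 0 ≤ z := by linarith
  rw [one_mul, Real.norm_of_nonneg (Real.rpow_nonneg hz0 _),
    Real.norm_of_nonneg (Real.rpow_nonneg hz0 _)]
  exact Real.rpow_le_rpow_of_exponent_le hz (neg_le_neg h)

namespace Vanishes

variable {e e' f : ℝ → ℝ}

theorem add (h : Vanishes p e) (h' : Vanishes p e') : Vanishes p fun z => e z + e' z := by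
  refine ⟨h.1.add h'.1, fun hp => ?_⟩
  obtain ⟨ε, h0, h1, hO⟩ := h.2 hp
  obtain ⟨ε', h0', h1', hO'⟩ := h'.2 hp
  exact ⟨min ε ε', lt_min h0 h0', (min_le_left _ _).trans_lt h1,
    (hO.trans (rpow_neg_isBigO (min_le_left _ _))).add
      (hO'.trans (rpow_neg_isBigO (min_le_right _ _)))⟩

theorem mul_bounded (h : Vanishes p e) (hf : f =O[atTop] fun _ => (1 : ℝ)) :
    Vanishes p fun z => f z * e z := by
  refine ⟨by simpa using hf.mul_isLittleO h.1, fun hp => ?_⟩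
  obtain ⟨ε, h0, h1, hO⟩ := h.2 hp
  exact ⟨ε, h0, h1, by simpa using hf.mul hO⟩

theorem const_mul (h : Vanishes p e) (c : ℝ) : Vanishes p fun z => c * e z :=
  h.mul_bounded (isBigO_const_const c one_ne_zero _)

end Vanishes

/-- `f` is asymptotic to the constant `c` plus the fluctuation `δ`. -/
def FluctuatesAround (p : Source m) (f : ℝ → ℝ) (c : ℝ) (δ : ℝ → ℝ) : Prop :=
  IsFluctuation p δ ∧ Vanishes p fun z => f z - (c + δ z)

namespace FluctuatesAround

variable {f f' V δ δ' : ℝ → ℝ} {c c' : ℝ}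

theorem add (h : FluctuatesAround p f c δ) (h' : FluctuatesAround p f' c' δ') :
    FluctuatesAround p (fun z => f z + f' z) (c + c') fun z => δ z + δ' z := by
  refine ⟨h.1.add h'.1, ?_⟩
  convert! h.2.add h'.2 using 2
  ring

theorem const_mul (h : FluctuatesAround p f c δ) (a : ℝ) :
    FluctuatesAround p (fun z => a * f z) (a * c) fun z => a * δ z := by
  refine ⟨h.1.const_mul a, ?_⟩
  convert! h.2.const_mul a using 2
  ring

theorem vanishes_mul_sub (h : FluctuatesAround p f c δ) (h' : FluctuatesAround p f' c' δ')
    (hf : f =O[atTop] fun _ => (1 : ℝ)) (hf' : f' =O[atTop] fun _ => (1 : ℝ)) :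
    Vanishes p fun z => f z * f' z - (c + δ z) * (c' + δ' z) := by
  have ha : (fun z => c + δ z) =O[atTop] fun _ => (1 : ℝ) := by
    have := hf.sub h.2.1.isBigO
    simpa using this
  convert! (h.2.mul_bounded hf').add (h'.2.mul_bounded ha) using 2
  ring

/-- The bounded error of depoissonization is o(n), and it is O(n^(1-ε)) because ε < 1; so the rate
is that of the renewal limits. -/
theorem linearAsymptotics (hV : FluctuatesAround p V c δ) {b b' : ℝ} {η η' : ℝ → ℝ}
    (h : FluctuatesAround p f b η) (h' : FluctuatesAround p f' b' η')
    (hf : f =O[atTop] fun _ => (1 : ℝ)) (hf' : f' =O[atTop] fun _ => (1 : ℝ)) {u : ℕ → ℝ} {C : ℝ}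
    (hu : ∀ᶠ n : ℕ in atTop, |u n - (V n - f n * f' n) * n| ≤ C) :
    LinearAsymptotics p u fun n => c + δ n - (b + η n) * (b' + η' n) := by
  have hr := hV.2.add ((h.vanishes_mul_sub h' hf hf').const_mul (-1))
  set r := fun z => V z - (c + δ z) + -1 * (f z * f' z - (b + η z) * (b' + η' z)) with hrdef
  have hcast : Tendsto (fun n : ℕ => (n : ℝ)) atTop atTop := tendsto_natCast_atTop_atTop
  have hO : (fun n : ℕ => u n - (V n - f n * f' n) * n) =O[atTop] fun _ => (1 : ℝ) :=
    IsBigO.of_bound C (by simpa using hu)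
  have e : (fun n : ℕ => u n - (c + δ n - (b + η n) * (b' + η' n)) * n) =
      fun n : ℕ => (u n - (V n - f n * f' n) * n) + r n * n := by
    funext n; simp only [hrdef]; ring
  unfold LinearAsymptotics
  rw [e]
  refine ⟨IsLittleO.add (hO.trans_isLittleO ?_) ?_, fun hp => ?_⟩
  · exact (isLittleO_const_id_atTop (1 : ℝ)).comp_tendsto hcast
  · have h1 := (hr.1.comp_tendsto hcast).mul_isBigO (isBigO_refl (fun n : ℕ => (n : ℝ)) atTop)
    simpa [Function.comp_def] using h1
  · obtain ⟨ε, h0, h1, hε⟩ := hr.2 hp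
    refine ⟨ε, h0, h1, IsBigO.add (hO.trans ?_) ?_⟩
    · refine IsBigO.of_bound 1 ?_
      filter_upwards [eventually_ge_atTop 1] with n hn
      have hn1 : (1 : ℝ) ≤ n := by exact_mod_cast hn
      rw [norm_one, one_mul, Real.norm_of_nonneg (by positivity)]
      exact Real.one_le_rpow hn1 (by linarith)
    · refine ((hε.comp_tendsto hcast).mul (isBigO_refl (fun n : ℕ => (n : ℝ)) atTop)).congr'
        EventuallyEq.rfl ?_
      filter_upwards [eventually_ge_atTop 1] with n hn
      have hn1 : (0 : ℝ) < n := by exact_mod_cast hn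
      rw [Function.comp_apply, sub_eq_neg_add, Real.rpow_add hn1, Real.rpow_one]

theorem arePoissonFluctuations {Y : ℕ → Strings m → ℝ} {b : ℝ} {η : ℝ → ℝ}
    (hV : FluctuatesAround p V c δ) (h : FluctuatesAround p f b η)
    (hvar : ∀ z > 0, poissonVar p Y z = z * V z)
    (hmean : ∀ z > 0, HasDerivAt (poissonMean p Y) (f z) z) :
    ArePoissonFluctuations p Y c b δ η := by
  refine ⟨hV.1, h.1, ?_, ?_⟩
  · have h1 := hV.2.1.mul_isBigO (isBigO_refl (fun z : ℝ => z) atTop)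
    refine h1.congr' ?_ (Eventually.of_forall fun z => one_mul z)
    filter_upwards [eventually_gt_atTop 0] with z hz
    rw [hvar z hz]
    ring
  · refine (((isLittleO_one_iff ℝ).1 h.2.1)).congr' ?_
    filter_upwards [eventually_gt_atTop 0] with z hz
    rw [(hmean z hz).deriv]

end FluctuatesAround

theorem Tame.exists_fluctuatesAround (hm : 2 ≤ m) {g : ℝ → ℝ} {K : ℝ} (hg : Tame g K) :
    ∃ δ, FluctuatesAround p (fun z => potential p g (Real.log z)) ((∫ t, g t) / p.entropy) δ := by
  obtain ⟨δ, h1, h2, h3⟩ := hg.exists_fluctuation (p := p) hm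
  exact ⟨δ, h1, (isLittleO_one_iff ℝ).2 h2, h3⟩

theorem Tame.potential_log_isBigO (hm : 2 ≤ m) {g : ℝ → ℝ} {K : ℝ} (hg : Tame g K) :
    (fun z => potential p g (Real.log z)) =O[atTop] fun _ => (1 : ℝ) :=
  IsBigO.of_bound (K * (1 - p.powerSum 2)⁻¹) (Eventually.of_forall fun z => by
    simpa using hg.abs_potential_le hm (Real.log z))

end Fluctuation

/-! ### Poisson mean and variance of a sum of two counts -/

section PoissonSum

/-- Counts are at most n, so all moments in use are at most n² ≤ 4^n, and the exponential series at
4|z| dominates. -/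
theorem summable_mul_pow_div_factorial {a : ℕ → ℝ} (ha : ∀ n : ℕ, |a n| ≤ (n : ℝ) ^ 2) (z : ℝ) :
    Summable fun n : ℕ => a n * (z ^ n / (n ! : ℝ)) := by
  refine Summable.of_norm_bounded (Real.summable_pow_div_factorial (4 * |z|)) fun n => ?_
  have h1 : (n : ℝ) ^ 2 ≤ 4 ^ n := by
    have h2 : (n : ℝ) ≤ 2 ^ n := by exact_mod_cast Nat.lt_two_pow_self.le
    calc (n : ℝ) ^ 2 ≤ (2 ^ n) ^ 2 := pow_le_pow_left₀ (Nat.cast_nonneg n) h2 2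
      _ = 4 ^ n := by rw [← pow_mul, mul_comm, pow_mul]; norm_num
  rw [Real.norm_eq_abs, abs_mul, abs_div, abs_pow, Nat.abs_cast, mul_pow, mul_div_assoc]
  exact mul_le_mul_of_nonneg_right ((ha n).trans h1) (by positivity)

theorem poissonize_add {a b : ℕ → ℝ} (ha : ∀ n : ℕ, |a n| ≤ (n : ℝ) ^ 2)
    (hb : ∀ n : ℕ, |b n| ≤ (n : ℝ) ^ 2) (z : ℝ) :
    poissonize (fun n => a n + b n) z = poissonize a z + poissonize b z := by
  rw [poissonize, poissonize, poissonize, ← mul_add,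
    ← (summable_mul_pow_div_factorial ha z).tsum_add (summable_mul_pow_div_factorial hb z)]
  simp only [add_mul]

theorem abs_integral_count_le (hT : 2 ≤ T.size) (n : ℕ) :
    |∫ S, T.count n S ∂p.law| ≤ (n : ℝ) ^ 2 := by
  rw [← Real.norm_eq_abs]
  refine (norm_integral_le_of_norm_le_const (μ := p.law) (C := (n : ℝ))
    (Eventually.of_forall fun S => ?_)).trans ?_
  · rw [Real.norm_of_nonneg (count_nonneg n S)]; exact count_le hT n S
  · rw [probReal_univ, mul_one]; exact_mod_cast Nat.le_self_pow two_ne_zero n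

theorem abs_integral_count_mul_le (hT : 2 ≤ T.size) (hT' : 2 ≤ T'.size) (n : ℕ) :
    |∫ S, T.count n S * T'.count n S ∂p.law| ≤ (n : ℝ) ^ 2 := by
  rw [← Real.norm_eq_abs]
  refine (norm_integral_le_of_norm_le_const (μ := p.law) (C := (n : ℝ) ^ 2)
    (Eventually.of_forall fun S => ?_)).trans ?_
  · rw [Real.norm_of_nonneg (mul_nonneg (count_nonneg n S) (count_nonneg n S)), sq]
    exact mul_le_mul (count_le hT n S) (count_le hT' n S) (count_nonneg n S) (Nat.cast_nonneg n)
  · rw [probReal_univ, mul_one]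

theorem poissonMean_count_add (hm : 2 ≤ m) (hT : 2 ≤ T.size) (hT' : 2 ≤ T'.size) (z : ℝ) :
    poissonMean p (fun n S => T.count n S + T'.count n S) z =
      poissonMean p T.count z + poissonMean p T'.count z := by
  have h1 := poissonize_add (abs_integral_count_le (p := p) hT) (abs_integral_count_le (p := p) hT') z
  rw [poissonMean, poissonMean, poissonMean, ← h1]
  congr 1
  funext n
  exact integral_add ((memLp_count p hm hT n).integrable one_le_two)
    ((memLp_count p hm hT' n).integrable one_le_two)

theorem poissonVar_count (hm : 2 ≤ m) (hT : 2 ≤ T.size) {z : ℝ} (hz : 0 < z) :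
    poissonVar p T.count z = z * potential p (covFun p T T) (Real.log z) := by
  rw [← poissonCov_count hm hT hT (Or.inl rfl) hz, poissonVar]
  simp only [sq]

theorem poissonVar_count_add (hm : 2 ≤ m) (hT : 2 ≤ T.size) (hT' : 2 ≤ T'.size)
    (h : T.Compatible T') {z : ℝ} (hz : 0 < z) :
    poissonVar p (fun n S => T.count n S + T'.count n S) z =
      z * (potential p (covFun p T T) (Real.log z) + potential p (covFun p T' T') (Real.log z) +
        2 * potential p (covFun p T T') (Real.log z)) := by
  have h1 := poissonCov_count (p := p) hm hT hT (Or.inl rfl) hz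
  have h2 := poissonCov_count (p := p) hm hT' hT' (Or.inl rfl) hz
  have h3 := poissonCov_count (p := p) hm hT hT' h hz
  have hexp : (fun n => ∫ S, (T.count n S + T'.count n S) ^ 2 ∂p.law) =
      fun n => (∫ S, T.count n S * T.count n S ∂p.law) + (∫ S, T'.count n S * T'.count n S ∂p.law) +
        2 * ∫ S, T.count n S * T'.count n S ∂p.law := by
    funext n
    have i₁ := integrable_count_mul p hm hT hT n
    have i₂ := integrable_count_mul p hm hT' hT' n
    have i₃ := (integrable_count_mul p hm hT hT' n).const_mul 2
    have i₁₂ : Integrable (fun S => T.count n S * T.count n S + T'.count n S * T'.count n S)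
      p.law := i₁.add i₂
    rw [← integral_const_mul, ← integral_add i₁ i₂, ← integral_add i₁₂ i₃]
    congr 1
    funext S
    ring
  have s₁ := summable_mul_pow_div_factorial (abs_integral_count_mul_le (p := p) hT hT) z
  have s₂ := summable_mul_pow_div_factorial (abs_integral_count_mul_le (p := p) hT' hT') z
  have s₃ := summable_mul_pow_div_factorial (abs_integral_count_mul_le (p := p) hT hT') z
  have hlin : poissonize (fun n => (∫ S, T.count n S * T.count n S ∂p.law) +
      (∫ S, T'.count n S * T'.count n S ∂p.law) + 2 * ∫ S, T.count n S * T'.count n S ∂p.law) z =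
      poissonize (fun n => ∫ S, T.count n S * T.count n S ∂p.law) z +
      poissonize (fun n => ∫ S, T'.count n S * T'.count n S ∂p.law) z +
      2 * poissonize (fun n => ∫ S, T.count n S * T'.count n S ∂p.law) z := by
    simp only [poissonize, add_mul, mul_assoc]
    rw [(s₁.add s₂).tsum_add (s₃.mul_left 2), s₁.tsum_add s₂, tsum_mul_left]
    ring
  rw [poissonVar, hexp, hlin, poissonMean_count_add hm hT hT']
  linear_combination h1 + h2 + 2 * h3

end PoissonSum

/-! ### Linear growth of the covariances and conclusion -/

section LinearTerms

theorem exists_fluctuatesAround_covFun (hm : 2 ≤ m) (hT : 2 ≤ T.size) (hT' : 2 ≤ T'.size) :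
    ∃ δ, FluctuatesAround p (fun z => potential p (covFun p T T') (Real.log z))
      (diag T T' (meanCoeff p T) + covCoeff p T T') δ := by
  obtain ⟨K, hK⟩ := exists_tame_covFun (p := p) hm hT hT'
  rw [← integral_covFun hm hT hT']
  exact hK.exists_fluctuatesAround hm

theorem exists_fluctuatesAround_slopeFun (hm : 2 ≤ m) (hT : 2 ≤ T.size) :
    ∃ δ, FluctuatesAround p (fun z => potential p (T.slopeFun p) (Real.log z)) (meanCoeff p T) δ := by
  obtain ⟨K, hK⟩ := exists_tame_slopeFun (p := p) hT
  rw [← integral_slopeFun_div hm hT]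
  exact hK.exists_fluctuatesAround hm

theorem linearAsymptotics_covariance (hm : 2 ≤ m) (hT : 2 ≤ T.size) (hT' : 2 ≤ T'.size)
    (h : T.Compatible T') {c : ℝ} {δ η η' : ℝ → ℝ}
    (hV : FluctuatesAround p (fun z => potential p (covFun p T T') (Real.log z)) c δ)
    (hf : FluctuatesAround p (fun z => potential p (T.slopeFun p) (Real.log z)) (meanCoeff p T) η)
    (hf' : FluctuatesAround p (fun z => potential p (T'.slopeFun p) (Real.log z))
      (meanCoeff p T') η') :
    LinearAsymptotics p (fun n => covariance (T.count n) (T'.count n) p.law)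
      fun n => c + δ n - (meanCoeff p T + η n) * (meanCoeff p T' + η' n) := by
  obtain ⟨C, hC⟩ := exists_abs_covariance_sub_le (p := p) hm hT hT' h
  obtain ⟨K, hK⟩ := exists_tame_slopeFun (p := p) hT
  obtain ⟨K', hK'⟩ := exists_tame_slopeFun (p := p) hT'
  exact hV.linearAsymptotics hf hf' (hK.potential_log_isBigO hm) (hK'.potential_log_isBigO hm)
    ((eventually_ge_atTop _).mono hC)

end LinearTerms

end DigitalTree

open DigitalTree
theorem theorem2 (m : ℕ) (hm : 2 ≤ m) (p : Source m) :
    ∃ (δ δhat : Motif m → ℝ → ℝ) (δ₂ δhat₂ : Motif m → Motif m → ℝ → ℝ),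
      (∀ T : Motif m, 2 ≤ T.size →
        ArePoissonFluctuations p T.count (varCoeff p T) (meanCoeff p T) (δ T) (δhat T) ∧
        LinearAsymptotics p (fun n => variance (T.count n) p.law)
          (fun n => varCoeff p T + δ T n - (meanCoeff p T + δhat T n) ^ 2)) ∧
      (∀ T T' : Motif m, T.Nonoverlapping T' →
        ArePoissonFluctuations p (fun n S => T.count n S + T'.count n S)
          (varCoeff p T + varCoeff p T' + 2 * covCoeff p T T')
          (meanCoeff p T + meanCoeff p T') (δ₂ T T') (δhat₂ T T') ∧
        LinearAsymptotics p (fun n => covariance (T.count n) (T'.count n) p.law)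
          (fun n => covCoeff p T T' + 1 / 2 * (δ₂ T T' n - δ T n - δ T' n)
            - T.shape p * T'.shape p /
                ((T.size : ℝ) * (T.size - 1) * T'.size * (T'.size - 1) * p.entropy ^ 2)
            + 1 / p.entropy *
                (T.shape p / ((T.size : ℝ) * (T.size - 1)) * (δhat T n - δhat₂ T T' n)
                  + T'.shape p / ((T'.size : ℝ) * (T'.size - 1)) * (δhat T' n - δhat₂ T T' n))
            - 1 / 2 * (δhat₂ T T' n ^ 2 - δhat T n ^ 2 - δhat T' n ^ 2))) := by
  -- The size conditions stand behind the existential, with default value 0 for smaller motifs, so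
  -- that `choose` yields functions of the motifs alone.
  have hV : ∀ T T' : Motif m, ∃ δ, 2 ≤ T.size → 2 ≤ T'.size →
      FluctuatesAround p (fun z => potential p (covFun p T T') (Real.log z))
        (diag T T' (meanCoeff p T) + covCoeff p T T') δ := fun T T' => by
    by_cases h : 2 ≤ T.size ∧ 2 ≤ T'.size
    · obtain ⟨δ, hδ⟩ := exists_fluctuatesAround_covFun (p := p) hm h.1 h.2
      exact ⟨δ, fun _ _ => hδ⟩
    · exact ⟨0, fun h1 h2 => absurd ⟨h1, h2⟩ h⟩
  have hf : ∀ T : Motif m, ∃ δ, 2 ≤ T.size →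
      FluctuatesAround p (fun z => potential p (T.slopeFun p) (Real.log z)) (meanCoeff p T) δ :=
    fun T => by
    by_cases h : 2 ≤ T.size
    · obtain ⟨δ, hδ⟩ := exists_fluctuatesAround_slopeFun (p := p) hm h
      exact ⟨δ, fun _ => hδ⟩
    · exact ⟨0, fun h1 => absurd h1 h⟩
  choose δc hV using hV
  choose δh hf using hf
  have hVd : ∀ T : Motif m, 2 ≤ T.size →
      FluctuatesAround p (fun z => potential p (covFun p T T) (Real.log z)) (varCoeff p T)
        (δc T T) := fun T hT => by
    have h := hV T T hT hT
    rwa [diag, if_pos rfl, ← varCoeff_eq hT] at h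
  -- Var(X + X') = Var X + Var X' + 2 Cov(X, X') dictates δ₂, and linearity of the mean dictates
  -- δhat₂.
  refine ⟨fun T => δc T T, δh, fun T T' z => δc T T z + δc T' T' z + 2 * δc T T' z,
    fun T T' z => δh T z + δh T' z, fun T hT => ⟨?_, ?_⟩, fun T T' h => ?_⟩
  · exact (hVd T hT).arePoissonFluctuations (hf T hT) (fun z hz => poissonVar_count hm hT hz)
      fun z hz => hasDerivAt_poissonMean hm hT hz
  · have h := linearAsymptotics_covariance hm hT hT (Or.inl rfl) (hVd T hT) (hf T hT) (hf T hT)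
    simp only [covariance_self (aemeasurable_count p hm hT _)] at h
    simpa only [sq] using h
  · have hT := h.two_le_size hm
    have hT' := h.symm.two_le_size hm
    -- A motif appears in itself at the root, so the diagonal term is absent.
    have hne : T ≠ T' := by
      rintro rfl
      exact h.1 ⟨[], by simp [subtree]⟩
    have hVc := hV T T' hT hT'
    rw [diag, if_neg hne, zero_add] at hVc
    refine ⟨?_, ?_⟩
    · refine (((hVd T hT).add (hVd T' hT')).add (hVc.const_mul 2)).arePoissonFluctuations
        ((hf T hT).add (hf T' hT'))
        (fun z hz => poissonVar_count_add hm hT hT' (Or.inr h) hz) fun z hz => ?_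
      have e : poissonMean p (fun n S => T.count n S + T'.count n S) =
          fun z => poissonMean p T.count z + poissonMean p T'.count z :=
        funext fun z => poissonMean_count_add hm hT hT' z
      rw [e]
      exact (hasDerivAt_poissonMean hm hT hz).add (hasDerivAt_poissonMean hm hT' hz)
    · have h := linearAsymptotics_covariance hm hT hT' (Or.inr h) hVc (hf T hT) (hf T' hT')
      -- Half the excess of δ₂ is the fluctuation of the covariance, and the remaining terms
      -- recombine to minus the product of the two values `meanCoeff` plus δhat.
      convert! h using 2 with n
      have hmean : ∀ T : Motif m, 1 / p.entropy * (T.shape p / ((T.size : ℝ) * (T.size - 1))) =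
          meanCoeff p T := fun T => by
        rw [meanCoeff, one_div, mul_comm, ← div_eq_mul_inv, div_div]
      have hprod : T.shape p * T'.shape p /
          ((T.size : ℝ) * (T.size - 1) * T'.size * (T'.size - 1) * p.entropy ^ 2) =
          meanCoeff p T * meanCoeff p T' := by
        rw [meanCoeff, meanCoeff, div_mul_div_comm]
        ring_nf
      rw [hprod, mul_add, ← mul_assoc, ← mul_assoc, hmean, hmean]
      ring
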